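/- **Notation.** Let $\mathbb D$ be the open unit disk and $\mathbb S^1$ the unit circle; $|J|$ denotes arc length. *Beurling–Carleson sets.* A Beurling–Carleson set is a non-empty closed set $E\subset\mathbb S^1$ of zero length such that $\|E\|_{BC}=\sum_J |J|\log\frac1{|J|}<\infty$, where $J$ runs over the components of $\mathbb S^1\setminus E$. The set $BC$ of all of them has the topology in which $E_n\to E$ if and only if $E_n\to E$ in the Hausdorff metric and $\|E_n\|_{BC}\to\|E\|_{BC}$. The Korenblum star of $E$ is $$K_E=\{|z|\le 1/\sqrt2\}\cup\{z\in\overline{\mathbb D}: 1-|z|\ge \operatorname{dist}(z/|z|,E)\}.$$ *Inner functions.* An inner function is a holomorphic $I:\mathbb D\to\overline{\mathbb D}$ whose radial limits exist and have absolute value $1$ almost everywhere. Write $I=cBS_\sigma$, where $|c|=1$, $B$ is the Blaschke product with the zeros $a_i$ of $I$ (with multiplicity), and $S_\sigma(z)=\exp\bigl(-\int_{\mathbb S^1}\frac{\zeta+z}{\zeta-z}\,d\sigma(\zeta)\bigr)$ with $\sigma$ a finite positive measure on $\mathbb S^1$ singular to arc length. The zero structure of $I$ is the measure $\mu(I)=\sum_i(1-|a_i|)\delta_{a_i}+\sigma$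 on $\overline{\mathbb D}$. *Bergman spaces.* For $1\le p<\infty$ and $\alpha>-1$, $A^p_\alpha$ is the space of holomorphic $f$ on $\mathbb D$ with $\|f\|_{A^p_\alpha}=\bigl(\int_{\mathbb D}|f(z)|^p(1-|z|)^\alpha\,|dz|^2\bigr)^{1/p}<\infty$, and $[I]$ is the closure in $A^p_\alpha$ of $\{PI: P \text{ a polynomial}\}$. *Carleson families.* A Carleson family is a family $(\Phi_E)_{E\in BC}$ of outer functions such that: 1. $\Phi_E\in C^\infty(\overline{\mathbb D})$, and $\Phi_E$ vanishes on $\overline{\mathbb D}$ precisely on $E$ (to infinite order, by 3); 2. for each $E\in BC$, $\Phi_{E'}\to\Phi_{E}$ uniformly on compact subsets of $\mathbb D$ as $E'\to E$ in $BC$; 3. for every integer $N\ge0$ there is a continuous function $E\mapsto C_E(N)$ on $BC$, with $C_E(0)=1$, such that $|\Phi_E(z)|\le C_E(N)\operatorname{dist}(z,E)^N$ for all $z\in\mathbb D$. Powers $\Phi_E^\delta=\exp(\delta\log\Phi_E)$ are formed with any holomorphic branch of $\log\Phi_E$ on $\mathbb D$. **Theorem 5.2 (Korenblum's division principle).** Carleson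 families exist. Moreover, for every Carleson family $(\Phi_E)$, every $1\le p<\infty$ and every $\alpha>-1$ there is a function $(E,\delta,M)\mapsto C_E(\delta,M)$, continuous on $BC\times(0,\infty)\times[0,\infty)$, with the following property. Let $E\in BC$, let $I$ be an inner function with $\operatorname{supp}\mu(I)\subset K_E$, let $f\in[I]\subset A^p_\alpha$ and let $\delta>0$. Then $f^\delta=(\Phi_E^\delta/I)\,f$ (extended over its removable singularities at the zeros of $I$) belongs to $A^p_\alpha$, and $$\|f^\delta\|_{A^p_\alpha}\le C_E\bigl(\delta,\mu(I)(\overline{\mathbb D})\bigr)\,\|f\|_{A^p_\alpha}.$$ -/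

import Mathlib

open Set Filter Topology MeasureTheory Metric
open scoped ENNReal

noncomputable section

/-! ### Beurling-Carleson sets and Korenblum stars -/

/-- Arc length on the unit circle (total mass `2π`), as a measure on `ℂ`. -/
def arcLength : Measure ℂ :=
  (volume.restrict (Ioc (0 : ℝ) (2 * Real.pi))).map (circleMap 0 1)

/-- The complementary arcs of `E`: the connected components of the unit circle minus `E`. -/
def complementaryArcs (E : Set ℂ) : Set (Set ℂ) :=
  {J | ∃ x ∈ sphere (0 : ℂ) 1 \ E, J = connectedComponentIn (sphere (0 : ℂ) 1 \ E) x}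

/-- The contribution `|J| log (1 / |J|)` of an arc `J` to the entropy. -/
def arcEntropy (J : Set ℂ) : ℝ :=
  arcLength.real J * Real.log (1 / arcLength.real J)

/-- A (non-empty) Beurling-Carleson set: a closed subset of the unit circle of zero length, whose
complementary arcs satisfy `∑ |J| log (1 / |J|) < ∞`. -/
structure BeurlingCarlesonSet where
  /-- The underlying set (non-empty and compact). -/
  toNonemptyCompacts : TopologicalSpace.NonemptyCompacts ℂ
  subset_circle : (toNonemptyCompacts : Set ℂ) ⊆ sphere 0 1
  arcLength_eq_zero : arcLength (toNonemptyCompacts : Set ℂ) = 0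
  summable_arcEntropy :
    Summable fun J : complementaryArcs (toNonemptyCompacts : Set ℂ) => arcEntropy J

namespace BeurlingCarlesonSet

/-- The underlying set of points. -/
def carrier (E : BeurlingCarlesonSet) : Set ℂ := (E.toNonemptyCompacts : Set ℂ)

/-- The entropy (or norm) `‖E‖_BC = ∑ |J| log (1 / |J|)`. -/
def entropy (E : BeurlingCarlesonSet) : ℝ :=
  ∑' J : complementaryArcs E.carrier, arcEntropy J

/-- The Korenblum topology: `E n → E` if and only if `E n → E` in the Hausdorff metric and
`‖E n‖_BC → ‖E‖_BC`. (`NonemptyCompacts ℂ` carries the Hausdorff metric in Mathlib.) -/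
instance : TopologicalSpace BeurlingCarlesonSet :=
  TopologicalSpace.induced
    (fun E : BeurlingCarlesonSet => (E.toNonemptyCompacts, E.entropy)) inferInstance

/-- The Korenblum star `K_E`: the union of a disk and of the Stolz angles with vertices in `E`. -/
def korenblumStar (E : BeurlingCarlesonSet) : Set ℂ :=
  closedBall 0 (1 / √2) ∪
    {z | z ∈ closedBall (0 : ℂ) 1 ∧ infDist (z / (‖z‖ : ℂ)) E.carrier ≤ 1 - ‖z‖}

end BeurlingCarlesonSet

/-! ### Inner functions and their zero structure -/

/-- Inner functions: holomorphic functions on the unit disk, bounded by one, having radial limits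
of absolute value one almost everywhere. Unimodular constants are included. -/
structure IsInner (I : ℂ → ℂ) : Prop where
  differentiableOn : DifferentiableOn ℂ I (ball 0 1)
  mapsTo : MapsTo I (ball 0 1) (closedBall 0 1)
  radialLimit : ∀ᵐ θ : ℝ, ∃ w : ℂ, ‖w‖ = 1 ∧
    Tendsto (fun r : ℝ => I (circleMap 0 r θ)) (𝓝[<] 1) (𝓝 w)

/-- The elementary Blaschke factor with zero at `a`. -/
def blaschkeFactor (a z : ℂ) : ℂ :=
  if a = 0 then z else (‖a‖ : ℂ) / a * ((a - z) / (1 - (starRingEnd ℂ) a * z))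

/-- The Blaschke product formed with the zeros of `I` in the unit disk, with multiplicity. -/
def blaschkeProduct (I : ℂ → ℂ) (z : ℂ) : ℂ :=
  ∏' a : ball (0 : ℂ) 1, blaschkeFactor a z ^ analyticOrderNatAt I a

/-- The singular inner function `exp (-∫ (ζ + z) / (ζ - z) dσ(ζ))`. -/
def singularInner (σ : Measure ℂ) (z : ℂ) : ℂ :=
  Complex.exp (-∫ ζ, herglotzRieszKernel 0 z ζ ∂σ)

/-- The measure `∑ (1 - |a|) δ_a`, summed over the zeros of `I` in the unit disk, with
multiplicity. -/
def blaschkeMeasure (I : ℂ → ℂ) : Measure ℂ :=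
  Measure.sum fun a : ball (0 : ℂ) 1 =>
    ENNReal.ofReal (analyticOrderNatAt I (a : ℂ) * (1 - ‖(a : ℂ)‖)) • Measure.dirac (a : ℂ)

/-- `μ` is the zero structure `μ(I)` of `I`: one has `I = c B S_σ` where `|c| = 1`, `B` is the
Blaschke product with the zeros of `I` and `S_σ` is the singular inner function of a finite measure
`σ` on the unit circle, singular to arc length, and `μ = ∑ (1 - |a|) δ_a + σ`. -/
def HasZeroStructure (I : ℂ → ℂ) (μ : Measure ℂ) : Prop :=
  ∃ (c : ℂ) (σ : Measure ℂ), ‖c‖ = 1 ∧ IsFiniteMeasure σ ∧ σ (sphere 0 1)ᶜ = 0 ∧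
    σ.MutuallySingular arcLength ∧
    (Summable fun a : ball (0 : ℂ) 1 =>
      (analyticOrderNatAt I (a : ℂ) : ℝ) * (1 - ‖(a : ℂ)‖)) ∧
    (∀ z ∈ ball (0 : ℂ) 1, I z = c * blaschkeProduct I z * singularInner σ z) ∧
    μ = blaschkeMeasure I + σ

/-! ### Weighted Bergman spaces -/

/-- The norm `(∫_𝔻 |f(z)|^p (1 - |z|)^α |dz|²)^(1/p)`, possibly infinite. -/
def bergmanNorm (p α : ℝ) (f : ℂ → ℂ) : ℝ≥0∞ :=
  (∫⁻ z in ball (0 : ℂ) 1, ‖f z‖ₑ ^ p * ENNReal.ofReal ((1 - ‖z‖) ^ α)) ^ (1 / p)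

/-- Membership in the weighted Bergman space `A^p_α`. Only the values on the unit disk matter. -/
def MemBergman (p α : ℝ) (f : ℂ → ℂ) : Prop :=
  DifferentiableOn ℂ f (ball 0 1) ∧ bergmanNorm p α f < ⊤

/-- Membership in the closed `z`-invariant subspace `[h]` generated by `h`: the closure in `A^p_α`
of the polynomial multiples of `h`. -/
def MemInvariantSubspace (p α : ℝ) (h f : ℂ → ℂ) : Prop :=
  MemBergman p α f ∧ ∀ ε : ℝ≥0∞, 0 < ε →
    ∃ P : Polynomial ℂ, bergmanNorm p α (fun z => f z - P.eval z * h z) < ε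

/-! ### Outer functions vanishing on Beurling-Carleson sets -/

/-- Outer functions on the unit disk: `F(z) = c exp (1/2π ∫ (ζ + z) / (ζ - z) w(ζ) |dζ|)` with
`|c| = 1` and `w` real-valued and integrable on the unit circle. -/
def IsOuter (F : ℂ → ℂ) : Prop :=
  ∃ (c : ℂ) (w : ℂ → ℝ), ‖c‖ = 1 ∧ CircleIntegrable w 0 1 ∧
    ∀ z ∈ ball (0 : ℂ) 1,
      F z = c * Complex.exp
        (Real.circleAverage (fun ζ => herglotzRieszKernel 0 z ζ * (w ζ : ℂ)) 0 1)

/-- A Carleson family: a choice, for each Beurling-Carleson set `E`, of an outer function `Φ E`,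
smooth up to the boundary, which vanishes precisely on `E` and does so to infinite order (this is
part of the bound in `decay`), and which varies continuously with `E`. -/
structure IsCarlesonFamily (Φ : BeurlingCarlesonSet → ℂ → ℂ) : Prop where
  isOuter : ∀ E, IsOuter (Φ E)
  smooth : ∀ E, ContDiffOn ℝ (⊤ : ℕ∞) (Φ E) (closedBall 0 1)
  eq_zero_iff : ∀ E, ∀ z ∈ closedBall (0 : ℂ) 1, Φ E z = 0 ↔ z ∈ E.carrier
  /-- If `E' → E` then `Φ E' → Φ E` uniformly on compact subsets of the disk. -/
  tendsto : ∀ E, TendstoLocallyUniformlyOn Φ (Φ E) (𝓝 E) (ball 0 1)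
  /-- `|Φ E z| ≤ C_E(N) dist(z, E)^N` with `C_E(N)` continuous in `E`, and `C_E(0) = 1`. -/
  decay : ∃ C : ℕ → BeurlingCarlesonSet → ℝ, (∀ N, Continuous (C N)) ∧ (∀ E, C 0 E = 1) ∧
    ∀ N E, ∀ z ∈ ball (0 : ℂ) 1, ‖Φ E z‖ ≤ C N E * infDist z E.carrier ^ N

end

/-! Division. Write D = dist(z, E), Ψ = Φ_E^δ and s = (2 + |α|)/p. If the zero structure of I lives
on the Korenblum star, then |1 - āz| ≥ D/7 for every zero a, and the singular part is carried by E.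
Hence |I| ≥ e^{-2M}, with M = μ(I)(closed disk), on the region 1 - |z| ≤ D²/112
(`HasZeroStructure.exp_neg_le_norm`). For a polynomial P this controls |ΨP| ≤ |P| ≤ e^{2M}|PI|
there. The rest of the disk touches the circle only on E. On the common boundary inside the disk 1 -
|z| = D²/112, so the point evaluation bound |PI| ≤ K(1 - |z|)^{-s}‖PI‖ costs a factor D^{-2s}, which
the decay |Ψ| ≤ κD^{2s} absorbs, and the maximum principle bounds ΨP by a multiple of ‖PI‖
(`norm_mul_le_of_infDist_rpow`). Thus ‖ΨP‖ ≤ C‖PI‖ for all polynomials, and the estimate passes to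
the closure [I] (`exists_division`). The constant is explicit except for κ, which exists locally
uniformly in (E, δ) and is made continuous by a partition of unity.

Existence. Integrating over the gaps shows that the entropy is, up to a constant, the integral of
log(1/dist(·, E)) over the circle. So convergence in BC is Hausdorff convergence plus convergence of
these integrals, and Scheffé's lemma turns it into L¹ convergence of the logarithms. Summing the
truncations (log(4/dist) - T_k)⁺, with levels T_k continuous in E and chosen so that the k-th term
has integral at most 2^{-k}, gives a weight W that is integrable, continuous in E in L¹, and larger
than every multiple of log(1/dist) up to a constant.

The outer function is exp(-H), where H(z) integrates W(ζ)(a + z)/(a - z) over the circle with the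
pole moved off it to a = (1 + dist(ζ, E))ζ. This makes H holomorphic across the circle away from E,
with |H| ≤ 40/D, while Re H still dominates W/34 at scale D (`le_re_herglotz`), so exp(-H) vanishes
to infinite order on E. Each derivative of exp(-H) is exp(-H) times a function of at most power
growth in 1/D, whence smoothness up to the boundary. Outerness follows from Schwarz's formula for
each pole and Fubini. -/

noncomputable section

/-! ### Weighted Bergman spaces: norms, point evaluations -/

/-- The measure `(1 - |z|)^α |dz|²` on the unit disk. -/
def diskMeasure (α : ℝ) : Measure ℂ :=
  (volume.restrict (ball (0 : ℂ) 1)).withDensity fun z => ENNReal.ofReal ((1 - ‖z‖) ^ α)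

lemma measurable_diskWeight (α : ℝ) :
    Measurable fun z : ℂ => ENNReal.ofReal ((1 - ‖z‖) ^ α) := by
  fun_prop

lemma diskMeasure_absolutelyContinuous (α : ℝ) :
    diskMeasure α ≪ volume.restrict (ball (0 : ℂ) 1) :=
  withDensity_absolutelyContinuous _ _

/-- Gives access to Minkowski's inequality and Fatou's lemma in Lᵖ. -/
lemma bergmanNorm_eq_eLpNorm {p : ℝ} (hp : 1 ≤ p) (α : ℝ) (f : ℂ → ℂ) :
    bergmanNorm p α f = eLpNorm f (ENNReal.ofReal p) (diskMeasure α) := by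
  have hp0 : 0 < p := by linarith
  rw [eLpNorm_eq_lintegral_rpow_enorm_toReal (by simpa using hp0) ENNReal.ofReal_ne_top,
    ENNReal.toReal_ofReal hp0.le, bergmanNorm, diskMeasure,
    lintegral_withDensity_eq_lintegral_mul_non_measurable _ (measurable_diskWeight α)
      (Eventually.of_forall fun _ => ENNReal.ofReal_lt_top)]
  simp only [Pi.mul_apply, mul_comm]

lemma ContinuousOn.aestronglyMeasurable_diskMeasure {f : ℂ → ℂ} (hf : ContinuousOn f (ball 0 1))
    (α : ℝ) : AEStronglyMeasurable f (diskMeasure α) :=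
  (hf.aestronglyMeasurable measurableSet_ball).mono_ac (diskMeasure_absolutelyContinuous α)

/-- In polar coordinates the mass is a multiple of ∫₀¹ y(1 - y)^α dy, which converges because α >
-1. Finiteness is what lets a constant pointwise bound contribute to the Bergman norm. -/
lemma isFiniteMeasure_diskMeasure {α : ℝ} (hα : -1 < α) : IsFiniteMeasure (diskMeasure α) := by
  have key : IntegrableOn (fun y : ℝ => y ^ (Module.finrank ℝ ℂ - 1) •
      (Iio (1 : ℝ)).indicator (fun y => (1 - y) ^ α) y) (Ioi 0) := by
    have h0 : IntegrableOn (fun y : ℝ => (1 - y) ^ α) (Ioo 0 1) := by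
      have h1 := (intervalIntegral.intervalIntegrable_rpow' (a := 0) (b := 1) hα).comp_sub_left 1
      simp only [sub_zero, sub_self] at h1
      exact ((intervalIntegrable_iff_integrableOn_Ioo_of_le zero_le_one).1 h1.symm)
    have h1 : IntegrableOn (fun y : ℝ => y • (1 - y) ^ α) (Ioo 0 1) := by
      refine Integrable.mono h0 ?_ ?_
      · exact (measurable_id.smul (by fun_prop)).aestronglyMeasurable
      · filter_upwards [ae_restrict_mem measurableSet_Ioo] with y hy
        rw [norm_smul]
        refine mul_le_of_le_one_left (norm_nonneg _) ?_
        rw [Real.norm_eq_abs, abs_le]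
        constructor <;> linarith [hy.1, hy.2]
    have h2 : (fun y : ℝ => y ^ (Module.finrank ℝ ℂ - 1) •
        (Iio (1 : ℝ)).indicator (fun y => (1 - y) ^ α) y) =
        (Iio (1 : ℝ)).indicator (fun y => y • (1 - y) ^ α) := by
      ext y
      by_cases hy : y < 1 <;> simp [indicator, hy]
    rw [h2, IntegrableOn, integrable_indicator_iff measurableSet_Iio, IntegrableOn,
      Measure.restrict_restrict measurableSet_Iio]
    rwa [show Iio (1 : ℝ) ∩ Ioi 0 = Ioo 0 1 by ext y; simp [and_comm]]
  have h3 := (integrable_fun_norm_addHaar (volume : Measure ℂ)).2 key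
  refine ⟨?_⟩
  rw [diskMeasure, withDensity_apply _ MeasurableSet.univ, Measure.restrict_univ]
  have h4 : Integrable (fun z : ℂ => (1 - ‖z‖) ^ α) (volume.restrict (ball (0 : ℂ) 1)) := by
    refine (h3.restrict (s := ball (0 : ℂ) 1)).congr ?_
    filter_upwards [ae_restrict_mem measurableSet_ball] with z hz
    have : ‖z‖ < 1 := by simpa using hz
    simp [indicator, this]
  refine lt_of_le_of_lt (lintegral_mono fun z => ?_) h4.2
  exact Real.ofReal_le_enorm _

/-- Sub-mean value property over disks. -/
lemma enorm_mul_volume_ball_le {f : ℂ → ℂ} {z : ℂ} {r : ℝ} (hr : 0 < r)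
    (hf : DifferentiableOn ℂ f (ball z r)) :
    ‖f z‖ₑ * volume (ball z r) ≤ ∫⁻ w in ball z r, ‖f w‖ₑ := by
  set F : ℂ → ℝ≥0∞ := fun w => (ball (0 : ℂ) r).indicator (fun w => ‖f (z + w)‖ₑ) w with hF
  have hcont : ContinuousOn (fun w => ‖f (z + w)‖ₑ) (ball (0 : ℂ) r) := by
    refine continuous_enorm.comp_continuousOn (hf.continuousOn.comp (by fun_prop) ?_)
    intro w hw
    simpa using hw
  have hFm : Measurable F := by
    classical
    have : F = (ball (0 : ℂ) r).piecewise (fun w => ‖f (z + w)‖ₑ) fun _ => 0 := by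
      rw [hF]
      exact (piecewise_eq_indicator (f := fun w => ‖f (z + w)‖ₑ)).symm
    rw [this]
    exact hcont.measurable_piecewise continuousOn_const measurableSet_ball
  -- Mean value property on each circle, with the angle in the range (-π, π) of polar coordinates;
  -- integration against ρ dρ then gives the disk.
  have hmean : ∀ ρ ∈ Ioo (0 : ℝ) r, ‖f z‖ₑ * ENNReal.ofReal (2 * Real.pi) ≤
      ∫⁻ θ in Ioo (-Real.pi) Real.pi, F (Complex.polarCoord.symm (ρ, θ)) := by
    intro ρ hρ
    have h1 : Real.circleAverage f z ρ = f z := by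
      refine DiffContOnCl.circleAverage ?_
      rw [abs_of_pos hρ.1]
      refine DifferentiableOn.diffContOnCl (hf.mono ?_)
      exact closure_ball_subset_closedBall.trans (closedBall_subset_ball hρ.2)
    have hper : Function.Periodic (fun θ => f (circleMap z ρ θ)) (2 * Real.pi) := fun θ => by
      simp only [periodic_circleMap z ρ θ]
    have h2 : f z * (2 * Real.pi : ℝ) =
        ∫ θ in Ioo (-Real.pi) Real.pi, f (circleMap z ρ θ) := by
      rw [← integral_Ioc_eq_integral_Ioo,
        ← intervalIntegral.integral_of_le (by linarith [Real.pi_pos])]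
      have := hper.intervalIntegral_add_eq (-Real.pi) 0
      rw [show -Real.pi + 2 * Real.pi = Real.pi by ring, zero_add] at this
      rw [this]
      rw [Real.circleAverage_def] at h1
      rw [← h1]
      have hpi : (2 * Real.pi : ℂ) ≠ 0 := by
        exact_mod_cast (by positivity : (2 * Real.pi : ℝ) ≠ 0)
      rw [Complex.real_smul]
      push_cast
      field_simp
    calc ‖f z‖ₑ * ENNReal.ofReal (2 * Real.pi) = ‖f z * (2 * Real.pi : ℝ)‖ₑ := by
          rw [enorm_mul]
          congr 1
          rw [← ofReal_norm, Complex.norm_real, Real.norm_of_nonneg (by positivity)]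
      _ = ‖∫ θ in Ioo (-Real.pi) Real.pi, f (circleMap z ρ θ)‖ₑ := by rw [h2]
      _ ≤ ∫⁻ θ in Ioo (-Real.pi) Real.pi, ‖f (circleMap z ρ θ)‖ₑ :=
          enorm_integral_le_lintegral_enorm _
      _ = _ := by
          refine lintegral_congr fun θ => ?_
          have : Complex.polarCoord.symm (ρ, θ) ∈ ball (0 : ℂ) r := by
            rw [mem_ball_zero_iff, Complex.norm_polarCoord_symm, abs_of_pos hρ.1]
            exact hρ.2
          rw [hF]
          simp only
          rw [indicator_of_mem this]
          congr 2
          rw [Complex.polarCoord_symm_apply, circleMap, Complex.exp_mul_I]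
          push_cast
          rfl
  have htrans : ∫⁻ w in ball z r, ‖f w‖ₑ = ∫⁻ w, F w := by
    rw [← lintegral_indicator measurableSet_ball,
      ← lintegral_add_left_eq_self ((ball z r).indicator fun w => ‖f w‖ₑ) z]
    refine lintegral_congr fun w => ?_
    simp only [hF, indicator, mem_ball, dist_eq_norm, add_sub_cancel_left, sub_zero]
  rw [htrans, ← Complex.lintegral_comp_polarCoord_symm, Complex.volume_ball,
    polarCoord_target, Measure.volume_eq_prod, setLIntegral_prod]
  · have h3 : ∫⁻ ρ in Ioo (0 : ℝ) r, ENNReal.ofReal ρ = ENNReal.ofReal (r ^ 2 / 2) := by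
      rw [← ofReal_integral_eq_lintegral_ofReal, ← integral_Ioc_eq_integral_Ioo,
        ← intervalIntegral.integral_of_le hr.le, integral_id]
      · congr 1; ring
      · exact (continuous_id.integrableOn_Icc).mono_set Ioo_subset_Icc_self
      · filter_upwards [ae_restrict_mem measurableSet_Ioo] with ρ hρ using hρ.1.le
    calc ‖f z‖ₑ * (ENNReal.ofReal r ^ 2 * NNReal.pi)
        = (∫⁻ ρ in Ioo (0 : ℝ) r, ENNReal.ofReal ρ) *
            (‖f z‖ₑ * ENNReal.ofReal (2 * Real.pi)) := by
          rw [h3, ← ENNReal.ofReal_pow hr.le]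
          have : (NNReal.pi : ℝ≥0∞) = ENNReal.ofReal Real.pi := by
            rw [ENNReal.ofReal, Real.toNNReal_of_nonneg Real.pi_pos.le]; rfl
          rw [this, mul_left_comm (ENNReal.ofReal (r ^ 2 / 2)),
            ← ENNReal.ofReal_mul (by positivity), ← ENNReal.ofReal_mul (by positivity)]
          congr 2
          ring
      _ = ∫⁻ ρ in Ioo (0 : ℝ) r, ENNReal.ofReal ρ *
            (‖f z‖ₑ * ENNReal.ofReal (2 * Real.pi)) := by
          rw [lintegral_mul_const _ (by fun_prop)]
      _ ≤ ∫⁻ ρ in Ioo (0 : ℝ) r, ENNReal.ofReal ρ *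
            ∫⁻ θ in Ioo (-Real.pi) Real.pi, F (Complex.polarCoord.symm (ρ, θ)) := by
          refine setLIntegral_mono' measurableSet_Ioo fun ρ hρ => ?_
          gcongr
          exact hmean ρ hρ
      _ ≤ ∫⁻ ρ in Ioi (0 : ℝ), ENNReal.ofReal ρ *
            ∫⁻ θ in Ioo (-Real.pi) Real.pi, F (Complex.polarCoord.symm (ρ, θ)) :=
          lintegral_mono_set Ioo_subset_Ioi_self
      _ = _ := by
          refine lintegral_congr fun ρ => ?_
          rw [← lintegral_const_mul']
          · rfl
          · exact ENNReal.ofReal_ne_top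
  · refine Measurable.aemeasurable ?_
    refine Measurable.smul (measurable_fst.ennreal_ofReal) (hFm.comp ?_)
    have : (fun p : ℝ × ℝ => Complex.polarCoord.symm p) =
        fun p : ℝ × ℝ => (p.1 : ℂ) * (Real.cos p.2 + Real.sin p.2 * Complex.I) := by
      ext p
      rw [Complex.polarCoord_symm_apply]
    change Measurable fun p : ℝ × ℝ => Complex.polarCoord.symm p
    rw [this]
    fun_prop

/-- Point evaluations are bounded on weighted Bergman spaces. -/
lemma exists_enorm_le_bergmanNorm {p α : ℝ} (hp : 1 ≤ p) :
    ∃ K : ℝ, 0 < K ∧ ∀ f : ℂ → ℂ, DifferentiableOn ℂ f (ball 0 1) → ∀ z ∈ ball (0 : ℂ) 1,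
      ‖f z‖ₑ ≤ ENNReal.ofReal (K * ((1 - ‖z‖) ^ ((2 + |α|) / p))⁻¹) * bergmanNorm p α f := by
  have hp0 : 0 < p := by linarith
  refine ⟨(Real.pi⁻¹ * 2 ^ (2 + |α|)) ^ (1 / p), by positivity, fun f hf z hz => ?_⟩
  have hz1 : ‖z‖ < 1 := by simpa using hz
  -- On the disk of this radius r ≤ 1 - |w| ≤ 1, so the weight is at least r^|α| whatever the sign
  -- of α. The area contributes the remaining 2 in the exponent 2 + |α|, and Hölder compares L¹ with
  -- Lᵖ.
  set r := (1 - ‖z‖) / 2 with hr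
  have hr0 : 0 < r := by rw [hr]; linarith
  have hsub : ball z r ⊆ ball (0 : ℂ) 1 := by
    refine ball_subset_ball' ?_
    rw [dist_zero_right, hr]; linarith
  have h1 := enorm_mul_volume_ball_le hr0 (hf.mono hsub)
  have hm : AEStronglyMeasurable f (volume.restrict (ball z r)) :=
    (hf.mono hsub).continuousOn.aestronglyMeasurable measurableSet_ball
  have h2 := eLpNorm_le_eLpNorm_mul_rpow_measure_univ (p := 1) (q := ENNReal.ofReal p)
    (by simpa using hp) hm
  rw [eLpNorm_one_eq_lintegral_enorm, Measure.restrict_apply_univ,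
    ENNReal.toReal_ofReal hp0.le] at h2
  set V := volume (ball z r) with hV
  have hVval : V = ENNReal.ofReal (Real.pi * r ^ 2) := by
    rw [hV, Complex.volume_ball, ← ENNReal.ofReal_pow hr0.le, mul_comm,
      ENNReal.ofReal_mul Real.pi_pos.le]
    congr 1
    rw [ENNReal.ofReal, Real.toNNReal_of_nonneg Real.pi_pos.le]; rfl
  have hV0 : V ≠ 0 := by
    rw [hVval]; simpa using (by positivity : 0 < Real.pi * r ^ 2)
  have hVt : V ≠ ⊤ := by rw [hVval]; exact ENNReal.ofReal_ne_top
  have h3 : eLpNorm f (ENNReal.ofReal p) (volume.restrict (ball z r)) ≤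
      ENNReal.ofReal ((r ^ |α|)⁻¹) ^ (1 / p) * bergmanNorm p α f := by
    rw [eLpNorm_eq_lintegral_rpow_enorm_toReal (by simpa using hp0) ENNReal.ofReal_ne_top,
      ENNReal.toReal_ofReal hp0.le, bergmanNorm, ← ENNReal.mul_rpow_of_nonneg _ _ (by positivity),
      ← lintegral_const_mul' _ _ ENNReal.ofReal_ne_top]
    refine ENNReal.rpow_le_rpow ?_ (by positivity)
    refine le_trans (setLIntegral_mono' measurableSet_ball fun w hw => ?_)
      (lintegral_mono_set hsub)
    have hw1 : dist w z < r := hw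
    have hw2 : r ≤ 1 - ‖w‖ := by
      have : ‖w‖ ≤ ‖w - z‖ + ‖z‖ := by simpa using norm_add_le (w - z) z
      rw [dist_eq_norm] at hw1
      linarith
    have hw3 : 1 - ‖w‖ ≤ 1 := by linarith [norm_nonneg w]
    have hw4 : r ^ |α| ≤ (1 - ‖w‖) ^ α := by
      calc r ^ |α| ≤ (1 - ‖w‖) ^ |α| := Real.rpow_le_rpow hr0.le hw2 (abs_nonneg _)
        _ ≤ (1 - ‖w‖) ^ α :=
          Real.rpow_le_rpow_of_exponent_ge (by linarith) hw3 (le_abs_self _)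
    calc ‖f w‖ₑ ^ p = ENNReal.ofReal ((r ^ |α|)⁻¹) * (‖f w‖ₑ ^ p * ENNReal.ofReal (r ^ |α|)) := by
          rw [mul_left_comm, ← ENNReal.ofReal_mul (by positivity), inv_mul_cancel₀ (by positivity)]
          simp
      _ ≤ _ := by gcongr
  have h4 : ‖f z‖ₑ * V ≤ (V ^ (-(1 / p)) * ENNReal.ofReal ((r ^ |α|)⁻¹) ^ (1 / p) *
      bergmanNorm p α f) * V := by
    refine (h1.trans h2).trans ?_
    calc _ ≤ ENNReal.ofReal ((r ^ |α|)⁻¹) ^ (1 / p) * bergmanNorm p α f *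
          V ^ (1 / (1 : ℝ≥0∞).toReal - 1 / p) := by gcongr
      _ = _ := by
          have : V ^ (1 / (1 : ℝ≥0∞).toReal - 1 / p) = V ^ (-(1 / p)) * V := by
            rw [ENNReal.toReal_one, div_one, sub_eq_neg_add, ENNReal.rpow_add _ _ hV0 hVt,
              ENNReal.rpow_one]
          rw [this]; ring
  have h5 := (ENNReal.mul_le_mul_iff_left hV0 hVt).1 h4
  refine h5.trans (le_of_eq ?_)
  congr 1
  rw [ENNReal.rpow_neg, ← ENNReal.inv_rpow, ← ENNReal.mul_rpow_of_nonneg _ _ (by positivity),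
    hVval, ← ENNReal.ofReal_inv_of_pos (by positivity), ← ENNReal.ofReal_mul (by positivity),
    ENNReal.ofReal_rpow_of_nonneg (by positivity) (by positivity)]
  congr 1
  have h6 : (1 - ‖z‖) ^ ((2 + |α|) / p) = ((1 - ‖z‖) ^ (2 + |α|)) ^ (1 / p) := by
    rw [← Real.rpow_mul (by linarith)]; congr 1; ring
  have h7 : 1 - ‖z‖ = 2 * r := by rw [hr]; ring
  rw [h6, h7, ← Real.inv_rpow (by positivity) (1 / p), ← Real.mul_rpow (by positivity) (by positivity)]
  congr 1
  rw [Real.mul_rpow (by norm_num) hr0.le, Real.rpow_add hr0, Real.rpow_two]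
  have : (2 : ℝ) ^ (2 + |α|) ≠ 0 := by positivity
  field_simp

/-! ### Lower bounds for inner functions away from the Korenblum star -/

namespace BeurlingCarlesonSet

variable (E : BeurlingCarlesonSet)

lemma carrier_nonempty : E.carrier.Nonempty := E.toNonemptyCompacts.nonempty

lemma isCompact_carrier : IsCompact E.carrier := E.toNonemptyCompacts.isCompact

lemma isClosed_carrier : IsClosed E.carrier := E.isCompact_carrier.isClosed

lemma norm_of_mem {e : ℂ} (he : e ∈ E.carrier) : ‖e‖ = 1 := by
  simpa using E.subset_circle he

lemma infDist_le_norm_add_one (z : ℂ) : infDist z E.carrier ≤ ‖z‖ + 1 := by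
  obtain ⟨e, he⟩ := E.carrier_nonempty
  refine (infDist_le_dist_of_mem he).trans ?_
  rw [dist_eq_norm, ← E.norm_of_mem he]
  exact norm_sub_le _ _

lemma one_sub_norm_le_infDist (z : ℂ) : 1 - ‖z‖ ≤ infDist z E.carrier := by
  refine (le_infDist E.carrier_nonempty).2 fun e he => ?_
  rw [dist_eq_norm, ← E.norm_of_mem he, norm_sub_rev]
  exact norm_sub_norm_le _ _

lemma infDist_pos_iff {z : ℂ} : 0 < infDist z E.carrier ↔ z ∉ E.carrier :=
  (E.isClosed_carrier.notMem_iff_infDist_pos E.carrier_nonempty).symm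

/-- If |a| ≤ 1/√2 ≤ 5/7, the right side is at least 7(1 - 5/7) = 2, and the distance is below 2;
this case fixes the constant 7. Otherwise u = a/|a| is within 1 - |a| of E and |z - u| = |1 - ūz| ≤
|1 - āz| + (1 - |a|); since 1 - |a| ≤ |1 - āz|, the constant 3 would do. -/
lemma infDist_le_mul_norm_of_mem_korenblumStar {a z : ℂ} (ha : a ∈ E.korenblumStar)
    (ha1 : a ∈ ball (0 : ℂ) 1) (hz : z ∈ ball (0 : ℂ) 1) :
    infDist z E.carrier ≤ 7 * ‖1 - (starRingEnd ℂ) a * z‖ := by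
  have ha1' : ‖a‖ < 1 := by simpa using ha1
  have hz1 : ‖z‖ < 1 := by simpa using hz
  by_cases hsmall : ‖a‖ ≤ 1 / √2
  · have h1 : 1 - ‖a‖ ≤ ‖1 - (starRingEnd ℂ) a * z‖ := by
      have h2 := norm_sub_norm_le (1 : ℂ) ((starRingEnd ℂ) a * z)
      rw [norm_one, norm_mul, RCLike.norm_conj] at h2
      nlinarith [norm_nonneg a, norm_nonneg z]
    have h2 : 1 / √2 ≤ 5 / 7 := by
      rw [div_le_div_iff₀ (by positivity) (by norm_num)]
      have : (7 : ℝ) / 5 ≤ √2 := Real.le_sqrt_of_sq_le (by norm_num)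
      linarith
    linarith [E.infDist_le_norm_add_one z]
  · have ha0 : 0 < ‖a‖ := lt_of_lt_of_le (by positivity) (not_le.1 hsmall).le
    have ha2 : infDist (a / (‖a‖ : ℂ)) E.carrier ≤ 1 - ‖a‖ := by
      rcases ha with h | h
      · exact absurd (by simpa using h) hsmall
      · exact h.2
    set u : ℂ := a / (‖a‖ : ℂ) with hu
    have hau : a = ‖a‖ * u := by
      rw [hu, mul_div_cancel₀ _ (by exact_mod_cast ha0.ne')]
    have hu1 : ‖u‖ = 1 := by
      rw [hu, norm_div, Complex.norm_real, norm_norm, div_self ha0.ne']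
    have huu : u * (starRingEnd ℂ) u = 1 := by
      rw [Complex.mul_conj, Complex.normSq_eq_norm_sq, hu1]; simp
    have h1 : ‖z - u‖ = ‖1 - (starRingEnd ℂ) u * z‖ := by
      have : z - u = -(u * (1 - (starRingEnd ℂ) u * z)) := by
        linear_combination (-z) * huu
      rw [this, norm_neg, norm_mul, hu1, one_mul]
    have h2 : ‖1 - (starRingEnd ℂ) u * z‖ ≤ ‖1 - (starRingEnd ℂ) a * z‖ + (1 - ‖a‖) := by
      have h3 : 1 - (starRingEnd ℂ) u * z = (1 - (starRingEnd ℂ) a * z) +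
          ((‖a‖ - 1 : ℝ) : ℂ) * ((starRingEnd ℂ) u * z) := by
        conv_rhs => rw [hau]
        simp only [map_mul, Complex.conj_ofReal, norm_mul, Complex.norm_real, norm_norm, hu1]
        push_cast
        ring
      rw [h3]
      refine (norm_add_le _ _).trans ?_
      gcongr
      rw [norm_mul, norm_mul, RCLike.norm_conj, hu1, one_mul, Complex.norm_real, Real.norm_eq_abs,
        abs_of_neg (by linarith)]
      nlinarith [norm_nonneg z]
    have h4 : 1 - ‖a‖ ≤ ‖1 - (starRingEnd ℂ) a * z‖ := by
      have h2 := norm_sub_norm_le (1 : ℂ) ((starRingEnd ℂ) a * z)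
      rw [norm_one, norm_mul, RCLike.norm_conj] at h2
      nlinarith [norm_nonneg a, norm_nonneg z]
    have h5 := infDist_le_infDist_add_dist (s := E.carrier) (x := z) (y := u)
    rw [dist_eq_norm, h1] at h5
    linarith [norm_nonneg (1 - (starRingEnd ℂ) a * z)]

end BeurlingCarlesonSet

lemma norm_blaschkeFactor_sq {a z : ℂ} (ha : ‖a‖ < 1) (hz : ‖z‖ < 1) :
    ‖blaschkeFactor a z‖ ^ 2 =
      1 - (1 - ‖a‖ ^ 2) * (1 - ‖z‖ ^ 2) / ‖1 - (starRingEnd ℂ) a * z‖ ^ 2 := by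
  have h1 : 1 - (starRingEnd ℂ) a * z ≠ 0 := by
    intro h
    have : ‖(starRingEnd ℂ) a * z‖ = 1 := by rw [← sub_eq_zero.1 h, norm_one]
    rw [norm_mul, RCLike.norm_conj] at this
    nlinarith [norm_nonneg a, norm_nonneg z]
  by_cases h0 : a = 0
  · simp [blaschkeFactor, h0]
  · rw [blaschkeFactor, if_neg h0, norm_mul, norm_div, Complex.norm_real, norm_norm,
      div_self (norm_ne_zero_iff.2 h0), one_mul, norm_div, div_pow, eq_sub_iff_add_eq,
      ← add_div, div_eq_one_iff_eq (by positivity)]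
    simp only [← Complex.normSq_eq_norm_sq, Complex.normSq_apply, Complex.sub_re, Complex.sub_im,
      Complex.mul_re, Complex.mul_im, Complex.conj_re, Complex.conj_im, Complex.one_re,
      Complex.one_im]
    ring

lemma exp_neg_two_mul_le_one_sub {x : ℝ} (h0 : 0 ≤ x) (h1 : x ≤ 1 / 2) :
    Real.exp (-(2 * x)) ≤ 1 - x := by
  have h2 : 1 + 2 * x ≤ Real.exp (2 * x) := by linarith [Real.add_one_le_exp (2 * x)]
  rw [Real.exp_neg]
  refine (inv_anti₀ (by positivity) h2).trans ?_
  rw [inv_le_iff_one_le_mul₀ (by positivity)]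
  nlinarith

/-- The squared modulus is 1 - x with x = (1 - |a|²)(1 - |z|²)/W², W = |1 - āz| and D ≤ 7W. The
constant 112 serves twice. From D² ≤ 49W² comes 1 - |z|² ≤ W², so x ≤ 2(1 - |a|); from D² ≤ 2D ≤ 14W
comes 1 - |z|² ≤ D²/56 ≤ W/4, so x ≤ 1/2. Then 1 - x ≥ e^{-2x}. -/
lemma exp_neg_le_norm_blaschkeFactor (E : BeurlingCarlesonSet) {a z : ℂ}
    (ha : a ∈ E.korenblumStar) (ha1 : a ∈ ball (0 : ℂ) 1) (hz : z ∈ ball (0 : ℂ) 1)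
    (hd : 1 - ‖z‖ ≤ infDist z E.carrier ^ 2 / 112) :
    Real.exp (-(2 * (1 - ‖a‖))) ≤ ‖blaschkeFactor a z‖ := by
  have hA := E.infDist_le_mul_norm_of_mem_korenblumStar ha ha1 hz
  have hd2 := E.infDist_le_norm_add_one z
  have ha1' : ‖a‖ < 1 := by simpa using ha1
  have hz1 : ‖z‖ < 1 := by simpa using hz
  have h4 : 1 - ‖a‖ ≤ ‖1 - (starRingEnd ℂ) a * z‖ := by
    have h2 := norm_sub_norm_le (1 : ℂ) ((starRingEnd ℂ) a * z)
    rw [norm_one, norm_mul, RCLike.norm_conj] at h2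
    nlinarith [norm_nonneg a, norm_nonneg z]
  set D := infDist z E.carrier
  set W := ‖1 - (starRingEnd ℂ) a * z‖ with hW
  have hD0 : 0 ≤ D := infDist_nonneg
  have hW0 : 0 < W := by linarith
  set x := (1 - ‖a‖ ^ 2) * (1 - ‖z‖ ^ 2) / W ^ 2 with hx
  have hna := norm_nonneg a
  have hnz := norm_nonneg z
  have ha2 : 0 ≤ 1 - ‖a‖ ^ 2 := by nlinarith
  have ha3 : 1 - ‖a‖ ^ 2 ≤ 2 * (1 - ‖a‖) := by nlinarith
  have hz2 : 0 ≤ 1 - ‖z‖ ^ 2 := by nlinarith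
  have hz3 : 1 - ‖z‖ ^ 2 ≤ 2 * (1 - ‖z‖) := by nlinarith
  have hx0 : 0 ≤ x := by positivity
  have hDW : D ^ 2 ≤ 49 * W ^ 2 := by nlinarith
  have hx1 : x ≤ 2 * (1 - ‖a‖) := by
    rw [hx, div_le_iff₀ (by positivity)]
    have h5 : 1 - ‖z‖ ^ 2 ≤ W ^ 2 := by nlinarith
    have := mul_le_mul ha3 h5 hz2 (by linarith)
    linarith
  have hx2 : x ≤ 1 / 2 := by
    rw [hx, div_le_iff₀ (by positivity)]
    have h5 : 1 - ‖z‖ ^ 2 ≤ W / 4 := by nlinarith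
    have h6 : 1 - ‖a‖ ^ 2 ≤ 2 * W := by linarith
    have := mul_le_mul h6 h5 hz2 (by linarith)
    linarith
  have h7 := exp_neg_two_mul_le_one_sub hx0 hx2
  rw [hx, hW, ← norm_blaschkeFactor_sq ha1' hz1] at h7
  refine le_of_sq_le_sq ?_ (norm_nonneg _)
  refine le_trans ?_ h7
  rw [← Real.exp_nat_mul]
  refine Real.exp_le_exp.2 ?_
  rw [← hW, ← hx]
  push_cast
  linarith

lemma mem_korenblumStar_of_analyticOrderNatAt_ne_zero {E : BeurlingCarlesonSet} {I : ℂ → ℂ}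
    {μ : Measure ℂ} (hμ : blaschkeMeasure I ≤ μ) (hsupp : μ.support ⊆ E.korenblumStar)
    {a : ℂ} (ha : a ∈ ball (0 : ℂ) 1) (hord : analyticOrderNatAt I a ≠ 0) :
    a ∈ E.korenblumStar := by
  refine hsupp (Measure.support_mono hμ ?_)
  rw [Measure.mem_support_iff_forall]
  intro U hU
  have ha1 : ‖a‖ < 1 := by simpa using ha
  have hpos : 0 < ENNReal.ofReal (analyticOrderNatAt I a * (1 - ‖a‖)) := by
    rw [ENNReal.ofReal_pos]
    exact mul_pos (by exact_mod_cast Nat.pos_of_ne_zero hord) (by linarith)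
  refine lt_of_lt_of_le hpos ?_
  refine le_trans ?_ (Measure.le_sum_apply _ U |>.trans' (ENNReal.le_tsum (⟨a, ha⟩ : ball (0 : ℂ) 1)))
  rw [Measure.smul_apply, smul_eq_mul, Measure.dirac_apply_of_mem (mem_of_mem_nhds hU), mul_one]

/-- Every finite partial product obeys the bound, by multiplying the estimates for the factors, and
the bound passes to the limit. -/
lemma exp_neg_le_norm_blaschkeProduct {E : BeurlingCarlesonSet} {I : ℂ → ℂ}
    (hsupp : ∀ a ∈ ball (0 : ℂ) 1, analyticOrderNatAt I a ≠ 0 → a ∈ E.korenblumStar)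
    (hsum : Summable fun a : ball (0 : ℂ) 1 =>
      (analyticOrderNatAt I (a : ℂ) : ℝ) * (1 - ‖(a : ℂ)‖))
    {z : ℂ} (hz : z ∈ ball (0 : ℂ) 1) (hd : 1 - ‖z‖ ≤ infDist z E.carrier ^ 2 / 112) :
    Real.exp (-(2 * ∑' a : ball (0 : ℂ) 1,
      (analyticOrderNatAt I (a : ℂ) : ℝ) * (1 - ‖(a : ℂ)‖))) ≤ ‖blaschkeProduct I z‖ := by
  have hterm : ∀ a : ball (0 : ℂ) 1,
      0 ≤ (analyticOrderNatAt I (a : ℂ) : ℝ) * (1 - ‖(a : ℂ)‖) := fun a => by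
    have : ‖(a : ℂ)‖ < 1 := mem_ball_zero_iff.1 a.2
    exact mul_nonneg (Nat.cast_nonneg _) (by linarith)
  by_cases hm : Multipliable fun a : ball (0 : ℂ) 1 =>
      blaschkeFactor a z ^ analyticOrderNatAt I a
  · have hlim := (continuous_norm.tendsto _).comp hm.hasProd
    refine ge_of_tendsto hlim (Eventually.of_forall fun s => ?_)
    simp only [Function.comp_apply, norm_prod, norm_pow]
    calc Real.exp (-(2 * ∑' a : ball (0 : ℂ) 1,
          (analyticOrderNatAt I (a : ℂ) : ℝ) * (1 - ‖(a : ℂ)‖)))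
        ≤ Real.exp (-(2 * ∑ a ∈ s,
          (analyticOrderNatAt I (a : ℂ) : ℝ) * (1 - ‖(a : ℂ)‖))) := by
          gcongr
          exact hsum.sum_le_tsum s fun a _ => hterm a
      _ = ∏ a ∈ s, Real.exp (-(2 * (1 - ‖(a : ℂ)‖))) ^ analyticOrderNatAt I (a : ℂ) := by
          rw [Finset.mul_sum, ← Finset.sum_neg_distrib, Real.exp_sum]
          refine Finset.prod_congr rfl fun a _ => ?_
          rw [← Real.exp_nat_mul]
          congr 1
          ring
      _ ≤ _ := by
          refine Finset.prod_le_prod (fun a _ => by positivity) fun a _ => ?_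
          by_cases h0 : analyticOrderNatAt I (a : ℂ) = 0
          · simp [h0]
          · gcongr
            exact exp_neg_le_norm_blaschkeFactor E (hsupp a a.2 h0) a.2 hz hd
  -- Without convergence the product is 1 by convention, and the bound is trivial.
  · rw [blaschkeProduct, tprod_eq_one_of_not_multipliable hm, norm_one]
    refine Real.exp_le_one_iff.2 ?_
    simpa using tsum_nonneg hterm

/-- The quantity -log|S_σ| is the Poisson integral of σ, and for ζ in E the kernel (1 - |z|²)/|ζ -
z|² is at most 2(1 - |z|)/dist(z, E)² ≤ 1/56, well below 2. -/
lemma exp_neg_le_norm_singularInner {E : BeurlingCarlesonSet} {σ : Measure ℂ} [IsFiniteMeasure σ]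
    (hσ : ∀ᵐ ζ ∂σ, ζ ∈ E.carrier) {z : ℂ} (hz : z ∈ ball (0 : ℂ) 1)
    (hd : 1 - ‖z‖ ≤ infDist z E.carrier ^ 2 / 112) :
    Real.exp (-(2 * σ.real univ)) ≤ ‖singularInner σ z‖ := by
  rw [singularInner, Complex.norm_exp]
  refine Real.exp_le_exp.2 ?_
  rw [Complex.neg_re, neg_le_neg_iff]
  have hnn : 0 ≤ σ.real univ := measureReal_nonneg
  have hz1 : ‖z‖ < 1 := by simpa using hz
  by_cases hint : Integrable (fun ζ => herglotzRieszKernel 0 z ζ) σ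
  · have h1 : (∫ ζ, herglotzRieszKernel 0 z ζ ∂σ).re =
        ∫ ζ, (herglotzRieszKernel 0 z ζ).re ∂σ := (Complex.reCLM.integral_comp_comm hint).symm
    rw [h1]
    refine (le_abs_self _).trans ?_
    rw [← Real.norm_eq_abs]
    refine norm_integral_le_of_norm_le_const ?_
    filter_upwards [hσ] with ζ hζ
    have h2 : (herglotzRieszKernel 0 z ζ).re = poissonKernel 0 z ζ := by
      rw [poissonKernel_eq_re_herglotzRieszKernel]; rfl
    rw [h2, poissonKernel_def]
    simp only [sub_zero, E.norm_of_mem hζ, Real.norm_eq_abs]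
    have h3 : infDist z E.carrier ≤ ‖ζ - z‖ := by
      rw [← dist_eq_norm, dist_comm]; exact infDist_le_dist_of_mem hζ
    have hD0 : 0 ≤ infDist z E.carrier := infDist_nonneg
    have hnz := norm_nonneg z
    have h4 : 0 < ‖ζ - z‖ ^ 2 := by nlinarith
    rw [abs_of_nonneg (div_nonneg (by nlinarith) h4.le), div_le_iff₀ h4]
    nlinarith
  · rw [integral_undef hint]
    simp

/-- An inner function whose zero structure lives on a Korenblum star is bounded below on the
region `1 - |z| ≤ dist(z, E)² / 112`. -/
lemma HasZeroStructure.exp_neg_le_norm {E : BeurlingCarlesonSet} {I : ℂ → ℂ} {μ : Measure ℂ}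
    (hI : HasZeroStructure I μ) (hsupp : μ.support ⊆ E.korenblumStar)
    {z : ℂ} (hz : z ∈ ball (0 : ℂ) 1) (hd : 1 - ‖z‖ ≤ infDist z E.carrier ^ 2 / 112) :
    Real.exp (-(2 * μ.real (closedBall 0 1))) ≤ ‖I z‖ := by
  obtain ⟨c, σ, hc, hfin, hsph, -, hsum, hfac, rfl⟩ := hI
  have hterm : ∀ a : ball (0 : ℂ) 1,
      0 ≤ (analyticOrderNatAt I (a : ℂ) : ℝ) * (1 - ‖(a : ℂ)‖) := fun a => by
    have : ‖(a : ℂ)‖ < 1 := mem_ball_zero_iff.1 a.2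
    exact mul_nonneg (Nat.cast_nonneg _) (by linarith)
  have hB : blaschkeMeasure I (closedBall 0 1) = ENNReal.ofReal (∑' a : ball (0 : ℂ) 1,
      (analyticOrderNatAt I (a : ℂ) : ℝ) * (1 - ‖(a : ℂ)‖)) := by
    rw [blaschkeMeasure, Measure.sum_apply _ measurableSet_closedBall,
      ENNReal.ofReal_tsum_of_nonneg hterm hsum]
    refine tsum_congr fun a => ?_
    rw [Measure.smul_apply, smul_eq_mul,
      Measure.dirac_apply_of_mem (ball_subset_closedBall a.2), mul_one]
  have hσ1 : σ (closedBall 0 1) = σ univ := by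
    refine le_antisymm (measure_mono (subset_univ _)) ?_
    calc σ univ ≤ σ (closedBall 0 1) + σ (closedBall 0 1)ᶜ := by
          rw [← union_compl_self (closedBall (0 : ℂ) 1)]; exact measure_union_le _ _
      _ = σ (closedBall 0 1) := by
          rw [measure_mono_null (compl_subset_compl.2 sphere_subset_closedBall) hsph, add_zero]
  have hM : (blaschkeMeasure I + σ).real (closedBall 0 1) = (∑' a : ball (0 : ℂ) 1,
      (analyticOrderNatAt I (a : ℂ) : ℝ) * (1 - ‖(a : ℂ)‖)) + σ.real univ := by
    rw [Measure.real, Measure.add_apply, hB, hσ1, ENNReal.toReal_add ENNReal.ofReal_ne_top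
      (measure_ne_top _ _), ENNReal.toReal_ofReal (tsum_nonneg hterm), Measure.real]
  -- On the unit circle the Korenblum star reduces to E: the small disk is excluded, and the Stolz
  -- condition at |ζ| = 1 reads dist(ζ, E) ≤ 0.
  have hσE : ∀ᵐ ζ ∂σ, ζ ∈ E.carrier := by
    have h1 : ∀ᵐ ζ ∂σ, ζ ∈ σ.support := Measure.support_mem_ae
    have h2 : ∀ᵐ ζ ∂σ, ζ ∈ sphere (0 : ℂ) 1 := hsph
    filter_upwards [h1, h2] with ζ hζ1 hζ2
    have hn : ‖ζ‖ = 1 := by simpa using hζ2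
    rcases hsupp (Measure.support_mono (Measure.le_add_left le_rfl) hζ1) with h | h
    · have h3 : ‖ζ‖ ≤ 1 / √2 := by simpa using h
      have h4 : (1 : ℝ) < √2 := Real.lt_sqrt_of_sq_lt (by norm_num)
      rw [hn, le_div_iff₀ (by positivity)] at h3
      linarith
    · have h4 := h.2
      rw [hn] at h4
      simp only [Complex.ofReal_one, div_one, sub_self] at h4
      by_contra h5
      exact absurd (E.infDist_pos_iff.2 h5) (not_lt.2 h4)
  rw [hM, hfac z hz, norm_mul, norm_mul, hc, one_mul, mul_add, neg_add, Real.exp_add]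
  refine mul_le_mul ?_ (exp_neg_le_norm_singularInner hσE hz hd) (by positivity) (norm_nonneg _)
  refine exp_neg_le_norm_blaschkeProduct (fun a ha h0 => ?_) hsum hz hd
  exact mem_korenblumStar_of_analyticOrderNatAt_ne_zero (Measure.le_add_right le_rfl) hsupp ha h0

/-! ### Division of functions in an invariant subspace -/

lemma norm_le_bergmanNorm_toReal {p α K s : ℝ} {f : ℂ → ℂ}
    (hK : 0 < K) {z : ℂ} (hz : z ∈ ball (0 : ℂ) 1)
    (h : ‖f z‖ₑ ≤ ENNReal.ofReal (K * ((1 - ‖z‖) ^ s)⁻¹) * bergmanNorm p α f)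
    (hfin : bergmanNorm p α f ≠ ⊤) :
    ‖f z‖ ≤ K * ((1 - ‖z‖) ^ s)⁻¹ * (bergmanNorm p α f).toReal := by
  have hz1 : ‖z‖ < 1 := by simpa using hz
  have h1 := ENNReal.toReal_mono (ENNReal.mul_ne_top ENNReal.ofReal_ne_top hfin) h
  have h2 : 0 ≤ (1 - ‖z‖) ^ s := Real.rpow_nonneg (by linarith) _
  rwa [toReal_enorm, ENNReal.toReal_mul, ENNReal.toReal_ofReal (by positivity)] at h1

/-- The pointwise estimate behind the division principle: near the circle and off `E` the inner
function is bounded below, and elsewhere the maximum principle applies. -/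
lemma norm_mul_le_of_infDist_rpow {E : BeurlingCarlesonSet} {I Ψ P : ℂ → ℂ} {m s κ A B : ℝ}
    (hs : 0 < s) (hm : 0 < m) (hκ : 0 ≤ κ) (hA : 0 ≤ A) (hB : 0 ≤ B)
    (hI : ∀ z ∈ ball (0 : ℂ) 1, 1 - ‖z‖ ≤ infDist z E.carrier ^ 2 / 112 → m⁻¹ ≤ ‖I z‖)
    (hΨ : DifferentiableOn ℂ Ψ (ball 0 1)) (hΨ1 : ∀ z ∈ ball (0 : ℂ) 1, ‖Ψ z‖ ≤ 1)
    (hΨκ : ∀ z ∈ ball (0 : ℂ) 1, ‖Ψ z‖ ≤ κ * infDist z E.carrier ^ (2 * s))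
    (hP : DifferentiableOn ℂ P (ball 0 1)) (hPA : ∀ z ∈ ball (0 : ℂ) 1, ‖P z‖ ≤ A)
    (hPI : ∀ z ∈ ball (0 : ℂ) 1, ‖P z * I z‖ ≤ B * ((1 - ‖z‖) ^ s)⁻¹)
    {z : ℂ} (hz : z ∈ ball (0 : ℂ) 1) :
    ‖Ψ z * P z‖ ≤ m * ‖P z * I z‖ + m * κ * 112 ^ s * B := by
  have hnear : ∀ z ∈ ball (0 : ℂ) 1, 1 - ‖z‖ ≤ infDist z E.carrier ^ 2 / 112 →
      ‖P z‖ ≤ m * ‖P z * I z‖ := by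
    intro z hz hd
    have h1 := hI z hz hd
    rw [norm_mul]
    have h2 : 1 ≤ m * ‖I z‖ := by
      rwa [inv_le_iff_one_le_mul₀ hm, mul_comm] at h1
    nlinarith [norm_nonneg (P z)]
  have hpos : 0 ≤ m * κ * 112 ^ s * B := by positivity
  by_cases hd : 1 - ‖z‖ ≤ infDist z E.carrier ^ 2 / 112
  · have h1 := hnear z hz hd
    rw [norm_mul]
    have : ‖Ψ z‖ * ‖P z‖ ≤ 1 * ‖P z‖ := by gcongr; exact hΨ1 z hz
    linarith
  -- The region where I may be small. On the unit circle its closure can only contain points with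
  -- dist(w, E) = 0.
  · set U : Set ℂ := {w | w ∈ ball (0 : ℂ) 1 ∧ infDist w E.carrier ^ 2 / 112 < 1 - ‖w‖} with hU
    have hcd : Continuous fun w : ℂ => infDist w E.carrier := continuous_infDist_pt _
    have hUo : IsOpen U := isOpen_ball.inter
      (isOpen_lt (by fun_prop : Continuous fun w : ℂ => infDist w E.carrier ^ 2 / 112)
        (by fun_prop : Continuous fun w : ℂ => 1 - ‖w‖))
    have hUb : U ⊆ ball (0 : ℂ) 1 := fun w hw => hw.1
    have hUc : closure U ⊆ {w | ‖w‖ ≤ 1 ∧ infDist w E.carrier ^ 2 / 112 ≤ 1 - ‖w‖} := by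
      refine closure_minimal (fun w hw => ⟨(mem_ball_zero_iff.1 hw.1).le, hw.2.le⟩) ?_
      exact (isClosed_le continuous_norm continuous_const).inter
        (isClosed_le (by fun_prop : Continuous fun w : ℂ => infDist w E.carrier ^ 2 / 112)
          (by fun_prop : Continuous fun w : ℂ => 1 - ‖w‖))
    -- Extending ΨP by zero outside the open disk makes it continuous on the closure of U: at points
    -- of E it is squeezed by κ A dist^(2s). The bound A serves only here and does not enter the
    -- final estimate.
    set G : ℂ → ℂ := (ball (0 : ℂ) 1).indicator fun w => Ψ w * P w with hG
    have hGeq : EqOn G (fun w => Ψ w * P w) (ball 0 1) := fun w hw => indicator_of_mem hw _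
    have hGd : DifferentiableOn ℂ G (ball 0 1) := (hΨ.mul hP).congr hGeq
    have hGle : ∀ w, ‖G w‖ ≤ κ * A * infDist w E.carrier ^ (2 * s) := by
      intro w
      by_cases hw : w ∈ ball (0 : ℂ) 1
      · rw [hGeq hw, norm_mul]
        calc ‖Ψ w‖ * ‖P w‖ ≤ (κ * infDist w E.carrier ^ (2 * s)) * A :=
              mul_le_mul (hΨκ w hw) (hPA w hw) (norm_nonneg _)
                (mul_nonneg hκ (Real.rpow_nonneg infDist_nonneg _))
          _ = _ := by ring
      · rw [hG, indicator_of_notMem hw, norm_zero]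
        exact mul_nonneg (mul_nonneg hκ hA) (Real.rpow_nonneg infDist_nonneg _)
    have hzero : ∀ w, ‖w‖ = 1 → infDist w E.carrier ^ 2 / 112 ≤ 1 - ‖w‖ →
        infDist w E.carrier = 0 := by
      intro w hw h
      rw [hw] at h
      have : infDist w E.carrier ^ 2 ≤ 0 := by linarith
      exact pow_eq_zero_iff two_ne_zero |>.1 (le_antisymm this (sq_nonneg _))
    have hdc : DiffContOnCl ℂ G U := by
      refine ⟨hGd.mono hUb, fun w hw => ?_⟩
      obtain ⟨hw1, hw2⟩ := hUc hw
      rcases hw1.lt_or_eq with h | h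
      · exact ((hGd.differentiableAt (isOpen_ball.mem_nhds (by simpa using h))).continuousAt
          ).continuousWithinAt
      · have h0 := hzero w h hw2
        have hGw : G w = 0 := by
          rw [← norm_le_zero_iff]
          refine (hGle w).trans (le_of_eq ?_)
          rw [h0, Real.zero_rpow (by positivity), mul_zero]
        rw [ContinuousWithinAt, hGw]
        refine squeeze_zero_norm hGle ?_
        have h3 : Continuous fun w : ℂ => κ * A * infDist w E.carrier ^ (2 * s) :=
          continuous_const.mul (hcd.rpow_const fun _ => Or.inr (by positivity))
        have h4 := h3.tendsto w
        rw [h0, Real.zero_rpow (by positivity), mul_zero] at h4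
        exact h4.mono_left nhdsWithin_le_nhds
    -- Inside the disk 1 - |w| = dist²/112 on the frontier, so the growth (1 - |w|)^(-s) equals
    -- 112^s dist^(-2s) and is cancelled by the decay of Ψ. On the circle G vanishes.
    have hfr : ∀ w ∈ frontier U, ‖G w‖ ≤ m * κ * 112 ^ s * B := by
      intro w hw
      obtain ⟨hw1, hw2⟩ := hUc hw.1
      rcases hw1.lt_or_eq with h | h
      · have hwb : w ∈ ball (0 : ℂ) 1 := by simpa using h
        have hwU : w ∉ U := by
          have := hw.2
          rwa [hUo.interior_eq] at this
        have h5 : 1 - ‖w‖ ≤ infDist w E.carrier ^ 2 / 112 := by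
          by_contra h6
          exact hwU ⟨hwb, not_le.1 h6⟩
        have h6 : 1 - ‖w‖ = infDist w E.carrier ^ 2 / 112 := le_antisymm h5 hw2
        have hD : 0 < infDist w E.carrier := by
          linarith [E.one_sub_norm_le_infDist w]
        rw [hGeq hwb, norm_mul]
        have h7 : ‖P w‖ ≤ m * (B * ((1 - ‖w‖) ^ s)⁻¹) :=
          (hnear w hwb h5).trans (by gcongr; exact hPI w hwb)
        rw [h6, Real.div_rpow (by positivity) (by norm_num), ← Real.rpow_natCast,
          ← Real.rpow_mul hD.le] at h7
        push_cast at h7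
        have hDs : infDist w E.carrier ^ (2 * s) ≠ 0 := (Real.rpow_pos_of_pos hD _).ne'
        calc ‖Ψ w‖ * ‖P w‖ ≤ (κ * infDist w E.carrier ^ (2 * s)) *
              (m * (B * (infDist w E.carrier ^ (2 * s) / 112 ^ s)⁻¹)) :=
              mul_le_mul (hΨκ w hwb) h7 (norm_nonneg _)
                (mul_nonneg hκ (Real.rpow_nonneg infDist_nonneg _))
          _ = _ := by field_simp
      · have hwb : w ∉ ball (0 : ℂ) 1 := by simp [h]
        rwa [hG, indicator_of_notMem hwb, norm_zero]
    have hzU : z ∈ U := ⟨hz, not_le.1 hd⟩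
    have h8 := Complex.norm_le_of_forall_mem_frontier_norm_le
      (isBounded_ball.subset hUb) hdc hfr (subset_closure hzU)
    rw [hGeq hz] at h8
    have : 0 ≤ m * ‖P z * I z‖ := by positivity
    linarith

lemma bergmanNorm_triangle {p α : ℝ} (hp : 1 ≤ p) {f g h : ℂ → ℂ}
    (hf : ContinuousOn f (ball 0 1)) (hg : ContinuousOn g (ball 0 1))
    (hh : ContinuousOn h (ball 0 1)) :
    bergmanNorm p α (fun z => g z - h z) ≤
      bergmanNorm p α (fun z => f z - g z) + bergmanNorm p α (fun z => f z - h z) := by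
  simp only [bergmanNorm_eq_eLpNorm hp]
  have h1 : (fun z => g z - h z) = (fun z => f z - h z) - fun z => f z - g z := by
    ext z; simp
  rw [h1, add_comm]
  exact eLpNorm_sub_le ((hf.sub hh).aestronglyMeasurable_diskMeasure α)
    ((hf.sub hg).aestronglyMeasurable_diskMeasure α) (by simpa using hp)

/-- The constant in the division principle. -/
def divisionConstant (p α K m κ : ℝ) : ℝ :=
  m + m * κ * 112 ^ ((2 + |α|) / p) * K * (diskMeasure α univ ^ (1 / p)).toReal

/-- The pointwise estimate is used with B = K‖PI‖, supplied by point evaluation; Minkowski then adds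
m‖PI‖ to a constant times a power of the mass of the disk. The bound on P is qualitative and leaves
no trace in the constant, so the estimate is uniform over polynomials. -/
lemma bergmanNorm_mul_le {p α K m κ : ℝ} (hp : 1 ≤ p) (hα : -1 < α) (hK0 : 0 < K)
    (hK : ∀ f : ℂ → ℂ, DifferentiableOn ℂ f (ball 0 1) → ∀ z ∈ ball (0 : ℂ) 1,
      ‖f z‖ₑ ≤ ENNReal.ofReal (K * ((1 - ‖z‖) ^ ((2 + |α|) / p))⁻¹) * bergmanNorm p α f)
    {E : BeurlingCarlesonSet} {I Ψ P : ℂ → ℂ} (hm : 0 < m) (hκ : 0 ≤ κ)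
    (hId : DifferentiableOn ℂ I (ball 0 1))
    (hI : ∀ z ∈ ball (0 : ℂ) 1, 1 - ‖z‖ ≤ infDist z E.carrier ^ 2 / 112 → m⁻¹ ≤ ‖I z‖)
    (hΨ : DifferentiableOn ℂ Ψ (ball 0 1)) (hΨ1 : ∀ z ∈ ball (0 : ℂ) 1, ‖Ψ z‖ ≤ 1)
    (hΨκ : ∀ z ∈ ball (0 : ℂ) 1,
      ‖Ψ z‖ ≤ κ * infDist z E.carrier ^ (2 * ((2 + |α|) / p)))
    (hP : DifferentiableOn ℂ P (ball 0 1)) (hPA : ∃ A, ∀ z ∈ ball (0 : ℂ) 1, ‖P z‖ ≤ A)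
    (hfin : bergmanNorm p α (fun z => P z * I z) ≠ ⊤) :
    bergmanNorm p α (fun z => Ψ z * P z) ≤
      ENNReal.ofReal (divisionConstant p α K m κ) * bergmanNorm p α (fun z => P z * I z) := by
  have hp0 : 0 < p := by linarith
  have hs : 0 < (2 + |α|) / p := by positivity
  have := isFiniteMeasure_diskMeasure hα
  set N := bergmanNorm p α (fun z => P z * I z) with hN
  obtain ⟨A, hPA⟩ := hPA
  have hA : 0 ≤ A := (norm_nonneg _).trans (hPA 0 (by simp))
  have hpt : ∀ z ∈ ball (0 : ℂ) 1, ‖Ψ z * P z‖ ≤ m * ‖P z * I z‖ +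
      m * κ * 112 ^ ((2 + |α|) / p) * (K * N.toReal) := fun z hz => by
    refine norm_mul_le_of_infDist_rpow hs hm hκ hA (by positivity) hI hΨ hΨ1 hΨκ hP hPA ?_ hz
    intro w hw
    refine (norm_le_bergmanNorm_toReal hK0 hw (hK _ (hP.mul hId) w hw) hfin).trans (le_of_eq ?_)
    change K * _ * N.toReal = _
    ring
  set b := m * κ * 112 ^ ((2 + |α|) / p) * (K * N.toReal) with hb
  have hb0 : 0 ≤ b := by positivity
  have hq0 : ENNReal.ofReal p ≠ 0 := by simpa using hp0
  calc bergmanNorm p α (fun z => Ψ z * P z)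
      ≤ eLpNorm ((m • fun z => ‖P z * I z‖) + fun _ => b) (ENNReal.ofReal p) (diskMeasure α) := by
        rw [bergmanNorm_eq_eLpNorm hp]
        refine eLpNorm_mono_ae_real ((diskMeasure_absolutelyContinuous α) ?_)
        filter_upwards [ae_restrict_mem measurableSet_ball] with z hz
        simpa using hpt z hz
    _ ≤ eLpNorm (m • fun z => ‖P z * I z‖) (ENNReal.ofReal p) (diskMeasure α) +
        eLpNorm (fun _ => b) (ENNReal.ofReal p) (diskMeasure α) := by
        refine eLpNorm_add_le ?_ aestronglyMeasurable_const (by simpa using hp)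
        exact (((hP.mul hId).continuousOn.aestronglyMeasurable_diskMeasure α).norm).const_smul m
    _ = ENNReal.ofReal m * N + ENNReal.ofReal b * diskMeasure α univ ^ (1 / p) := by
        rw [eLpNorm_const_smul, eLpNorm_norm, eLpNorm_const' _ hq0 ENNReal.ofReal_ne_top,
          ENNReal.toReal_ofReal hp0.le, Real.enorm_of_nonneg hm.le, Real.enorm_of_nonneg hb0, hN,
          bergmanNorm_eq_eLpNorm hp]
    _ = _ := by
        have hV : diskMeasure α univ ^ (1 / p) =
            ENNReal.ofReal (diskMeasure α univ ^ (1 / p)).toReal :=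
          (ENNReal.ofReal_toReal
            (ENNReal.rpow_ne_top_of_nonneg (by positivity) (measure_ne_top _ _))).symm
        rw [divisionConstant, ENNReal.ofReal_add (by positivity) (by positivity), add_mul]
        congr 1
        conv_lhs => rw [hV]
        conv_rhs => rw [← ENNReal.ofReal_toReal hfin]
        rw [← ENNReal.ofReal_mul hb0, ← ENNReal.ofReal_mul (by positivity)]
        congr 1
        rw [hb]
        ring

/-- The estimate for polynomials is linear in P, so P_n I → f makes ΨP_n a Cauchy sequence in norm,
hence locally uniformly by point evaluation. Its limit g is holomorphic, inherits the norm bound by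
Fatou, and satisfies Ig = Ψf pointwise. Obtaining the quotient as a limit avoids any discussion of
the zeros of I. -/
lemma exists_division {p α K m κ : ℝ} (hp : 1 ≤ p) (hα : -1 < α) (hK0 : 0 < K)
    (hK : ∀ f : ℂ → ℂ, DifferentiableOn ℂ f (ball 0 1) → ∀ z ∈ ball (0 : ℂ) 1,
      ‖f z‖ₑ ≤ ENNReal.ofReal (K * ((1 - ‖z‖) ^ ((2 + |α|) / p))⁻¹) * bergmanNorm p α f)
    {E : BeurlingCarlesonSet} {I Ψ f : ℂ → ℂ} (hm : 0 < m) (hκ : 0 ≤ κ)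
    (hId : DifferentiableOn ℂ I (ball 0 1))
    (hI : ∀ z ∈ ball (0 : ℂ) 1, 1 - ‖z‖ ≤ infDist z E.carrier ^ 2 / 112 → m⁻¹ ≤ ‖I z‖)
    (hΨ : DifferentiableOn ℂ Ψ (ball 0 1)) (hΨ1 : ∀ z ∈ ball (0 : ℂ) 1, ‖Ψ z‖ ≤ 1)
    (hΨκ : ∀ z ∈ ball (0 : ℂ) 1,
      ‖Ψ z‖ ≤ κ * infDist z E.carrier ^ (2 * ((2 + |α|) / p)))
    (hf : MemInvariantSubspace p α I f) :
    ∃ g : ℂ → ℂ, MemBergman p α g ∧ (∀ z ∈ ball (0 : ℂ) 1, I z * g z = Ψ z * f z) ∧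
      bergmanNorm p α g ≤
        ENNReal.ofReal (divisionConstant p α K m κ) * bergmanNorm p α f := by
  obtain ⟨⟨hfd, hffin⟩, happ⟩ := hf
  set c : ℝ≥0∞ := ENNReal.ofReal (divisionConstant p α K m κ) with hc
  have hc1 : c ≠ ⊤ := ENNReal.ofReal_ne_top
  choose P hP using fun n : ℕ => happ ((n : ℝ≥0∞) + 1)⁻¹ (by simp)
  have hPd : ∀ n, DifferentiableOn ℂ (fun z => (P n).eval z) (ball 0 1) :=
    fun n => (P n).differentiable.differentiableOn
  have hPId : ∀ n, DifferentiableOn ℂ (fun z => (P n).eval z * I z) (ball 0 1) :=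
    fun n => (hPd n).mul hId
  set G : ℕ → ℂ → ℂ := fun n z => Ψ z * (P n).eval z with hG
  have hGd : ∀ n, DifferentiableOn ℂ (G n) (ball 0 1) := fun n => hΨ.mul (hPd n)
  have hmain : ∀ Q : Polynomial ℂ, bergmanNorm p α (fun z => Q.eval z * I z) ≠ ⊤ →
      bergmanNorm p α (fun z => Ψ z * Q.eval z) ≤
        c * bergmanNorm p α (fun z => Q.eval z * I z) := fun Q hQ => by
    refine bergmanNorm_mul_le hp hα hK0 hK hm hκ hId hI hΨ hΨ1 hΨκ
      Q.differentiable.differentiableOn ?_ hQ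
    obtain ⟨A, hA⟩ := (isCompact_closedBall (0 : ℂ) 1).exists_bound_of_continuousOn
      Q.continuous.continuousOn
    exact ⟨A, fun z hz => hA z (ball_subset_closedBall hz)⟩
  have hPI : ∀ n, bergmanNorm p α (fun z => (P n).eval z * I z) ≤
      bergmanNorm p α f + ((n : ℝ≥0∞) + 1)⁻¹ := fun n => by
    have h1 := bergmanNorm_triangle (α := α) hp hfd.continuousOn (hPId n).continuousOn
      (continuousOn_const (c := (0 : ℂ)))
    simp only [sub_zero] at h1
    rw [add_comm]
    exact h1.trans (by gcongr; exact (hP n).le)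
  have hinv : Tendsto (fun n : ℕ => ((n : ℝ≥0∞) + 1)⁻¹) atTop (𝓝 0) := by
    have := ENNReal.tendsto_inv_nat_nhds_zero.comp (tendsto_add_atTop_nat 1)
    simpa [Function.comp_def] using this
  have hdiff : ∀ n k, bergmanNorm p α (fun z => G n z - G k z) ≤
      c * (((n : ℝ≥0∞) + 1)⁻¹ + ((k : ℝ≥0∞) + 1)⁻¹) := fun n k => by
    have h1 := bergmanNorm_triangle (α := α) hp hfd.continuousOn (hPId n).continuousOn
      (hPId k).continuousOn
    have h2 : (fun z => (P n).eval z * I z - (P k).eval z * I z) =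
        fun z => (P n - P k).eval z * I z := by
      ext z; simp [sub_mul]
    have h3 : (fun z => G n z - G k z) = fun z => Ψ z * (P n - P k).eval z := by
      ext z; simp [hG, mul_sub]
    have h4 : bergmanNorm p α (fun z => (P n).eval z * I z - (P k).eval z * I z) ≤
        ((n : ℝ≥0∞) + 1)⁻¹ + ((k : ℝ≥0∞) + 1)⁻¹ :=
      h1.trans (add_le_add (hP n).le (hP k).le)
    rw [h2] at h4
    rw [h3]
    refine (hmain _ (ne_top_of_le_ne_top ?_ h4)).trans (by gcongr)
    exact ENNReal.add_ne_top.2 ⟨by simp, by simp⟩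
  have hcauchy : ∀ r < (1 : ℝ), ∀ ε > (0 : ℝ), ∃ n₀ : ℕ, ∀ n ≥ n₀, ∀ k ≥ n₀,
      ∀ z ∈ closedBall (0 : ℂ) r, ‖G n z - G k z‖ < ε := by
    intro r hr ε hε
    set R : ℝ≥0∞ := ENNReal.ofReal (K * ((1 - r) ^ ((2 + |α|) / p))⁻¹) with hR
    have hlim : Tendsto (fun n : ℕ => R * (c * (((n : ℝ≥0∞) + 1)⁻¹ + ((n : ℝ≥0∞) + 1)⁻¹)))
        atTop (𝓝 (R * (c * (0 + 0)))) :=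
      ENNReal.Tendsto.const_mul (ENNReal.Tendsto.const_mul (hinv.add hinv) (Or.inr hc1))
        (Or.inr ENNReal.ofReal_ne_top)
    simp only [add_zero, mul_zero] at hlim
    obtain ⟨n₀, hn₀⟩ := eventually_atTop.1
      (hlim.eventually_lt_const (ENNReal.ofReal_pos.2 hε))
    refine ⟨n₀, fun n hn k hk z hz => ?_⟩
    have hzr : ‖z‖ ≤ r := by simpa using hz
    have hz1 : z ∈ ball (0 : ℂ) 1 := by simpa using hzr.trans_lt hr
    have h1 := hK _ ((hGd n).sub (hGd k)) z hz1
    have h2 : ‖G n z - G k z‖ₑ < ENNReal.ofReal ε := by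
      refine lt_of_le_of_lt ?_ (hn₀ n₀ le_rfl)
      refine h1.trans ?_
      refine mul_le_mul' ?_ ((hdiff n k).trans ?_)
      · rw [hR]
        have : 0 < 1 - r := by linarith
        gcongr
      · gcongr
    rw [← ofReal_norm, ENNReal.ofReal_lt_ofReal_iff hε] at h2
    exact h2
  have hex : ∀ z ∈ ball (0 : ℂ) 1, ∃ w, Tendsto (fun n => G n z) atTop (𝓝 w) := by
    intro z hz
    refine cauchySeq_tendsto_of_complete (Metric.cauchySeq_iff.2 fun ε hε => ?_)
    obtain ⟨n₀, hn₀⟩ := hcauchy ‖z‖ (by simpa using hz) ε hε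
    exact ⟨n₀, fun n hn k hk => by
      rw [dist_eq_norm]; exact hn₀ n hn k hk z (by simp)⟩
  choose! g hg using hex
  have hloc : TendstoLocallyUniformlyOn G g atTop (ball 0 1) := by
    rw [tendstoLocallyUniformlyOn_iff_forall_isCompact isOpen_ball]
    intro S hS hSc
    obtain ⟨r, hr, hSr⟩ : ∃ r < (1 : ℝ), S ⊆ closedBall (0 : ℂ) r := by
      rcases S.eq_empty_or_nonempty with rfl | hne
      · exact ⟨0, by norm_num, empty_subset _⟩
      · obtain ⟨x, hx, hmax⟩ := hSc.exists_isMaxOn hne continuous_norm.continuousOn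
        exact ⟨‖x‖, by simpa using hS hx, fun y hy => by simpa using hmax hy⟩
    refine UniformCauchySeqOn.tendstoUniformlyOn_of_tendsto ?_ fun z hz => hg z (hS hz)
    rw [Metric.uniformCauchySeqOn_iff]
    intro ε hε
    obtain ⟨n₀, hn₀⟩ := hcauchy r hr ε hε
    exact ⟨n₀, fun n hn k hk z hz => by
      rw [dist_eq_norm]; exact hn₀ n hn k hk z (hSr hz)⟩
  have hgd : DifferentiableOn ℂ g (ball 0 1) :=
    hloc.differentiableOn (Eventually.of_forall hGd) isOpen_ball
  have hle : bergmanNorm p α g ≤ c * bergmanNorm p α f := by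
    have h1 : bergmanNorm p α g ≤ liminf (fun n => bergmanNorm p α (G n)) atTop := by
      simp only [bergmanNorm_eq_eLpNorm hp]
      refine Lp.eLpNorm_lim_le_liminf_eLpNorm
        (fun n => (hGd n).continuousOn.aestronglyMeasurable_diskMeasure α) g ?_
      refine diskMeasure_absolutelyContinuous α ?_
      filter_upwards [ae_restrict_mem measurableSet_ball] with z hz using hg z hz
    have h2 : Tendsto (fun n : ℕ => c * (bergmanNorm p α f + ((n : ℝ≥0∞) + 1)⁻¹)) atTop
        (𝓝 (c * (bergmanNorm p α f + 0))) :=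
      ENNReal.Tendsto.const_mul (tendsto_const_nhds.add hinv) (Or.inr hc1)
    rw [add_zero] at h2
    rw [← h2.liminf_eq]
    refine h1.trans (liminf_le_liminf (Eventually.of_forall fun n => ?_))
    refine (hmain (P n) (ne_top_of_le_ne_top ?_ (hPI n))).trans (by gcongr; exact hPI n)
    exact ENNReal.add_ne_top.2 ⟨hffin.ne, by simp⟩
  refine ⟨g, ⟨hgd, hle.trans_lt (ENNReal.mul_lt_top hc1.lt_top hffin)⟩, fun z hz => ?_, hle⟩
  have hPf : Tendsto (fun n => (P n).eval z * I z) atTop (𝓝 (f z)) := by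
    rw [tendsto_iff_edist_tendsto_0]
    set R : ℝ≥0∞ := ENNReal.ofReal (K * ((1 - ‖z‖) ^ ((2 + |α|) / p))⁻¹)
    have hlim : Tendsto (fun n : ℕ => R * ((n : ℝ≥0∞) + 1)⁻¹) atTop (𝓝 (R * 0)) :=
      ENNReal.Tendsto.const_mul hinv (Or.inr ENNReal.ofReal_ne_top)
    rw [mul_zero] at hlim
    refine tendsto_of_tendsto_of_tendsto_of_le_of_le tendsto_const_nhds hlim
      (fun _ => zero_le) fun n => ?_
    rw [edist_comm, edist_eq_enorm_sub]
    exact (hK _ (hfd.sub (hPId n)) z hz).trans (by gcongr; exact (hP n).le)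
  have h1 : Tendsto (fun n => I z * G n z) atTop (𝓝 (I z * g z)) := (hg z hz).const_mul _
  have h2 : Tendsto (fun n => I z * G n z) atTop (𝓝 (Ψ z * f z)) := by
    refine (hPf.const_mul (Ψ z)).congr fun n => ?_
    simp only [hG]
    ring
  exact tendsto_nhds_unique h1 h2

/-! ### Continuous dependence of the constants -/

instance : TopologicalSpace.PseudoMetrizableSpace BeurlingCarlesonSet :=
  Topology.IsInducing.pseudoMetrizableSpace
    (f := fun E : BeurlingCarlesonSet => (E.toNonemptyCompacts, E.entropy)) ⟨rfl⟩

/-- Locally constant choices are glued by a partition of unity, and convexity keeps the result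
admissible. This produces both the continuous decay constants and the continuous truncation levels.
-/
lemma exists_continuous_mem_of_eventually_mem {X : Type*} [TopologicalSpace X]
    [TopologicalSpace.PseudoMetrizableSpace X] {t : X → Set ℝ} (ht : ∀ x, Convex ℝ (t x))
    (H : ∀ x, ∃ c, ∀ᶠ y in 𝓝 x, c ∈ t y) : ∃ g : X → ℝ, Continuous g ∧ ∀ x, g x ∈ t x := by
  let := TopologicalSpace.pseudoMetrizableSpacePseudoMetric X
  obtain ⟨g, hg⟩ := exists_continuous_forall_mem_convex_of_local_const ht H
  exact ⟨g, g.continuous, hg⟩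

lemma IsCarlesonFamily.norm_le_one {Φ : BeurlingCarlesonSet → ℂ → ℂ} (hΦ : IsCarlesonFamily Φ)
    (E : BeurlingCarlesonSet) {z : ℂ} (hz : z ∈ ball (0 : ℂ) 1) : ‖Φ E z‖ ≤ 1 := by
  obtain ⟨C, -, hC0, hC⟩ := hΦ.decay
  simpa [hC0] using hC 0 E z hz

/-- The exponent is parametrized by its logarithm t so that it ranges over all of ℝ. Admissible
constants form an upward closed, hence convex, set, so it suffices to find one that works near a
given point. -/
lemma IsCarlesonFamily.exists_continuous_rpow_le {Φ : BeurlingCarlesonSet → ℂ → ℂ}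
    (hΦ : IsCarlesonFamily Φ) {s : ℝ} :
    ∃ κ : BeurlingCarlesonSet × ℝ → ℝ, Continuous κ ∧ ∀ E t, 0 ≤ κ (E, t) ∧
      ∀ z ∈ ball (0 : ℂ) 1, ‖Φ E z‖ ^ Real.exp t ≤ κ (E, t) * infDist z E.carrier ^ s := by
  obtain ⟨C, hCc, -, hC⟩ := hΦ.decay
  suffices h : ∃ κ : BeurlingCarlesonSet × ℝ → ℝ, Continuous κ ∧ ∀ q, 0 ≤ κ q ∧
      ∀ z ∈ ball (0 : ℂ) 1, ‖Φ q.1 z‖ ^ Real.exp q.2 ≤ κ q * infDist z q.1.carrier ^ s by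
    obtain ⟨κ, hκ, hκ'⟩ := h
    exact ⟨κ, hκ, fun E t => hκ' (E, t)⟩
  refine exists_continuous_mem_of_eventually_mem
    (t := fun q : BeurlingCarlesonSet × ℝ => {c | 0 ≤ c ∧
      ∀ z ∈ ball (0 : ℂ) 1, ‖Φ q.1 z‖ ^ Real.exp q.2 ≤ c * infDist z q.1.carrier ^ s}) ?_ ?_
  · rintro ⟨E, t⟩
    refine Set.OrdConnected.convex ⟨fun a ha b hb c hc => ⟨ha.1.trans hc.1, fun z hz => ?_⟩⟩
    refine (ha.2 z hz).trans ?_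
    have : 0 ≤ infDist z E.carrier ^ s := Real.rpow_nonneg infDist_nonneg _
    gcongr
    exact hc.1
  · rintro ⟨E₀, t₀⟩
    set δ := Real.exp t₀ / 2 with hδ
    have hδ0 : 0 < δ := by positivity
    obtain ⟨N, hN⟩ := exists_nat_ge (s / δ)
    set B := |C N E₀| + 1
    have hB0 : 0 < B := by positivity
    -- Near (E₀, t₀) the exponent exceeds δ = e^{t₀}/2, and lowering it to δ is allowed because |Φ|
    -- ≤ 1. With Nδ ≥ s, the decay of order N leaves D^(Nδ - s) to spare, which is at most 2^(Nδ -
    -- s).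
    refine ⟨B ^ δ * 2 ^ (N * δ - s), ?_⟩
    have h1 : ∀ᶠ q : BeurlingCarlesonSet × ℝ in 𝓝 (E₀, t₀), C N q.1 < B :=
      ((hCc N).comp continuous_fst).continuousAt.eventually_lt continuousAt_const
        (lt_of_le_of_lt (le_abs_self _) (lt_add_one _))
    have h2 : ∀ᶠ q : BeurlingCarlesonSet × ℝ in 𝓝 (E₀, t₀), δ < Real.exp q.2 :=
      continuousAt_const.eventually_lt (Real.continuous_exp.comp continuous_snd).continuousAt
        (by simp only [hδ]; linarith [Real.exp_pos t₀])
    filter_upwards [h1, h2] with q hq1 hq2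
    refine ⟨by positivity, fun z hz => ?_⟩
    have hz1 : ‖z‖ < 1 := by simpa using hz
    set D := infDist z q.1.carrier
    have hD : 0 < D := by linarith [q.1.one_sub_norm_le_infDist z]
    have hD2 : D ≤ 2 := by linarith [q.1.infDist_le_norm_add_one z]
    have hNs : 0 ≤ N * δ - s := by
      rw [div_le_iff₀ hδ0] at hN; linarith
    calc ‖Φ q.1 z‖ ^ Real.exp q.2 ≤ ‖Φ q.1 z‖ ^ δ :=
          Real.rpow_le_rpow_of_exponent_ge' (norm_nonneg _) (hΦ.norm_le_one _ hz) hδ0.le hq2.le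
      _ ≤ (B * D ^ N) ^ δ := by
          refine Real.rpow_le_rpow (norm_nonneg _) ((hC N q.1 z hz).trans ?_) hδ0.le
          gcongr
      _ = B ^ δ * (D ^ (N * δ - s) * D ^ s) := by
          rw [Real.mul_rpow hB0.le (by positivity), ← Real.rpow_add hD, sub_add_cancel,
            ← Real.rpow_natCast, ← Real.rpow_mul hD.le]
      _ ≤ B ^ δ * (2 ^ (N * δ - s) * D ^ s) := by gcongr
      _ = _ := by ring

/-- The division principle for an arbitrary Carleson family. -/
theorem IsCarlesonFamily.exists_division {Φ : BeurlingCarlesonSet → ℂ → ℂ}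
    (hΦ : IsCarlesonFamily Φ) {p α : ℝ} (hp : 1 ≤ p) (hα : -1 < α) :
    ∃ C : BeurlingCarlesonSet → ℝ → ℝ → ℝ,
      ContinuousOn (fun q : BeurlingCarlesonSet × ℝ × ℝ => C q.1 q.2.1 q.2.2)
        (univ ×ˢ (Ioi 0 ×ˢ Ici 0)) ∧
      ∀ (E : BeurlingCarlesonSet) (I : ℂ → ℂ) (μ : Measure ℂ) (f : ℂ → ℂ) (δ : ℝ),
        IsInner I → HasZeroStructure I μ → μ.support ⊆ E.korenblumStar →
        MemInvariantSubspace p α I f → 0 < δ →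
        ∀ L : ℂ → ℂ, DifferentiableOn ℂ L (ball 0 1) →
          (∀ z ∈ ball (0 : ℂ) 1, Complex.exp (L z) = Φ E z) →
          ∃ g : ℂ → ℂ, MemBergman p α g ∧
            (∀ z ∈ ball (0 : ℂ) 1, I z * g z = Complex.exp (δ * L z) * f z) ∧
            bergmanNorm p α g ≤
              ENNReal.ofReal (C E δ (μ.real (closedBall 0 1))) * bergmanNorm p α f := by
  obtain ⟨K, hK0, hK⟩ := exists_enorm_le_bergmanNorm (α := α) hp
  obtain ⟨κ, hκc, hκ⟩ := hΦ.exists_continuous_rpow_le (s := 2 * ((2 + |α|) / p))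
  -- Here e^{2M} is the reciprocal of the lower bound for |I| off the star.
  refine ⟨fun E δ M => divisionConstant p α K (Real.exp (2 * M)) (κ (E, Real.log δ)), ?_, ?_⟩
  · have h1 : ContinuousOn (fun q : BeurlingCarlesonSet × ℝ × ℝ => κ (q.1, Real.log q.2.1))
        (univ ×ˢ (Ioi 0 ×ˢ Ici 0)) := by
      refine hκc.comp_continuousOn (continuousOn_fst.prodMk ?_)
      refine ContinuousOn.log (by fun_prop) fun q hq => ?_
      exact ne_of_gt hq.2.1
    have h2 : ContinuousOn (fun q : BeurlingCarlesonSet × ℝ × ℝ => Real.exp (2 * q.2.2))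
        (univ ×ˢ (Ioi 0 ×ˢ Ici 0)) := by fun_prop
    exact h2.add ((((h2.mul h1).mul continuousOn_const).mul continuousOn_const).mul
      continuousOn_const)
  · intro E I μ f δ hI hμ hsupp hf hδ L hL hLΦ
    have hnorm : ∀ z ∈ ball (0 : ℂ) 1, ‖Complex.exp (δ * L z)‖ = ‖Φ E z‖ ^ δ := fun z hz => by
      rw [← hLΦ z hz, Complex.norm_exp, Complex.norm_exp, ← Real.exp_mul]
      simp [mul_comm]
    refine _root_.exists_division hp hα hK0 hK (E := E) (Real.exp_pos _) (hκ _ _).1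
      hI.differentiableOn ?_ (hL.const_mul _).cexp ?_ ?_ hf
    · intro z hz hd
      rw [← Real.exp_neg]
      exact hμ.exp_neg_le_norm hsupp hz hd
    · intro z hz
      rw [hnorm z hz]
      exact Real.rpow_le_one (norm_nonneg _) (hΦ.norm_le_one E hz) hδ.le
    · intro z hz
      have h1 := (hκ E (Real.log δ)).2 z hz
      rwa [Real.exp_log hδ, ← hnorm z hz] at h1

/-! ### Complementary arcs -/

/-- Every half-open interval of length 2π is a fundamental domain for translation by 2πℤ. A gap can
thus be integrated from its own left endpoint, even when it straddles the angle 0. -/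
lemma arcLength_eq_map_Ioc (t : ℝ) :
    arcLength = (volume.restrict (Ioc t (t + 2 * Real.pi))).map (circleMap 0 1) := by
  have h2π : 0 < 2 * Real.pi := Real.two_pi_pos
  ext s hs
  rw [arcLength, Measure.map_apply (measurable_circleMap 0 1) hs,
    Measure.map_apply (measurable_circleMap 0 1) hs, ← lintegral_indicator_one
      ((measurable_circleMap 0 1) hs), ← lintegral_indicator_one ((measurable_circleMap 0 1) hs)]
  have : VAddInvariantMeasure (AddSubgroup.zmultiples (2 * Real.pi)) ℝ volume :=
    ⟨fun c s _ => measure_preimage_add _ _ _⟩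
  have h0 := isAddFundamentalDomain_Ioc h2π 0
  rw [zero_add] at h0
  refine IsAddFundamentalDomain.setLIntegral_eq (G := AddSubgroup.zmultiples (2 * Real.pi)) h0
    (isAddFundamentalDomain_Ioc h2π t) _ ?_
  refine Function.Periodic.map_vadd_zmultiples fun θ => ?_
  have : θ + 2 * Real.pi ∈ circleMap 0 1 ⁻¹' s ↔ θ ∈ circleMap 0 1 ⁻¹' s := by
    rw [mem_preimage, periodic_circleMap 0 1 θ, mem_preimage]
  exact indicator_eq_indicator this rfl

lemma measurable_circleMap_lintegral (t : ℝ) {F : ℂ → ℝ≥0∞} (hF : Measurable F) :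
    ∫⁻ ζ, F ζ ∂arcLength = ∫⁻ θ in Ioc t (t + 2 * Real.pi), F (circleMap 0 1 θ) := by
  rw [arcLength_eq_map_Ioc t, lintegral_map hF (measurable_circleMap 0 1)]

lemma arcLength_univ : arcLength univ = ENNReal.ofReal (2 * Real.pi) := by
  rw [arcLength, Measure.map_apply (measurable_circleMap 0 1) MeasurableSet.univ]
  simp

instance : IsFiniteMeasure arcLength := ⟨by rw [arcLength_univ]; exact ENNReal.ofReal_lt_top⟩

lemma arcLength_compl_sphere : arcLength (sphere (0 : ℂ) 1)ᶜ = 0 := by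
  rw [arcLength, Measure.map_apply (measurable_circleMap 0 1) isClosed_sphere.measurableSet.compl]
  have : circleMap 0 1 ⁻¹' (sphere (0 : ℂ) 1)ᶜ = ∅ := by
    ext θ; simp
  simp [this]

lemma exists_mem_Ico_circleMap_eq {e : ℂ} (he : ‖e‖ = 1) (t : ℝ) :
    ∃ φ ∈ Ico t (t + 2 * Real.pi), circleMap 0 1 φ = e := by
  have h1 : e ∈ range (circleMap 0 1) := by simp [he]
  obtain ⟨x, rfl⟩ := h1
  obtain ⟨φ, hφ, h⟩ := (periodic_circleMap 0 1).exists_mem_Ico Real.two_pi_pos x t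
  exact ⟨φ, hφ, h.symm⟩

namespace BeurlingCarlesonSet

variable (E : BeurlingCarlesonSet)

/-- `(a, b)` parametrizes a complementary arc of `E`. -/
structure IsGap (a b : ℝ) : Prop where
  lt : a < b
  left_mem : circleMap 0 1 a ∈ E.carrier
  right_mem : circleMap 0 1 b ∈ E.carrier
  notMem : ∀ θ ∈ Ioo a b, circleMap 0 1 θ ∉ E.carrier

variable {E}

lemma IsGap.le_add_two_pi {a b : ℝ} (h : E.IsGap a b) : b ≤ a + 2 * Real.pi := by
  by_contra hlt
  refine h.notMem (a + 2 * Real.pi) ⟨by linarith [Real.two_pi_pos], not_le.1 hlt⟩ ?_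
  rw [periodic_circleMap]
  exact h.left_mem

/-- The endpoints are the last angle of E before θ and the first one after it; both exist because E
is non-empty and its set of angles is closed and 2π-periodic. -/
lemma exists_isGap {θ : ℝ} (hθ : circleMap 0 1 θ ∉ E.carrier) :
    ∃ a b, E.IsGap a b ∧ θ ∈ Ioo a b := by
  have hcl : IsClosed (circleMap 0 1 ⁻¹' E.carrier) :=
    E.isClosed_carrier.preimage (continuous_circleMap 0 1)
  obtain ⟨e, he⟩ := E.carrier_nonempty
  obtain ⟨x, hx, hxe⟩ := exists_mem_Ico_circleMap_eq (E.norm_of_mem he) θ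
  have hper : circleMap 0 1 (x - 2 * Real.pi) = e := by
    rw [(periodic_circleMap 0 1).sub_eq, hxe]
  have hA : (circleMap 0 1 ⁻¹' E.carrier ∩ Iic θ).Nonempty :=
    ⟨x - 2 * Real.pi, by rw [mem_preimage, hper]; exact he, by rw [mem_Iic]; linarith [hx.2]⟩
  have hB : (circleMap 0 1 ⁻¹' E.carrier ∩ Ici θ).Nonempty :=
    ⟨x, by rw [mem_preimage, hxe]; exact he, hx.1⟩
  have hAb : BddAbove (circleMap 0 1 ⁻¹' E.carrier ∩ Iic θ) := ⟨θ, fun y hy => hy.2⟩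
  have hBb : BddBelow (circleMap 0 1 ⁻¹' E.carrier ∩ Ici θ) := ⟨θ, fun y hy => hy.2⟩
  have ha := (hcl.inter isClosed_Iic).csSup_mem hA hAb
  have hb := (hcl.inter isClosed_Ici).csInf_mem hB hBb
  set a := sSup (circleMap 0 1 ⁻¹' E.carrier ∩ Iic θ)
  set b := sInf (circleMap 0 1 ⁻¹' E.carrier ∩ Ici θ)
  have haθ : a < θ := lt_of_le_of_ne ha.2 fun h => hθ (h ▸ ha.1)
  have hbθ : θ < b := lt_of_le_of_ne hb.2 fun h => hθ (h ▸ hb.1)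
  refine ⟨a, b, ⟨haθ.trans hbθ, ha.1, hb.1, fun φ hφ hmem => ?_⟩, haθ, hbθ⟩
  rcases le_total φ θ with h | h
  · exact absurd (le_csSup hAb ⟨hmem, h⟩) (not_le.2 hφ.1)
  · exact absurd (csInf_le hBb ⟨hmem, h⟩) (not_le.2 hφ.2)

lemma IsGap.image_subset {a b : ℝ} (h : E.IsGap a b) :
    circleMap 0 1 '' Ioo a b ⊆ sphere (0 : ℂ) 1 \ E.carrier := by
  rintro _ ⟨θ, hθ, rfl⟩
  exact ⟨by simp, h.notMem θ hθ⟩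

/-- The closed arcs over [a, b] and [b, a + 2π] cover the circle and meet only in E. A connected set
off E that contains a point of the first arc therefore cannot meet the second. -/
lemma IsGap.connectedComponentIn_eq {a b θ : ℝ} (h : E.IsGap a b) (hθ : θ ∈ Ioo a b) :
    connectedComponentIn (sphere (0 : ℂ) 1 \ E.carrier) (circleMap 0 1 θ) =
      circleMap 0 1 '' Ioo a b := by
  refine Subset.antisymm ?_ ?_
  · set A := circleMap 0 1 '' Icc a b with hA
    set B := circleMap 0 1 '' Icc b (a + 2 * Real.pi) with hB
    have hAc : IsClosed A := (isCompact_Icc.image (continuous_circleMap 0 1)).isClosed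
    have hBc : IsClosed B := (isCompact_Icc.image (continuous_circleMap 0 1)).isClosed
    have hAB : A ∩ B ⊆ E.carrier := by
      rintro _ ⟨⟨x, hx, rfl⟩, ⟨y, hy, hxy⟩⟩
      rcases eq_or_ne x a with rfl | hxa
      · exact h.left_mem
      · have hlt : a < x := lt_of_le_of_ne hx.1 (Ne.symm hxa)
        have : y = x := eq_of_circleMap_eq one_ne_zero
          (by rw [abs_lt]; constructor <;> linarith [hx.2, hy.1, hy.2, Real.two_pi_pos]) hxy
        have hxb : x = b := le_antisymm hx.2 (this ▸ hy.1)
        rw [hxb]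
        exact h.right_mem
    have hcov : sphere (0 : ℂ) 1 \ E.carrier ⊆ A ∪ B := by
      rintro z ⟨hz, -⟩
      obtain ⟨φ, hφ, rfl⟩ := exists_mem_Ico_circleMap_eq (by simpa using hz : ‖z‖ = 1) a
      rcases le_total φ b with hb | hb
      · exact Or.inl ⟨φ, ⟨hφ.1, hb⟩, rfl⟩
      · exact Or.inr ⟨φ, ⟨hb, hφ.2.le⟩, rfl⟩
    intro z hz
    have hzS := connectedComponentIn_subset _ _ hz
    have hmem : circleMap 0 1 θ ∈ sphere (0 : ℂ) 1 \ E.carrier := ⟨by simp, h.notMem θ hθ⟩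
    have hpre := isPreconnected_connectedComponentIn
      (F := sphere (0 : ℂ) 1 \ E.carrier) (x := circleMap 0 1 θ)
    have hzB : z ∉ B := by
      intro hzB
      obtain ⟨w, hw, hwAB⟩ := isPreconnected_closed_iff.1 hpre A B hAc hBc
        ((connectedComponentIn_subset _ _).trans hcov)
        ⟨_, mem_connectedComponentIn hmem, θ, ⟨hθ.1.le, hθ.2.le⟩, rfl⟩ ⟨z, hz, hzB⟩
      exact (connectedComponentIn_subset _ _ hw).2 (hAB hwAB)
    rcases hcov hzS with ⟨φ, hφ, rfl⟩ | hB'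
    · refine ⟨φ, ⟨lt_of_le_of_ne hφ.1 ?_, lt_of_le_of_ne hφ.2 ?_⟩, rfl⟩
      · rintro rfl
        exact hzS.2 h.left_mem
      · rintro rfl
        exact hzS.2 h.right_mem
    · exact absurd hB' hzB
  · exact (isPreconnected_Ioo.image _ (continuous_circleMap 0 1).continuousOn
      ).subset_connectedComponentIn ⟨θ, hθ, rfl⟩ h.image_subset

lemma exists_isGap_of_mem_complementaryArcs {J : Set ℂ} (hJ : J ∈ complementaryArcs E.carrier) :
    ∃ a b, E.IsGap a b ∧ J = circleMap 0 1 '' Ioo a b := by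
  obtain ⟨x, hx, rfl⟩ := hJ
  obtain ⟨θ, -, rfl⟩ := exists_mem_Ico_circleMap_eq (by simpa using hx.1 : ‖x‖ = 1) 0
  obtain ⟨a, b, hab, hθ⟩ := exists_isGap hx.2
  exact ⟨a, b, hab, hab.connectedComponentIn_eq hθ⟩

lemma IsGap.injOn {a b : ℝ} (h : E.IsGap a b) : InjOn (circleMap 0 1) (Ioo a b) :=
  (injOn_circleMap_of_abs_sub_le' one_ne_zero (by linarith [h.le_add_two_pi])).mono
    Ioo_subset_Ico_self

lemma IsGap.measurableSet_image {a b : ℝ} (h : E.IsGap a b) :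
    MeasurableSet (circleMap 0 1 '' Ioo a b) :=
  measurableSet_Ioo.image_of_continuousOn_injOn (continuous_circleMap 0 1).continuousOn h.injOn

lemma IsGap.setLIntegral {a b : ℝ} (h : E.IsGap a b) {F : ℂ → ℝ≥0∞} (hF : Measurable F) :
    ∫⁻ ζ in circleMap 0 1 '' Ioo a b, F ζ ∂arcLength =
      ∫⁻ θ in Ioo a b, F (circleMap 0 1 θ) := by
  rw [← lintegral_indicator h.measurableSet_image,
    measurable_circleMap_lintegral a (hF.indicator h.measurableSet_image),
    ← lintegral_indicator measurableSet_Ioc, ← lintegral_indicator measurableSet_Ioo]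
  refine lintegral_congr fun θ => ?_
  by_cases hθ : θ ∈ Ioc a (a + 2 * Real.pi)
  · rw [indicator_of_mem hθ]
    by_cases hθ2 : θ ∈ Ioo a b
    · rw [indicator_of_mem hθ2, indicator_of_mem (mem_image_of_mem _ hθ2)]
    · rw [indicator_of_notMem hθ2, indicator_of_notMem]
      rintro ⟨φ, hφ, hφθ⟩
      have : φ = θ := eq_of_circleMap_eq one_ne_zero
        (by rw [abs_lt]; constructor <;> linarith [hφ.1, hφ.2, hθ.1, hθ.2, h.le_add_two_pi]) hφθ
      exact hθ2 (this ▸ hφ)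
  · rw [indicator_of_notMem hθ, indicator_of_notMem]
    exact fun hθ2 => hθ ⟨hθ2.1, hθ2.2.le.trans h.le_add_two_pi⟩

lemma IsGap.arcLength_image {a b : ℝ} (h : E.IsGap a b) :
    arcLength (circleMap 0 1 '' Ioo a b) = ENNReal.ofReal (b - a) := by
  have := h.setLIntegral (F := fun _ => 1) measurable_const
  simpa using this

lemma countable_complementaryArcs : (complementaryArcs E.carrier).Countable := by
  choose! a b hab hJ using fun J (hJ : J ∈ complementaryArcs E.carrier) =>
    exists_isGap_of_mem_complementaryArcs hJ
  refine Set.PairwiseDisjoint.countable_of_isOpen (s := fun J => Ioo (a J) (b J)) ?_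
    (fun _ _ => isOpen_Ioo) fun J h => nonempty_Ioo.2 (hab J h).lt
  intro J h J' h' hne
  rw [Function.onFun, Set.disjoint_left]
  intro θ hθ hθ'
  exact hne (by
    rw [hJ J h, hJ J' h', ← (hab J h).connectedComponentIn_eq hθ,
      ← (hab J' h').connectedComponentIn_eq hθ'])

lemma pairwiseDisjoint_complementaryArcs :
    (complementaryArcs E.carrier).PairwiseDisjoint id := by
  rintro _ ⟨x, hx, rfl⟩ _ ⟨y, hy, rfl⟩ hne
  simp only [Function.onFun, id]
  rw [Set.disjoint_left]
  intro z hz hz'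
  exact hne ((connectedComponentIn_eq hz).trans (connectedComponentIn_eq hz').symm)

lemma sUnion_complementaryArcs : ⋃₀ complementaryArcs E.carrier = sphere (0 : ℂ) 1 \ E.carrier := by
  refine Subset.antisymm ?_ fun x hx => ⟨_, ⟨x, hx, rfl⟩, mem_connectedComponentIn hx⟩
  rintro x ⟨_, ⟨y, hy, rfl⟩, hx⟩
  exact connectedComponentIn_subset _ _ hx

lemma ae_mem_compl : ∀ᵐ ζ ∂arcLength, ζ ∈ sphere (0 : ℂ) 1 \ E.carrier := by
  have h1 : ∀ᵐ ζ ∂arcLength, ζ ∈ sphere (0 : ℂ) 1 := arcLength_compl_sphere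
  have h2 : ∀ᵐ ζ ∂arcLength, ζ ∉ E.carrier := measure_eq_zero_iff_ae_notMem.1 E.arcLength_eq_zero
  filter_upwards [h1, h2] with ζ h h' using ⟨h, h'⟩

lemma lintegral_arcLength_eq_tsum (F : ℂ → ℝ≥0∞) :
    ∫⁻ ζ, F ζ ∂arcLength =
      ∑' J : complementaryArcs E.carrier, ∫⁻ ζ in (J : Set ℂ), F ζ ∂arcLength := by
  have hc : Countable (complementaryArcs E.carrier) := countable_complementaryArcs.to_subtype
  have hm : ∀ J : complementaryArcs E.carrier, MeasurableSet (J : Set ℂ) := fun J => by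
    obtain ⟨a, b, h, hJ⟩ := exists_isGap_of_mem_complementaryArcs J.2
    rw [hJ]
    exact h.measurableSet_image
  rw [← lintegral_iUnion hm fun J J' hne =>
      pairwiseDisjoint_complementaryArcs J.2 J'.2 fun h => hne (Subtype.ext h),
    ← sUnion_eq_iUnion, sUnion_complementaryArcs,
    Measure.restrict_eq_self_of_ae_mem ae_mem_compl]

/-! ### The entropy as an integral -/

/-- The distance from a point of the circle to `E` along the circle. -/
def arcDist (E : BeurlingCarlesonSet) (ζ : ℂ) : ℝ := 2 * Real.arcsin (infDist ζ E.carrier / 2)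

lemma norm_circleMap_sub_circleMap (θ φ : ℝ) :
    ‖circleMap 0 1 θ - circleMap 0 1 φ‖ = 2 * |Real.sin ((θ - φ) / 2)| := by
  have h := Complex.norm_exp_I_mul_ofReal_sub_one (θ - φ)
  rw [norm_mul, Real.norm_ofNat, Real.norm_eq_abs] at h
  rw [← h]
  have : circleMap 0 1 θ - circleMap 0 1 φ =
      circleMap 0 1 φ * (Complex.exp (Complex.I * ((θ - φ : ℝ) : ℂ)) - 1) := by
    simp only [circleMap_zero, Complex.ofReal_one, one_mul, mul_sub, mul_one, ← Complex.exp_add]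
    congr 2
    push_cast
    ring
  rw [this, norm_mul, norm_circleMap_zero, abs_one, one_mul]

lemma sin_le_sin_of_le_pi_sub {x y : ℝ} (hy : 0 ≤ y) (hyx : y ≤ x) (hx : x ≤ Real.pi - y) :
    Real.sin y ≤ Real.sin x := by
  rcases le_total x (Real.pi / 2) with h | h
  · exact Real.sin_le_sin_of_le_of_le_pi_div_two (by linarith [Real.pi_pos]) h hyx
  · rw [← Real.sin_pi_sub x]
    exact Real.sin_le_sin_of_le_of_le_pi_div_two (by linarith [Real.pi_pos]) (by linarith)
      (by linarith)

/-- Chords have length 2 sin(t/2), and the nearest point of E is an endpoint of the gap. Any point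
of E has an angle φ in [b, a + 2π], so (φ - θ)/2 lies between m/2 and π - m/2, where the sine is at
least sin(m/2). -/
lemma IsGap.arcDist_eq {a b θ : ℝ} (h : E.IsGap a b) (hθ : θ ∈ Ioo a b) :
    E.arcDist (circleMap 0 1 θ) = min (θ - a) (b - θ) := by
  set m := min (θ - a) (b - θ) with hm
  have hm0 : 0 < m := lt_min (by linarith [hθ.1]) (by linarith [hθ.2])
  have hma : m ≤ θ - a := min_le_left _ _
  have hmb : m ≤ b - θ := min_le_right _ _
  have hmπ : m ≤ Real.pi := by linarith [h.le_add_two_pi]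
  have hs0 : 0 ≤ Real.sin (m / 2) := Real.sin_nonneg_of_nonneg_of_le_pi (by linarith) (by linarith)
  have key : infDist (circleMap 0 1 θ) E.carrier = 2 * Real.sin (m / 2) := by
    refine le_antisymm ?_ ?_
    · rcases min_choice (θ - a) (b - θ) with hc | hc
      · refine (infDist_le_dist_of_mem h.left_mem).trans (le_of_eq ?_)
        rw [dist_eq_norm, norm_circleMap_sub_circleMap, ← hc, ← hm, abs_of_nonneg hs0]
      · refine (infDist_le_dist_of_mem h.right_mem).trans (le_of_eq ?_)
        rw [dist_comm, dist_eq_norm, norm_circleMap_sub_circleMap, ← hc, ← hm, abs_of_nonneg hs0]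
    · refine (le_infDist E.carrier_nonempty).2 fun e he => ?_
      obtain ⟨φ, hφ, rfl⟩ := exists_mem_Ico_circleMap_eq (E.norm_of_mem he) θ
      have h1 : b ≤ φ := by
        by_contra hlt
        exact h.notMem φ ⟨hθ.1.trans_le hφ.1, not_le.1 hlt⟩ he
      have h2 : φ ≤ a + 2 * Real.pi := by
        by_contra hlt
        refine h.notMem (φ - 2 * Real.pi) ⟨by linarith, by linarith [hφ.2, hθ.2]⟩ ?_
        rwa [(periodic_circleMap 0 1).sub_eq]
      rw [dist_comm, dist_eq_norm, norm_circleMap_sub_circleMap]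
      have h3 : Real.sin (m / 2) ≤ Real.sin ((φ - θ) / 2) :=
        sin_le_sin_of_le_pi_sub (by linarith) (by linarith) (by linarith)
      linarith [le_abs_self (Real.sin ((φ - θ) / 2))]
  rw [arcDist, key, mul_div_cancel_left₀ _ two_ne_zero, Real.arcsin_sin (by linarith) (by linarith)]
  ring

lemma measurable_arcDist : Measurable E.arcDist := by
  unfold arcDist
  exact (Real.continuous_arcsin.measurable.comp
    ((continuous_infDist_pt _).measurable.div_const 2)).const_mul 2

lemma arcDist_nonneg (ζ : ℂ) : 0 ≤ E.arcDist ζ :=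
  mul_nonneg zero_le_two (Real.arcsin_nonneg.2 (div_nonneg infDist_nonneg zero_le_two))

lemma arcDist_le_pi (ζ : ℂ) : E.arcDist ζ ≤ Real.pi := by
  have := Real.arcsin_le_pi_div_two (infDist ζ E.carrier / 2)
  unfold arcDist
  linarith

/-- The logarithm of the reciprocal of the distance to `E`, normalized to be non-negative. -/
def logArcDist (E : BeurlingCarlesonSet) (ζ : ℂ) : ℝ := Real.log (4 / E.arcDist ζ)

lemma measurable_logArcDist : Measurable E.logArcDist :=
  Real.measurable_log.comp (measurable_const.div measurable_arcDist)

lemma logArcDist_nonneg (ζ : ℂ) : 0 ≤ E.logArcDist ζ := by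
  rcases (arcDist_nonneg (E := E) ζ).eq_or_lt with h | h
  -- On E the distance is 0 and the logarithm takes the default value 0; E being null, this does not
  -- affect the integrals.
  · simp [logArcDist, ← h]
  · refine Real.log_nonneg ?_
    rw [le_div_iff₀ h, one_mul]
    exact (arcDist_le_pi ζ).trans Real.pi_le_four

/-- The integral is twice that of log 4 - log x over half the gap. The 8 is the normalizing 4 times
the 2 from the half-length. -/
lemma integral_log_four_div_min {a b : ℝ} (hab : a < b) :
    IntegrableOn (fun θ => Real.log (4 / min (θ - a) (b - θ))) (Ioo a b) ∧
    ∫ θ in Ioo a b, Real.log (4 / min (θ - a) (b - θ)) =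
      (b - a) * Real.log (1 / (b - a)) + (1 + Real.log 8) * (b - a) := by
  set c := (a + b) / 2 with hc
  have hac : a < c := by rw [hc]; linarith
  have hcb : c < b := by rw [hc]; linarith
  set F := fun θ => Real.log (4 / min (θ - a) (b - θ)) with hF
  have h1 : EqOn (fun θ => Real.log 4 - Real.log (θ - a)) F (Ioc a c) := fun θ hθ => by
    have h2 : θ - a ≤ b - θ := by linarith [hθ.2]
    simp only [hF, min_eq_left h2]
    rw [Real.log_div (by norm_num) (by linarith [hθ.1])]
  have h2 : EqOn (fun θ => Real.log 4 - Real.log (b - θ)) F (Ico c b) := fun θ hθ => by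
    have h2 : b - θ ≤ θ - a := by linarith [hθ.1]
    simp only [hF, min_eq_right h2]
    rw [Real.log_div (by norm_num) (by linarith [hθ.2])]
  have i1 : IntervalIntegrable (fun θ => Real.log 4 - Real.log (θ - a)) volume a c := by
    refine intervalIntegrable_const.sub ?_
    have := (intervalIntegral.intervalIntegrable_log' (a := a - a) (b := c - a)).comp_sub_right a
    simpa using this
  have i2 : IntervalIntegrable (fun θ => Real.log 4 - Real.log (b - θ)) volume c b := by
    refine intervalIntegrable_const.sub ?_
    have := (intervalIntegral.intervalIntegrable_log' (a := b - c) (b := b - b)).comp_sub_left b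
    simpa using this
  have j1 : IntervalIntegrable F volume a c := by
    rw [intervalIntegrable_iff_integrableOn_Ioc_of_le hac.le] at i1 ⊢
    exact i1.congr_fun h1 measurableSet_Ioc
  have j2 : IntervalIntegrable F volume c b := by
    rw [intervalIntegrable_iff_integrableOn_Ico_of_le hcb.le] at i2 ⊢
    exact i2.congr_fun h2 measurableSet_Ico
  have v1 : ∫ θ in a..c, F θ = (c - a) * Real.log 4 - ((c - a) * Real.log (c - a) - (c - a)) := by
    rw [intervalIntegral.integral_of_le hac.le, ← setIntegral_congr_fun measurableSet_Ioc h1,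
      ← intervalIntegral.integral_of_le hac.le, intervalIntegral.integral_sub
        intervalIntegrable_const, intervalIntegral.integral_comp_sub_right (fun x => Real.log x),
      integral_log, intervalIntegral.integral_const]
    · simp
    · have := (intervalIntegral.intervalIntegrable_log' (a := a - a) (b := c - a)).comp_sub_right a
      simpa using this
  have v2 : ∫ θ in c..b, F θ = (b - c) * Real.log 4 - ((b - c) * Real.log (b - c) - (b - c)) := by
    rw [intervalIntegral.integral_of_le hcb.le, integral_Ioc_eq_integral_Ioo,
      ← integral_Ico_eq_integral_Ioo, ← setIntegral_congr_fun measurableSet_Ico h2,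
      integral_Ico_eq_integral_Ioo, ← integral_Ioc_eq_integral_Ioo,
      ← intervalIntegral.integral_of_le hcb.le, intervalIntegral.integral_sub
        intervalIntegrable_const, intervalIntegral.integral_comp_sub_left (fun x => Real.log x),
      integral_log, intervalIntegral.integral_const]
    · simp
    · have := (intervalIntegral.intervalIntegrable_log' (a := b - c) (b := b - b)).comp_sub_left b
      simpa using this
  have j := j1.trans j2
  refine ⟨((intervalIntegrable_iff_integrableOn_Ioo_of_le hab.le).1 j), ?_⟩
  rw [← integral_Ioc_eq_integral_Ioo, ← intervalIntegral.integral_of_le hab.le,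
    ← intervalIntegral.integral_add_adjacent_intervals j1 j2, v1, v2]
  have e1 : c - a = (b - a) / 2 := by rw [hc]; ring
  have e2 : b - c = (b - a) / 2 := by rw [hc]; ring
  have l1 : Real.log ((b - a) / 2) = Real.log (b - a) - Real.log 2 :=
    Real.log_div (by linarith) two_ne_zero
  have l2 : Real.log 4 = 2 * Real.log 2 := by
    rw [show (4 : ℝ) = 2 ^ 2 by norm_num, Real.log_pow]; norm_num
  have l3 : Real.log 8 = 3 * Real.log 2 := by
    rw [show (8 : ℝ) = 2 ^ 3 by norm_num, Real.log_pow]; norm_num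
  rw [e1, e2, l1, l2, l3, one_div, Real.log_inv]
  ring

/-- The entropy of an arc longer than 1 is negative; only the corrected summand is non-negative,
which is needed to sum over the gaps in `ℝ≥0∞`. -/
lemma setLIntegral_logArcDist (J : complementaryArcs E.carrier) :
    ∫⁻ ζ in (J : Set ℂ), ENNReal.ofReal (E.logArcDist ζ) ∂arcLength =
      ENNReal.ofReal (arcEntropy J + (1 + Real.log 8) * arcLength.real J) ∧
    0 ≤ arcEntropy J + (1 + Real.log 8) * arcLength.real J := by
  obtain ⟨a, b, h, hJ⟩ := exists_isGap_of_mem_complementaryArcs J.2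
  have hlen : arcLength.real J = b - a := by
    rw [hJ, Measure.real, h.arcLength_image, ENNReal.toReal_ofReal (by linarith [h.lt])]
  obtain ⟨hint, hval⟩ := integral_log_four_div_min h.lt
  have hnn : ∀ θ ∈ Ioo a b, 0 ≤ Real.log (4 / min (θ - a) (b - θ)) := fun θ hθ => by
    rw [← h.arcDist_eq hθ]
    exact logArcDist_nonneg _
  rw [arcEntropy, hlen, ← hval]
  refine ⟨?_, setIntegral_nonneg measurableSet_Ioo hnn⟩
  rw [hJ, h.setLIntegral measurable_logArcDist.ennreal_ofReal,
    ofReal_integral_eq_lintegral_ofReal hint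
      (by filter_upwards [ae_restrict_mem measurableSet_Ioo] with θ hθ using hnn θ hθ)]
  refine setLIntegral_congr_fun measurableSet_Ioo fun θ hθ => ?_
  simp only [logArcDist, h.arcDist_eq hθ]

lemma hasSum_arcLength_real :
    HasSum (fun J : complementaryArcs E.carrier => arcLength.real J) (2 * Real.pi) := by
  have h := lintegral_arcLength_eq_tsum (E := E) fun _ => 1
  simp only [lintegral_const, one_mul, Measure.restrict_apply_univ, arcLength_univ] at h
  have hne : ∑' J : complementaryArcs E.carrier, arcLength (J : Set ℂ) ≠ ⊤ := by
    rw [← h]; exact ENNReal.ofReal_ne_top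
  have h2 := ENNReal.hasSum_toReal hne
  rwa [← ENNReal.tsum_toReal_eq (fun J => measure_ne_top _ _), ← h,
    ENNReal.toReal_ofReal Real.two_pi_pos.le] at h2

/-- The entropy of `E` is, up to an additive constant, the integral of the logarithm of the
reciprocal of the distance to `E`. -/
lemma integral_logArcDist : Integrable E.logArcDist arcLength ∧
    ∫ ζ, E.logArcDist ζ ∂arcLength = E.entropy + (1 + Real.log 8) * (2 * Real.pi) := by
  have hsum : HasSum (fun J : complementaryArcs E.carrier =>
      arcEntropy J + (1 + Real.log 8) * arcLength.real J)
      (E.entropy + (1 + Real.log 8) * (2 * Real.pi)) :=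
    E.summable_arcEntropy.hasSum.add (hasSum_arcLength_real.mul_left _)
  have h1 : ∫⁻ ζ, ENNReal.ofReal (E.logArcDist ζ) ∂arcLength =
      ENNReal.ofReal (E.entropy + (1 + Real.log 8) * (2 * Real.pi)) := by
    rw [lintegral_arcLength_eq_tsum (E := E), ← hsum.tsum_eq,
      ENNReal.ofReal_tsum_of_nonneg (fun J => (setLIntegral_logArcDist J).2) hsum.summable]
    exact tsum_congr fun J => (setLIntegral_logArcDist J).1
  have h0 : 0 ≤ᵐ[arcLength] E.logArcDist := Eventually.of_forall logArcDist_nonneg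
  have hm := measurable_logArcDist (E := E).aestronglyMeasurable (μ := arcLength)
  refine ⟨⟨hm, ?_⟩, ?_⟩
  · rw [hasFiniteIntegral_iff_ofReal h0, h1]
    exact ENNReal.ofReal_lt_top
  · rw [integral_eq_lintegral_of_nonneg_ae h0 hm, h1, ENNReal.toReal_ofReal]
    exact hsum.nonneg fun J => (setLIntegral_logArcDist J).2

end BeurlingCarlesonSet

/-! ### Dependence of the logarithmic distance on the set -/

/-- Scheffé's lemma. -/
lemma tendsto_integral_abs_sub_of_tendsto_integral {ι X : Type*} [MeasurableSpace X]
    {μ : Measure X} {l : Filter ι} [l.IsCountablyGenerated] {f : ι → X → ℝ} {g : X → ℝ}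
    (hf : ∀ i, Integrable (f i) μ) (hg : Integrable g μ) (hf0 : ∀ i x, 0 ≤ f i x)
    (hg0 : ∀ x, 0 ≤ g x) (hlim : ∀ᵐ x ∂μ, Tendsto (fun i => f i x) l (𝓝 (g x)))
    (hint : Tendsto (fun i => ∫ x, f i x ∂μ) l (𝓝 (∫ x, g x ∂μ))) :
    Tendsto (fun i => ∫ x, |f i x - g x| ∂μ) l (𝓝 0) := by
  -- Uses |f - g| = (f - g) + 2(g - f)⁺, where the positive part is dominated by g.
  have hpos : Tendsto (fun i => ∫ x, max (g x - f i x) 0 ∂μ) l (𝓝 (∫ _, (0 : ℝ) ∂μ)) := by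
    refine tendsto_integral_filter_of_dominated_convergence g
      (Eventually.of_forall fun i => (hg.sub (hf i)).pos_part.aestronglyMeasurable)
      (Eventually.of_forall fun i => Eventually.of_forall fun x => ?_) hg ?_
    · rw [Real.norm_of_nonneg (le_max_right _ _)]
      exact max_le (by linarith [hf0 i x]) (hg0 x)
    · filter_upwards [hlim] with x hx
      have := (tendsto_const_nhds (x := g x)).sub hx |>.max (tendsto_const_nhds (x := (0 : ℝ)))
      simpa using this
  rw [integral_zero] at hpos
  have h1 : Tendsto (fun i => (∫ x, f i x ∂μ - ∫ x, g x ∂μ) +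
      2 * ∫ x, max (g x - f i x) 0 ∂μ) l (𝓝 ((∫ x, g x ∂μ - ∫ x, g x ∂μ) + 2 * 0)) :=
    (hint.sub_const _).add (hpos.const_mul 2)
  simp only [sub_self, mul_zero, add_zero] at h1
  refine h1.congr fun i => ?_
  have hi1 : Integrable (fun x => f i x - g x) μ := (hf i).sub hg
  have hi2 : Integrable (fun x => 2 * max (g x - f i x) 0) μ :=
    ((hg.sub (hf i)).pos_part).const_mul 2
  rw [← integral_sub (hf i) hg, ← integral_const_mul, ← integral_add hi1 hi2]
  refine integral_congr_ae (Eventually.of_forall fun x => ?_)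
  simp only
  rcases le_total (f i x) (g x) with h | h
  · rw [max_eq_left (by linarith), abs_of_nonpos (by linarith)]; ring
  · rw [max_eq_right (by linarith), abs_of_nonneg (by linarith)]; ring

namespace BeurlingCarlesonSet

variable {E : BeurlingCarlesonSet}

lemma continuous_toNonemptyCompacts :
    Continuous fun E : BeurlingCarlesonSet => E.toNonemptyCompacts :=
  continuous_fst.comp (continuous_induced_dom
    (f := fun E : BeurlingCarlesonSet => (E.toNonemptyCompacts, E.entropy)))

lemma continuous_entropy : Continuous entropy :=
  continuous_snd.comp (continuous_induced_dom
    (f := fun E : BeurlingCarlesonSet => (E.toNonemptyCompacts, E.entropy)))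

lemma continuous_infDist_carrier (ζ : ℂ) :
    Continuous fun E : BeurlingCarlesonSet => infDist ζ E.carrier :=
  (Metric.lipschitz_infDist_set ζ).continuous.comp continuous_toNonemptyCompacts

lemma abs_infDist_sub_infDist_le (E E' : BeurlingCarlesonSet) (ζ : ℂ) :
    |infDist ζ E'.carrier - infDist ζ E.carrier| ≤
      dist E'.toNonemptyCompacts E.toNonemptyCompacts := by
  have := (Metric.lipschitz_infDist_set ζ).dist_le_mul E'.toNonemptyCompacts E.toNonemptyCompacts
  rwa [NNReal.coe_one, one_mul, Real.dist_eq] at this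

lemma arcDist_pos {ζ : ℂ} (hζ : ζ ∉ E.carrier) : 0 < E.arcDist ζ :=
  mul_pos two_pos (Real.arcsin_pos.2 (div_pos (E.infDist_pos_iff.2 hζ) two_pos))

lemma tendsto_logArcDist {ζ : ℂ} (hζ : ζ ∉ E.carrier) :
    Tendsto (fun E' : BeurlingCarlesonSet => E'.logArcDist ζ) (𝓝 E) (𝓝 (E.logArcDist ζ)) := by
  have h1 : Tendsto (fun E' : BeurlingCarlesonSet => E'.arcDist ζ) (𝓝 E) (𝓝 (E.arcDist ζ)) :=
    ((Real.continuous_arcsin.comp ((continuous_infDist_carrier ζ).div_const 2)).const_mul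
      2).tendsto E
  have h2 := arcDist_pos hζ
  exact (tendsto_const_nhds.div h1 h2.ne').log (by positivity)

lemma ae_notMem_carrier (E : BeurlingCarlesonSet) : ∀ᵐ ζ ∂arcLength, ζ ∉ E.carrier :=
  measure_eq_zero_iff_ae_notMem.1 E.arcLength_eq_zero

lemma integrable_logArcDist (E : BeurlingCarlesonSet) : Integrable E.logArcDist arcLength :=
  integral_logArcDist.1

/-- Both halves of the topology enter: Hausdorff convergence gives pointwise convergence off E, and
convergence of entropies gives convergence of integrals. Scheffé's lemma combines them. -/
lemma tendsto_integral_abs_logArcDist_sub :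
    Tendsto (fun E' : BeurlingCarlesonSet => ∫ ζ, |E'.logArcDist ζ - E.logArcDist ζ| ∂arcLength)
      (𝓝 E) (𝓝 0) := by
  refine tendsto_integral_abs_sub_of_tendsto_integral integrable_logArcDist
    E.integrable_logArcDist (fun E' => logArcDist_nonneg) logArcDist_nonneg ?_ ?_
  · filter_upwards [E.ae_notMem_carrier] with ζ hζ using tendsto_logArcDist hζ
  · simp only [integral_logArcDist.2]
    exact (continuous_entropy.tendsto E).add_const _

/-- The part of the logarithmic distance above the level `T`. -/
def excess (E : BeurlingCarlesonSet) (T : ℝ) (ζ : ℂ) : ℝ := max (E.logArcDist ζ - T) 0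

lemma excess_nonneg (T : ℝ) (ζ : ℂ) : 0 ≤ E.excess T ζ := le_max_right _ _

lemma integrable_excess (E : BeurlingCarlesonSet) (T : ℝ) : Integrable (E.excess T) arcLength :=
  (E.integrable_logArcDist.sub (integrable_const T)).pos_part

lemma abs_excess_sub_excess_le (E E' : BeurlingCarlesonSet) (T T' : ℝ) (ζ : ℂ) :
    |E'.excess T' ζ - E.excess T ζ| ≤ |E'.logArcDist ζ - E.logArcDist ζ| + |T' - T| := by
  refine (abs_max_sub_max_le_abs _ _ _).trans ?_
  rw [show E'.logArcDist ζ - T' - (E.logArcDist ζ - T) =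
    (E'.logArcDist ζ - E.logArcDist ζ) - (T' - T) by ring]
  exact abs_sub _ _

lemma tendsto_integral_excess {T : BeurlingCarlesonSet → ℝ} (hT : ContinuousAt T E) :
    Tendsto (fun E' : BeurlingCarlesonSet => ∫ ζ, E'.excess (T E') ζ ∂arcLength) (𝓝 E)
      (𝓝 (∫ ζ, E.excess (T E) ζ ∂arcLength)) := by
  rw [tendsto_iff_dist_tendsto_zero]
  have h1 : Tendsto (fun E' : BeurlingCarlesonSet =>
      (∫ ζ, |E'.logArcDist ζ - E.logArcDist ζ| ∂arcLength) + |T E' - T E| * arcLength.real univ)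
      (𝓝 E) (𝓝 (0 + |T E - T E| * arcLength.real univ)) :=
    tendsto_integral_abs_logArcDist_sub.add (((hT.tendsto.sub_const _).abs).mul_const _)
  rw [sub_self, abs_zero, zero_mul, add_zero] at h1
  refine squeeze_zero (fun _ => dist_nonneg) (fun E' => ?_) h1
  rw [Real.dist_eq, ← integral_sub (integrable_excess _ _) (integrable_excess _ _)]
  refine (abs_integral_le_integral_abs).trans ?_
  have hi : Integrable (fun ζ => |E'.logArcDist ζ - E.logArcDist ζ|) arcLength :=
    (E'.integrable_logArcDist.sub E.integrable_logArcDist).abs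
  calc ∫ ζ, |E'.excess (T E') ζ - E.excess (T E) ζ| ∂arcLength
      ≤ ∫ ζ, (|E'.logArcDist ζ - E.logArcDist ζ| + |T E' - T E|) ∂arcLength :=
        integral_mono ((integrable_excess _ _).sub (integrable_excess _ _)).abs
          (hi.add (integrable_const _)) fun ζ => abs_excess_sub_excess_le _ _ _ _ _
    _ = _ := by
        rw [integral_add hi (integrable_const _), integral_const, smul_eq_mul, mul_comm |T E' - T E|]

lemma tendsto_integral_excess_atTop (E : BeurlingCarlesonSet) :
    Tendsto (fun T : ℝ => ∫ ζ, E.excess T ζ ∂arcLength) atTop (𝓝 0) := by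
  have : Tendsto (fun T : ℝ => ∫ ζ, E.excess T ζ ∂arcLength) atTop
      (𝓝 (∫ _, (0 : ℝ) ∂arcLength)) := by
    refine tendsto_integral_filter_of_dominated_convergence E.logArcDist
      (Eventually.of_forall fun T => (E.integrable_excess T).aestronglyMeasurable) ?_
      E.integrable_logArcDist ?_
    · filter_upwards [eventually_ge_atTop 0] with T hT
      refine Eventually.of_forall fun ζ => ?_
      rw [Real.norm_of_nonneg (excess_nonneg _ _)]
      exact max_le (by linarith) (logArcDist_nonneg ζ)
    · refine Eventually.of_forall fun ζ => tendsto_const_nhds.congr' ?_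
      filter_upwards [eventually_ge_atTop (E.logArcDist ζ)] with T hT
      rw [excess, max_eq_right (by linarith)]
  rwa [integral_zero] at this

/-- A level with strict inequality at E stays admissible nearby, because the integral of the excess
is continuous in the set; raising a level keeps it admissible. -/
lemma exists_continuous_level (k : ℕ) : ∃ T : BeurlingCarlesonSet → ℝ, Continuous T ∧
    ∀ E, (k : ℝ) ≤ T E ∧ ∫ ζ, E.excess (T E) ζ ∂arcLength ≤ (1 / 2) ^ k := by
  refine exists_continuous_mem_of_eventually_mem
    (t := fun E : BeurlingCarlesonSet =>
      {T | (k : ℝ) ≤ T ∧ ∫ ζ, E.excess T ζ ∂arcLength ≤ (1 / 2) ^ k}) ?_ ?_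
  · refine fun E => Set.OrdConnected.convex ⟨fun a ha b hb c hc => ⟨ha.1.trans hc.1, ?_⟩⟩
    refine le_trans (integral_mono (E.integrable_excess c) (E.integrable_excess a) fun ζ => ?_) ha.2
    exact max_le_max_right _ (by linarith [hc.1])
  · intro E
    have h1 := (E.tendsto_integral_excess_atTop).eventually_lt_const
      (show (0 : ℝ) < (1 / 2) ^ k by positivity)
    obtain ⟨T, hT, hTk⟩ := (h1.and (eventually_ge_atTop (k : ℝ))).exists
    refine ⟨T, ?_⟩
    have h2 := (tendsto_integral_excess (E := E) (T := fun _ => T)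
      continuousAt_const).eventually_lt_const hT
    filter_upwards [h2] with E' hE' using ⟨hTk, hE'.le⟩

/-- Truncation levels of the logarithmic distance, depending continuously on the set. -/
def level (k : ℕ) : BeurlingCarlesonSet → ℝ := (exists_continuous_level k).choose

lemma continuous_level (k : ℕ) : Continuous (level k) := (exists_continuous_level k).choose_spec.1

lemma le_level (k : ℕ) (E : BeurlingCarlesonSet) : (k : ℝ) ≤ level k E :=
  ((exists_continuous_level k).choose_spec.2 E).1

lemma integral_excess_level_le (k : ℕ) (E : BeurlingCarlesonSet) :
    ∫ ζ, E.excess (level k E) ζ ∂arcLength ≤ (1 / 2) ^ k :=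
  ((exists_continuous_level k).choose_spec.2 E).2

/-- A weight growing faster than any multiple of the logarithmic distance. -/
def weight (E : BeurlingCarlesonSet) (ζ : ℂ) : ℝ := ∑' k, E.excess (level k E) ζ

lemma summable_max_sub_natCast (B : ℝ) : Summable fun k : ℕ => max (B - k) 0 := by
  obtain ⟨n, hn⟩ := exists_nat_ge B
  refine summable_of_ne_finset_zero (s := Finset.range n) fun k hk => ?_
  have : (n : ℝ) ≤ k := by exact_mod_cast not_lt.1 (by simpa using hk)
  exact max_eq_right (by linarith)

/-- As the k-th level is at least k, only finitely many terms of the weight are non-zero at a point,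
with a majorant common to all sets whose logarithmic distance there is at most B. -/
lemma excess_level_le {B : ℝ} {ζ : ℂ} (h : E.logArcDist ζ ≤ B) (k : ℕ) :
    E.excess (level k E) ζ ≤ max (B - k) 0 :=
  max_le_max_right _ (by linarith [le_level k E])

lemma summable_excess_level (E : BeurlingCarlesonSet) (ζ : ℂ) :
    Summable fun k => E.excess (level k E) ζ :=
  Summable.of_nonneg_of_le (fun _ => excess_nonneg _ _) (fun k => excess_level_le le_rfl k)
    (summable_max_sub_natCast (E.logArcDist ζ))

lemma weight_nonneg (ζ : ℂ) : 0 ≤ E.weight ζ := tsum_nonneg fun _ => excess_nonneg _ _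

lemma measurable_weight : Measurable E.weight := by
  refine measurable_of_tendsto_metrizable (f := fun n ζ => ∑ k ∈ Finset.range n,
    E.excess (level k E) ζ) (fun n => ?_) ?_
  · exact Finset.measurable_fun_sum _ fun k _ =>
      (measurable_logArcDist.sub_const _).max measurable_const
  · exact tendsto_pi_nhds.2 fun ζ => (E.summable_excess_level ζ).hasSum.tendsto_sum_nat

/-- Each of the first n terms contributes at least the logarithmic distance minus its level. Since n
is arbitrary, this is the source of vanishing to infinite order. -/
lemma sum_le_weight (n : ℕ) (ζ : ℂ) :
    n * E.logArcDist ζ - ∑ k ∈ Finset.range n, level k E ≤ E.weight ζ := by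
  refine le_trans ?_ ((E.summable_excess_level ζ).sum_le_tsum (Finset.range n)
    fun _ _ => excess_nonneg _ _)
  calc n * E.logArcDist ζ - ∑ k ∈ Finset.range n, level k E
      = ∑ k ∈ Finset.range n, (E.logArcDist ζ - level k E) := by simp
    _ ≤ _ := Finset.sum_le_sum fun k _ => le_max_left _ _

lemma hasSum_integral_excess (E : BeurlingCarlesonSet) :
    HasSum (fun k => ∫ ζ, E.excess (level k E) ζ ∂arcLength) (∫ ζ, E.weight ζ ∂arcLength) := by
  refine hasSum_integral_of_summable_integral_norm (fun k => E.integrable_excess _) ?_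
  refine Summable.of_nonneg_of_le (fun k => integral_nonneg fun _ => norm_nonneg _) (fun k => ?_)
    summable_geometric_two
  simp only [Real.norm_of_nonneg (excess_nonneg _ _)]
  exact integral_excess_level_le k E

lemma integrable_weight (E : BeurlingCarlesonSet) : Integrable E.weight arcLength := by
  refine ⟨measurable_weight.aestronglyMeasurable, ?_⟩
  rw [hasFiniteIntegral_iff_ofReal (Eventually.of_forall weight_nonneg)]
  have h1 : ∀ ζ, ENNReal.ofReal (E.weight ζ) =
      ∑' k, ENNReal.ofReal (E.excess (level k E) ζ) := fun ζ =>
    ENNReal.ofReal_tsum_of_nonneg (fun _ => excess_nonneg _ _) (E.summable_excess_level ζ)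
  simp only [h1]
  rw [lintegral_tsum fun k => (E.integrable_excess _).aestronglyMeasurable.aemeasurable.ennreal_ofReal]
  have h2 : ∀ k, ∫⁻ ζ, ENNReal.ofReal (E.excess (level k E) ζ) ∂arcLength ≤
      ENNReal.ofReal ((1 / 2) ^ k) := fun k => by
    rw [← ofReal_integral_eq_lintegral_ofReal (E.integrable_excess _)
      (Eventually.of_forall fun _ => excess_nonneg _ _)]
    exact ENNReal.ofReal_le_ofReal (integral_excess_level_le k E)
  refine lt_of_le_of_lt (ENNReal.tsum_le_tsum h2) ?_
  rw [← ENNReal.ofReal_tsum_of_nonneg (fun _ => by positivity) summable_geometric_two]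
  exact ENNReal.ofReal_lt_top

lemma integral_weight_le (E : BeurlingCarlesonSet) : ∫ ζ, E.weight ζ ∂arcLength ≤ 2 := by
  rw [← E.hasSum_integral_excess.tsum_eq, ← tsum_geometric_two]
  exact E.hasSum_integral_excess.summable.tsum_le_tsum (fun k => integral_excess_level_le k E)
    summable_geometric_two

/-- The weights depend continuously on the set, in the mean. -/
lemma tendsto_integral_abs_weight_sub :
    Tendsto (fun E' : BeurlingCarlesonSet => ∫ ζ, |E'.weight ζ - E.weight ζ| ∂arcLength)
      (𝓝 E) (𝓝 0) := by
  -- Scheffé again. The series converges pointwise with majorant (B - k)⁺, and its integrals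
  -- converge with majorant 2^(-k).
  refine tendsto_integral_abs_sub_of_tendsto_integral integrable_weight
    E.integrable_weight (fun E' => weight_nonneg) weight_nonneg ?_ ?_
  · filter_upwards [E.ae_notMem_carrier] with ζ hζ
    have h1 := tendsto_logArcDist hζ
    refine tendsto_tsum_of_dominated_convergence
      (summable_max_sub_natCast (E.logArcDist ζ + 1)) (fun k => ?_) ?_
    · exact (h1.sub ((continuous_level k).tendsto E)).max tendsto_const_nhds
    · filter_upwards [h1.eventually_lt_const (lt_add_one _)] with E' hE' k
      rw [Real.norm_of_nonneg (excess_nonneg _ _)]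
      exact excess_level_le hE'.le k
  · simp only [← (hasSum_integral_excess _).tsum_eq]
    refine tendsto_tsum_of_dominated_convergence summable_geometric_two
      (fun k => tendsto_integral_excess (continuous_level k).continuousAt)
      (Eventually.of_forall fun E' k => ?_)
    rw [Real.norm_of_nonneg (integral_nonneg fun _ => excess_nonneg _ _)]
    exact integral_excess_level_le k E'

end BeurlingCarlesonSet

/-! ### Herglotz integrals with poles outside the closed disk -/

lemma herglotzRieszKernel_zero (z a : ℂ) : herglotzRieszKernel 0 z a = (a + z) / (a - z) := by
  simp [herglotzRieszKernel_def]

lemma re_herglotzRieszKernel_zero (z a : ℂ) :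
    (herglotzRieszKernel 0 z a).re = (‖a‖ ^ 2 - ‖z‖ ^ 2) / ‖a - z‖ ^ 2 := by
  have : (herglotzRieszKernel 0 z a).re = poissonKernel 0 z a := by
    rw [poissonKernel_eq_re_herglotzRieszKernel]; rfl
  rw [this, poissonKernel_def]
  simp

lemma two_mul_le_arcLength_closedBall {u : ℂ} (hu : ‖u‖ = 1) {s : ℝ}
    (hs : s ≤ Real.pi) : 2 * s ≤ arcLength.real (closedBall u s) := by
  obtain ⟨φ, -, rfl⟩ := exists_mem_Ico_circleMap_eq hu 0
  rw [Measure.real, ← ENNReal.ofReal_le_iff_le_toReal (measure_ne_top _ _),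
    arcLength_eq_map_Ioc (φ - Real.pi), Measure.map_apply (measurable_circleMap 0 1)
      measurableSet_closedBall, Measure.restrict_apply
      ((measurable_circleMap 0 1) measurableSet_closedBall)]
  calc ENNReal.ofReal (2 * s) = volume (Ioc (φ - s) (φ + s)) := by
        rw [Real.volume_Ioc]; congr 1; ring
    _ ≤ _ := by
        refine measure_mono fun θ hθ => ⟨?_, by linarith [hθ.1], by linarith [hθ.2]⟩
        rw [mem_preimage, mem_closedBall]
        have h1 := (lipschitzWith_circleMap 0 1).dist_le_mul θ φ
        have h2 : dist θ φ ≤ s := by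
          rw [Real.dist_eq, abs_le]; constructor <;> linarith [hθ.1, hθ.2]
        have h3 : ((Real.nnabs 1 : NNReal) : ℝ) = 1 := by simp
        rw [h3, one_mul] at h1
        exact h1.trans h2

namespace BeurlingCarlesonSet

variable {E : BeurlingCarlesonSet}

/-- The pole attached to a point of the circle: its radial reflection at distance `dist(ζ, E)`. -/
def pole (E : BeurlingCarlesonSet) (ζ : ℂ) : ℂ := ((1 + infDist ζ E.carrier : ℝ) : ℂ) * ζ

/-- A region containing the closed disk without `E`. -/
def region (E : BeurlingCarlesonSet) (ε : ℝ) : Set ℂ := {z | ‖z‖ < 1 + ε * infDist z E.carrier}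

lemma measurable_pole : Measurable E.pole :=
  ((Complex.continuous_ofReal.comp (continuous_const.add (continuous_infDist_pt _))).mul
    continuous_id).measurable

lemma norm_pole {ζ : ℂ} (hζ : ‖ζ‖ = 1) : ‖E.pole ζ‖ = 1 + infDist ζ E.carrier := by
  rw [pole, norm_mul, hζ, mul_one, Complex.norm_real,
    Real.norm_of_nonneg (by linarith [infDist_nonneg (x := ζ) (s := E.carrier)])]

lemma norm_pole_sub {ζ : ℂ} (hζ : ‖ζ‖ = 1) : ‖E.pole ζ - ζ‖ = infDist ζ E.carrier := by
  have : E.pole ζ - ζ = ((infDist ζ E.carrier : ℝ) : ℂ) * ζ := by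
    rw [pole]; push_cast; ring
  rw [this, norm_mul, hζ, mul_one, Complex.norm_real, Real.norm_of_nonneg infDist_nonneg]

lemma norm_pole_le {ζ : ℂ} (hζ : ‖ζ‖ = 1) : ‖E.pole ζ‖ ≤ 3 := by
  rw [norm_pole hζ]
  linarith [E.infDist_le_norm_add_one ζ]

lemma isOpen_region (ε : ℝ) : IsOpen (E.region ε) :=
  isOpen_lt continuous_norm
    (continuous_const.add (continuous_const.mul (continuous_infDist_pt _)))

lemma mem_region_of_mem_closedBall {ε : ℝ} (hε : 0 < ε) {z : ℂ} (hz : z ∈ closedBall (0 : ℂ) 1)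
    (hzE : z ∉ E.carrier) : z ∈ E.region ε := by
  have h1 : ‖z‖ ≤ 1 := by simpa using hz
  have h2 := mul_pos hε (E.infDist_pos_iff.2 hzE)
  rw [region, mem_ofPred_eq]
  linarith

lemma notMem_of_mem_region {ε : ℝ} {z : ℂ} (hz : z ∈ E.region ε) : z ∉ E.carrier := by
  intro h
  rw [region, mem_ofPred_eq, infDist_zero_of_mem h, E.norm_of_mem h] at hz
  linarith

lemma norm_lt_two_of_mem_region {z : ℂ} (hz : z ∈ E.region (1 / 8)) : ‖z‖ < 2 := by
  rw [region, mem_ofPred_eq] at hz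
  linarith [E.infDist_le_norm_add_one z]

/-- With X the distance from z to the pole and d = dist(ζ, E), comparing moduli gives d ≤ X + D/8,
and the triangle inequality through ζ gives D ≤ 2d + X. Hence D ≤ 3X + D/4. -/
lemma infDist_le_four_mul_norm_pole_sub {z ζ : ℂ} (hz : z ∈ E.region (1 / 8)) (hζ : ‖ζ‖ = 1) :
    infDist z E.carrier ≤ 4 * ‖E.pole ζ - z‖ := by
  rw [region, mem_ofPred_eq] at hz
  have h1 := norm_sub_norm_le (E.pole ζ) z
  rw [norm_pole hζ] at h1
  have h2 := infDist_le_infDist_add_dist (s := E.carrier) (x := z) (y := ζ)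
  have h3 : dist z ζ ≤ ‖E.pole ζ - z‖ + infDist ζ E.carrier := by
    rw [← norm_pole_sub hζ, dist_eq_norm, norm_sub_rev (E.pole ζ) z]
    exact norm_sub_le_norm_sub_add_norm_sub _ _ _
  linarith

lemma ae_norm_eq_one : ∀ᵐ ζ ∂arcLength, ‖ζ‖ = 1 := by
  have h : ∀ᵐ ζ ∂arcLength, ζ ∈ sphere (0 : ℂ) 1 := arcLength_compl_sphere
  filter_upwards [h] with ζ hζ using by simpa using hζ

lemma norm_kernel_le {z ζ : ℂ} (hz : z ∈ E.region (1 / 8)) (hζ : ‖ζ‖ = 1) :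
    ‖herglotzRieszKernel 0 z (E.pole ζ)‖ ≤ 20 / infDist z E.carrier := by
  have hD := E.infDist_pos_iff.2 (notMem_of_mem_region hz)
  have h1 := infDist_le_four_mul_norm_pole_sub hz hζ
  have h2 : 0 < ‖E.pole ζ - z‖ := by linarith
  rw [herglotzRieszKernel_zero, norm_div, div_le_div_iff₀ h2 hD]
  have h3 : ‖E.pole ζ + z‖ ≤ 5 := by
    linarith [norm_add_le (E.pole ζ) z, norm_pole_le (E := E) hζ, norm_lt_two_of_mem_region hz]
  nlinarith [norm_nonneg (E.pole ζ + z)]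

lemma measurable_kernel (z : ℂ) : Measurable fun ζ => herglotzRieszKernel 0 z (E.pole ζ) := by
  simp only [herglotzRieszKernel_zero]
  exact (measurable_pole.add_const z).div (measurable_pole.sub_const z)

lemma integrable_kernel_mul_weight {z : ℂ} (hz : z ∈ E.region (1 / 8)) :
    Integrable (fun ζ => herglotzRieszKernel 0 z (E.pole ζ) * (E.weight ζ : ℂ)) arcLength := by
  refine Integrable.bdd_mul (c := 20 / infDist z E.carrier) E.integrable_weight.ofReal
    (measurable_kernel z).aestronglyMeasurable ?_
  filter_upwards [ae_norm_eq_one] with ζ hζ using norm_kernel_le hz hζ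

/-- The holomorphic function whose negative is the logarithm of the outer function. -/
def herglotz (E : BeurlingCarlesonSet) (z : ℂ) : ℂ :=
  ∫ ζ, herglotzRieszKernel 0 z (E.pole ζ) * (E.weight ζ : ℂ) ∂arcLength

lemma norm_herglotz_le {z : ℂ} (hz : z ∈ E.region (1 / 8)) :
    ‖E.herglotz z‖ ≤ 40 / infDist z E.carrier := by
  calc ‖E.herglotz z‖ ≤ ∫ ζ, 20 / infDist z E.carrier * E.weight ζ ∂arcLength := by
        refine norm_integral_le_of_norm_le (E.integrable_weight.const_mul _) ?_
        filter_upwards [ae_norm_eq_one] with ζ hζ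
        rw [norm_mul, Complex.norm_real, Real.norm_of_nonneg (weight_nonneg ζ)]
        exact mul_le_mul_of_nonneg_right (norm_kernel_le hz hζ) (weight_nonneg ζ)
    _ = 20 / infDist z E.carrier * ∫ ζ, E.weight ζ ∂arcLength := integral_const_mul _ _
    _ ≤ 20 / infDist z E.carrier * 2 := by
        exact mul_le_mul_of_nonneg_left E.integral_weight_le
          (div_nonneg (by norm_num) infDist_nonneg)
    _ = _ := by ring

lemma differentiableOn_herglotz : DifferentiableOn ℂ E.herglotz (E.region (1 / 8)) := by
  intro z₀ hz₀
  refine DifferentiableAt.differentiableWithinAt ?_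
  have hD := E.infDist_pos_iff.2 (notMem_of_mem_region hz₀)
  set D := infDist z₀ E.carrier with hDdef
  -- Where the distance to E stays above D/2, poles stay D/8 away, so the differentiated kernel is
  -- at most 2·3/(D/8)² = 384/D².
  have hmem : E.region (1 / 8) ∩ {z | D / 2 < infDist z E.carrier} ∈ 𝓝 z₀ :=
    inter_mem ((isOpen_region _).mem_nhds hz₀)
      ((isOpen_lt continuous_const (continuous_infDist_pt _)).mem_nhds
        (by rw [mem_ofPred_eq, ← hDdef]; linarith))
  obtain ⟨r, hr, hball⟩ := Metric.mem_nhds_iff.1 hmem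
  refine (hasDerivAt_integral_of_dominated_loc_of_deriv_le (μ := arcLength)
    (F := fun z ζ => herglotzRieszKernel 0 z (E.pole ζ) * (E.weight ζ : ℂ))
    (F' := fun z ζ => 2 * E.pole ζ / (E.pole ζ - z) ^ 2 * (E.weight ζ : ℂ))
    (bound := fun ζ => 384 / D ^ 2 * E.weight ζ) (ball_mem_nhds z₀ hr) ?_
    (integrable_kernel_mul_weight hz₀) ?_ ?_ (E.integrable_weight.const_mul _) ?_).2.differentiableAt
  · exact Eventually.of_forall fun z => ((measurable_kernel z).mul
      (Complex.measurable_ofReal.comp measurable_weight)).aestronglyMeasurable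
  · exact (((measurable_pole.const_mul 2).div ((measurable_pole.sub_const z₀).pow_const 2)).mul
      (Complex.measurable_ofReal.comp measurable_weight)).aestronglyMeasurable
  · filter_upwards [ae_norm_eq_one] with ζ hζ z hz
    obtain ⟨hz1, hz2⟩ := hball hz
    rw [mem_ofPred_eq] at hz2
    have h1 := infDist_le_four_mul_norm_pole_sub hz1 hζ
    rw [norm_mul, Complex.norm_real, Real.norm_of_nonneg (weight_nonneg ζ)]
    refine mul_le_mul_of_nonneg_right ?_ (weight_nonneg ζ)
    have h2 : D / 8 ≤ ‖E.pole ζ - z‖ := by linarith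
    rw [norm_div, norm_mul, norm_pow, Complex.norm_ofNat]
    calc 2 * ‖E.pole ζ‖ / ‖E.pole ζ - z‖ ^ 2 ≤ 2 * 3 / (D / 8) ^ 2 := by
          gcongr
          exact norm_pole_le hζ
      _ = 384 / D ^ 2 := by field_simp; norm_num
  · filter_upwards [ae_norm_eq_one] with ζ hζ z hz
    obtain ⟨hz1, hz2⟩ := hball hz
    rw [mem_ofPred_eq] at hz2
    have h1 := infDist_le_four_mul_norm_pole_sub hz1 hζ
    have h2 : E.pole ζ - z ≠ 0 := norm_pos_iff.1 (by linarith)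
    simp only [herglotzRieszKernel_zero]
    refine HasDerivAt.mul_const ?_ _
    have h3 := ((hasDerivAt_id z).const_add (E.pole ζ)).div
      ((hasDerivAt_id z).const_sub (E.pole ζ)) h2
    refine h3.congr_deriv ?_
    simp only [id]
    ring

lemma re_herglotz {z : ℂ} (hz : z ∈ E.region (1 / 8)) :
    (E.herglotz z).re = ∫ ζ, (herglotzRieszKernel 0 z (E.pole ζ)).re * E.weight ζ ∂arcLength := by
  have h := Complex.reCLM.integral_comp_comm (integrable_kernel_mul_weight hz)
  rw [herglotz]
  refine h.symm.trans ?_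
  simp

lemma re_kernel_nonneg {z ζ : ℂ} (hz : z ∈ closedBall (0 : ℂ) 1) (hζ : ‖ζ‖ = 1) :
    0 ≤ (herglotzRieszKernel 0 z (E.pole ζ)).re := by
  rw [re_herglotzRieszKernel_zero, norm_pole hζ]
  have h1 : ‖z‖ ≤ 1 := by simpa using hz
  refine div_nonneg ?_ (by positivity)
  nlinarith [norm_nonneg z, infDist_nonneg (x := ζ) (s := E.carrier)]

lemma re_herglotz_nonneg {z : ℂ} (hz : z ∈ closedBall (0 : ℂ) 1) (hzE : z ∉ E.carrier) :
    0 ≤ (E.herglotz z).re := by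
  rw [re_herglotz (mem_region_of_mem_closedBall (by norm_num) hz hzE)]
  refine integral_nonneg_of_ae ?_
  filter_upwards [ae_norm_eq_one] with ζ hζ
  exact mul_nonneg (re_kernel_nonneg hz hζ) (weight_nonneg ζ)

/-! ### Lower bound for the real part of the Herglotz integral -/

lemma arcDist_le_two_mul_infDist {ζ : ℂ} (hζ : ‖ζ‖ = 1) :
    E.arcDist ζ ≤ Real.pi / 2 * infDist ζ E.carrier := by
  have h0 : 0 ≤ infDist ζ E.carrier := infDist_nonneg
  have h2 := E.infDist_le_norm_add_one ζ
  have h3 : 0 ≤ Real.arcsin (infDist ζ E.carrier / 2) := Real.arcsin_nonneg.2 (by positivity)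
  have h4 := Real.mul_le_sin h3 (Real.arcsin_le_pi_div_two _)
  rw [Real.sin_arcsin (by linarith) (by linarith)] at h4
  rw [div_mul_eq_mul_div, div_le_iff₀ Real.pi_pos] at h4
  unfold arcDist
  linarith

/-- Near the radial projection u of z everything is comparable to D. One has d = dist(ζ, E) ≤ 9D/4,
the pole is within 7D/2 of z, and (1 + d)² - |z|² ≥ 3D/4, so the real part of the kernel is at least
3/(49D) ≥ 1/(17D). The arc distance is at most (π/2)(9/4)D ≤ 4D, whence the logarithmic distance is
at least log(1/D). -/
lemma kernel_weight_lower_bound {z u ζ : ℂ} (hz : z ∈ closedBall (0 : ℂ) 1)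
    (hu : ‖u - z‖ = 1 - ‖z‖) (hζ : ‖ζ‖ = 1) (hζE : ζ ∉ E.carrier) (hzE : z ∉ E.carrier)
    (hζu : ζ ∈ closedBall u (infDist z E.carrier / 4)) (n : ℕ) :
    (n * Real.log (1 / infDist z E.carrier) - ∑ k ∈ Finset.range n, level k E) /
        (17 * infDist z E.carrier) ≤
      (herglotzRieszKernel 0 z (E.pole ζ)).re * E.weight ζ := by
  have hD := E.infDist_pos_iff.2 hzE
  set D := infDist z E.carrier with hDdef
  set d := infDist ζ E.carrier with hd
  have hz1 : ‖z‖ ≤ 1 := by simpa using hz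
  have hr := E.one_sub_norm_le_infDist z
  rw [← hDdef] at hr
  rw [mem_closedBall, dist_eq_norm] at hζu
  have e1 : D ≤ infDist u E.carrier + ‖u - z‖ := by
    rw [norm_sub_rev, ← dist_eq_norm]; exact infDist_le_infDist_add_dist
  have e2 : infDist u E.carrier ≤ D + ‖u - z‖ := by
    rw [← dist_eq_norm]; exact infDist_le_infDist_add_dist
  have e3 : infDist u E.carrier ≤ d + ‖ζ - u‖ := by
    rw [norm_sub_rev, ← dist_eq_norm]; exact infDist_le_infDist_add_dist
  have e4 : d ≤ infDist u E.carrier + ‖ζ - u‖ := by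
    rw [← dist_eq_norm]; exact infDist_le_infDist_add_dist
  have e5 : ‖E.pole ζ - z‖ ≤ d + ‖ζ - u‖ + ‖u - z‖ := by
    rw [hd, ← norm_pole_sub hζ]
    calc ‖E.pole ζ - z‖ = ‖(E.pole ζ - ζ) + (ζ - u) + (u - z)‖ := by congr 1; ring
      _ ≤ _ := norm_add₃_le
  have hd0 : 0 < d := E.infDist_pos_iff.2 hζE
  have hpos : 0 < ‖E.pole ζ - z‖ := by
    have := infDist_le_four_mul_norm_pole_sub
      (mem_region_of_mem_closedBall (by norm_num) hz hzE) hζ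
    linarith
  have hker : 1 / (17 * D) ≤ (herglotzRieszKernel 0 z (E.pole ζ)).re := by
    rw [re_herglotzRieszKernel_zero, norm_pole hζ, ← hd, div_le_div_iff₀ (by positivity)
      (by positivity), one_mul]
    have h1 : ‖E.pole ζ - z‖ ≤ 7 / 2 * D := by linarith
    have h2 : 3 / 4 * D ≤ 1 + d - ‖z‖ := by linarith
    have h3 : ‖E.pole ζ - z‖ ^ 2 ≤ (7 / 2 * D) ^ 2 := by gcongr
    have h4 : 3 / 4 * D ≤ (1 + d) ^ 2 - ‖z‖ ^ 2 := by nlinarith [norm_nonneg z]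
    nlinarith
  have hlog : Real.log (1 / D) ≤ E.logArcDist ζ := by
    have h1 := arcDist_pos hζE
    have h2 := arcDist_le_two_mul_infDist (E := E) hζ
    refine Real.log_le_log (by positivity) ?_
    rw [div_le_div_iff₀ hD h1]
    have h3 : d ≤ 9 / 4 * D := by linarith
    nlinarith [Real.pi_lt_d2, Real.pi_pos]
  have hw : n * Real.log (1 / D) - ∑ k ∈ Finset.range n, level k E ≤ E.weight ζ :=
    le_trans (by gcongr) (sum_le_weight n ζ)
  rw [div_eq_mul_one_div, mul_comm]
  have hw0 := weight_nonneg (E := E) ζ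
  calc 1 / (17 * D) * (n * Real.log (1 / D) - ∑ k ∈ Finset.range n, level k E)
      ≤ 1 / (17 * D) * E.weight ζ := by gcongr
    _ ≤ _ := by gcongr

/-- The integrand is non-negative, so it may be restricted to an arc of length at least D/2 around
the projection of z, where it is at least m/(17D). If m ≤ 0, positivity suffices. -/
lemma le_re_herglotz {z : ℂ} (hz : z ∈ closedBall (0 : ℂ) 1) (hzE : z ∉ E.carrier) (n : ℕ) :
    (n * Real.log (1 / infDist z E.carrier) - ∑ k ∈ Finset.range n, level k E) / 34 ≤
      (E.herglotz z).re := by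
  have hD := E.infDist_pos_iff.2 hzE
  have hz1 : ‖z‖ ≤ 1 := by simpa using hz
  have hD2 : infDist z E.carrier ≤ 2 := by linarith [E.infDist_le_norm_add_one z]
  set D := infDist z E.carrier with hDdef
  set m := n * Real.log (1 / D) - ∑ k ∈ Finset.range n, level k E with hm
  rcases le_or_gt m 0 with h0 | h0
  · linarith [re_herglotz_nonneg hz hzE]
  obtain ⟨u, hu1, hu⟩ : ∃ u : ℂ, ‖u‖ = 1 ∧ ‖u - z‖ = 1 - ‖z‖ := by
    rcases eq_or_ne z 0 with rfl | h
    · exact ⟨1, by simp⟩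
    · have hn : (‖z‖ : ℂ) ≠ 0 := by simpa using h
      refine ⟨z / ‖z‖, by rw [norm_div, Complex.norm_real, norm_norm, div_self (by simpa using h)],
        ?_⟩
      have : z / ‖z‖ - z = ((1 - ‖z‖ : ℝ) : ℂ) * (z / ‖z‖) := by
        push_cast; field_simp
      rw [this, norm_mul, norm_div, Complex.norm_real, Complex.norm_real, norm_norm,
        div_self (by simpa using h), mul_one, Real.norm_of_nonneg (by linarith)]
  have hreg := mem_region_of_mem_closedBall (show (0 : ℝ) < 1 / 8 by norm_num) hz hzE
  have hint : Integrable (fun ζ => (herglotzRieszKernel 0 z (E.pole ζ)).re * E.weight ζ)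
      arcLength := by
    have := (integrable_kernel_mul_weight hreg).re
    simpa using this
  have hnn : 0 ≤ᵐ[arcLength] fun ζ => (herglotzRieszKernel 0 z (E.pole ζ)).re * E.weight ζ := by
    filter_upwards [ae_norm_eq_one] with ζ hζ
    exact mul_nonneg (re_kernel_nonneg hz hζ) (weight_nonneg ζ)
  rw [re_herglotz hreg]
  calc m / 34 = 2 * (D / 4) * (m / (17 * D)) := by field_simp; ring
    _ ≤ arcLength.real (closedBall u (D / 4)) * (m / (17 * D)) := by
        refine mul_le_mul_of_nonneg_right (two_mul_le_arcLength_closedBall hu1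
          (by linarith [Real.pi_gt_three])) (by positivity)
    _ = ∫ _ in closedBall u (D / 4), m / (17 * D) ∂arcLength := by
        rw [setIntegral_const, smul_eq_mul]
    _ ≤ ∫ ζ in closedBall u (D / 4),
          (herglotzRieszKernel 0 z (E.pole ζ)).re * E.weight ζ ∂arcLength := by
        refine setIntegral_mono_on_ae (integrable_const _).integrableOn hint.integrableOn
          measurableSet_closedBall ?_
        filter_upwards [ae_norm_eq_one, E.ae_notMem_carrier] with ζ hζ hζE hζu
        exact kernel_weight_lower_bound hz hu hζ hζE hzE hζu n
    _ ≤ _ := setIntegral_le_integral hint hnn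

/-! ### The outer functions -/

open Classical in
/-- The outer function attached to a Beurling-Carleson set. -/
def outerFunction (E : BeurlingCarlesonSet) (z : ℂ) : ℂ :=
  if z ∈ E.carrier then 0 else Complex.exp (-E.herglotz z)

lemma outerFunction_of_mem {z : ℂ} (h : z ∈ E.carrier) : E.outerFunction z = 0 := if_pos h

lemma outerFunction_of_notMem {z : ℂ} (h : z ∉ E.carrier) :
    E.outerFunction z = Complex.exp (-E.herglotz z) := if_neg h

lemma outerFunction_eq_zero_iff (z : ℂ) : E.outerFunction z = 0 ↔ z ∈ E.carrier := by
  by_cases h : z ∈ E.carrier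
  · simp [outerFunction_of_mem, h]
  · simp [outerFunction_of_notMem h, h, Complex.exp_ne_zero]

lemma notMem_of_mem_ball {z : ℂ} (hz : z ∈ ball (0 : ℂ) 1) : z ∉ E.carrier := fun h => by
  have := E.norm_of_mem h
  rw [mem_ball_zero_iff] at hz
  linarith

/-- The constant in the decay estimate of order `N` of the outer function. -/
def decayConstant (N : ℕ) (E : BeurlingCarlesonSet) : ℝ :=
  Real.exp ((∑ k ∈ Finset.range (34 * N), level k E) / 34)

lemma continuous_decayConstant (N : ℕ) : Continuous (decayConstant N) :=
  Real.continuous_exp.comp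
    ((continuous_finsetSum _ fun k _ => continuous_level k).div_const 34)

lemma norm_outerFunction_le (N : ℕ) {z : ℂ} (hz : z ∈ closedBall (0 : ℂ) 1)
    (hzE : z ∉ E.carrier) :
    ‖E.outerFunction z‖ ≤ decayConstant N E * infDist z E.carrier ^ N := by
  have hD := E.infDist_pos_iff.2 hzE
  -- Taking 34N terms compensates the factor 1/34. For N = 0 the sum of levels is empty, which gives
  -- the constant 1.
  have h := le_re_herglotz hz hzE (34 * N)
  rw [outerFunction_of_notMem hzE, Complex.norm_exp, decayConstant]
  have h1 : infDist z E.carrier ^ N = Real.exp (N * Real.log (infDist z E.carrier)) := by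
    rw [Real.exp_nat_mul, Real.exp_log hD]
  rw [h1, ← Real.exp_add]
  refine Real.exp_le_exp.2 ?_
  rw [one_div, Real.log_inv] at h
  push_cast at h
  rw [Complex.neg_re]
  linarith

end BeurlingCarlesonSet

/-! ### The Schwarz formula for Herglotz kernels -/

lemma differentiableOn_herglotzRieszKernel_zero {a : ℂ} (ha : 1 < ‖a‖) :
    DifferentiableOn ℂ (fun ζ => herglotzRieszKernel 0 ζ a) (closedBall 0 1) := by
  simp only [herglotzRieszKernel_zero]
  refine DifferentiableOn.div (by fun_prop) (by fun_prop) fun ζ hζ h => ?_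
  rw [mem_closedBall_zero_iff, ← sub_eq_zero.1 h] at hζ
  linarith

lemma diffContOnCl_of_closedBall {f : ℂ → ℂ} (hf : DifferentiableOn ℂ f (closedBall 0 1)) :
    DiffContOnCl ℂ f (ball 0 |1|) := by
  rw [abs_one]
  exact DifferentiableOn.diffContOnCl (by rwa [closure_ball (0 : ℂ) one_ne_zero])

lemma circleIntegrable_of_closedBall {f : ℂ → ℂ} (hf : DifferentiableOn ℂ f (closedBall 0 1)) :
    CircleIntegrable f 0 1 :=
  (hf.continuousOn.mono sphere_subset_closedBall).circleIntegrable zero_le_one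

lemma herglotzRieszKernel_at_zero {a : ℂ} (ha : a ≠ 0) : herglotzRieszKernel 0 0 a = 1 := by
  rw [herglotzRieszKernel_zero, add_zero, sub_zero, div_self ha]

lemma continuousOn_herglotzRieszKernel_unit_sphere {z : ℂ} (hz : z ∈ ball (0 : ℂ) 1) :
    ContinuousOn (fun ζ => herglotzRieszKernel 0 z ζ) (sphere 0 1) := by
  simp only [herglotzRieszKernel_zero]
  refine ContinuousOn.div (by fun_prop) (by fun_prop) fun ζ hζ h => ?_
  rw [mem_sphere_zero_iff_norm, sub_eq_zero.1 h] at hζ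
  rw [mem_ball_zero_iff] at hz
  linarith

/-- Schwarz's formula, for a Herglotz kernel with pole outside the closed disk. -/
lemma circleAverage_herglotzRieszKernel_mul_re {a z : ℂ} (ha : 1 < ‖a‖)
    (hz : z ∈ ball (0 : ℂ) 1) :
    Real.circleAverage (fun ζ => herglotzRieszKernel 0 z ζ *
      ((herglotzRieszKernel 0 ζ a).re : ℂ)) 0 1 = herglotzRieszKernel 0 z a := by
  have hz1 : ‖z‖ < 1 := by simpa using hz
  have ha0 : a ≠ 0 := norm_pos_iff.1 (by linarith)
  set k : ℂ → ℂ := fun ζ => herglotzRieszKernel 0 ζ a with hk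
  have hkd : DifferentiableOn ℂ k (closedBall 0 1) := differentiableOn_herglotzRieszKernel_zero ha
  -- On the circle the conjugate of q is the Herglotz kernel at z, and q is holomorphic on the
  -- closed disk. Writing Re k = (k + k̄)/2, the part with k is (ζ/(ζ - z) - 1/2)k, with average
  -- k(z) - k(0)/2 by Cauchy; the part with k̄ is half the conjugate of qk, with average 1/2. As
  -- k(0) = 1, the halves cancel.
  set q : ℂ → ℂ := fun ζ => (1 + (starRingEnd ℂ) z * ζ) / (1 - (starRingEnd ℂ) z * ζ) with hq
  have hden : ∀ ζ ∈ closedBall (0 : ℂ) 1, 1 - (starRingEnd ℂ) z * ζ ≠ 0 := fun ζ hζ h => by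
    have h1 : ‖(starRingEnd ℂ) z * ζ‖ = 1 := by rw [← sub_eq_zero.1 h, norm_one]
    rw [norm_mul, RCLike.norm_conj] at h1
    rw [mem_closedBall_zero_iff] at hζ
    nlinarith [norm_nonneg z, norm_nonneg ζ]
  have hqd : DifferentiableOn ℂ q (closedBall 0 1) :=
    DifferentiableOn.div (by fun_prop) (by fun_prop) hden
  have hne : ∀ ζ ∈ sphere (0 : ℂ) 1, ζ - z ≠ 0 := fun ζ hζ h => by
    rw [mem_sphere_zero_iff_norm, sub_eq_zero.1 h] at hζ
    linarith
  have a1 : Real.circleAverage (fun ζ => (ζ / (ζ - z)) • k ζ) 0 1 = k z := by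
    have := (diffContOnCl_of_closedBall hkd).circleAverage_smul_div (w := z) (by simpa using hz1)
    simpa using this
  have a2 : Real.circleAverage k 0 1 = 1 := by
    rw [(diffContOnCl_of_closedBall hkd).circleAverage]
    exact herglotzRieszKernel_at_zero ha0
  have a3 : Real.circleAverage (fun ζ => (starRingEnd ℂ) (q ζ * k ζ)) 0 1 = 1 := by
    have h1 := Complex.conjCLE.toContinuousLinearMap.circleAverage_comp_comm
      (circleIntegrable_of_closedBall (hqd.mul hkd))
    have h2 : Real.circleAverage (q * k) 0 1 = 1 := by
      rw [(diffContOnCl_of_closedBall (hqd.mul hkd)).circleAverage]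
      simp [hq, hk, herglotzRieszKernel_at_zero ha0]
    refine h1.trans ?_
    rw [h2]
    simp
  have i1 : CircleIntegrable (fun ζ => (ζ / (ζ - z)) • k ζ) 0 1 := by
    refine ContinuousOn.circleIntegrable zero_le_one ?_
    exact ((continuousOn_id.div (by fun_prop) hne).smul
      (hkd.continuousOn.mono sphere_subset_closedBall))
  have i2 : CircleIntegrable (fun ζ => (-(1 / 2) : ℂ) • k ζ) 0 1 :=
    (circleIntegrable_of_closedBall hkd).const_smul
  have i3 : CircleIntegrable (fun ζ => (1 / 2 : ℂ) • (starRingEnd ℂ) (q ζ * k ζ)) 0 1 := by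
    refine ContinuousOn.circleIntegrable zero_le_one ?_
    have h1 : ContinuousOn (fun ζ => (starRingEnd ℂ) (q ζ * k ζ)) (sphere 0 1) :=
      Complex.continuous_conj.comp_continuousOn
        ((hqd.mul hkd).continuousOn.mono sphere_subset_closedBall)
    exact ContinuousOn.const_smul (c := (1 / 2 : ℂ)) h1
  have hcongr : Real.circleAverage (fun ζ => herglotzRieszKernel 0 z ζ * ((k ζ).re : ℂ)) 0 1 =
      Real.circleAverage (fun ζ => ((ζ / (ζ - z)) • k ζ + (-(1 / 2) : ℂ) • k ζ) +
        (1 / 2 : ℂ) • (starRingEnd ℂ) (q ζ * k ζ)) 0 1 := by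
    refine Real.circleAverage_congr_sphere fun ζ hζ => ?_
    rw [abs_one] at hζ
    have hζ1 : ‖ζ‖ = 1 := by simpa using hζ
    have hζζ : ζ * (starRingEnd ℂ) ζ = 1 := by
      rw [Complex.mul_conj, Complex.normSq_eq_norm_sq, hζ1]; simp
    have hqc : (starRingEnd ℂ) (q ζ) = herglotzRieszKernel 0 z ζ := by
      rw [herglotzRieszKernel_zero]
      simp only [hq, map_div₀, map_add, map_sub, map_mul, map_one, Complex.conj_conj]
      have h1 : 1 - z * (starRingEnd ℂ) ζ ≠ 0 := by
        have := (map_ne_zero (starRingEnd ℂ)).2 (hden ζ (sphere_subset_closedBall hζ))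
        simpa using this
      rw [div_eq_div_iff h1 (hne ζ hζ)]
      linear_combination (2 * z) * hζζ
    simp only [smul_eq_mul]
    rw [map_mul, hqc, Complex.re_eq_add_conj, herglotzRieszKernel_zero]
    have := hne ζ hζ
    field_simp
    ring
  have i12 : CircleIntegrable (fun ζ => (ζ / (ζ - z)) • k ζ + (-(1 / 2) : ℂ) • k ζ) 0 1 :=
    i1.add i2
  rw [hcongr, Real.circleAverage_fun_add i12 i3, Real.circleAverage_fun_add i1 i2,
    Real.circleAverage_fun_smul, Real.circleAverage_fun_smul, a1, a2, a3]
  simp only [smul_eq_mul, mul_one]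
  exact neg_add_cancel_right (k z) (1 / 2)

lemma circleAverage_re_herglotzRieszKernel {a : ℂ} (ha : 1 < ‖a‖) :
    Real.circleAverage (fun ζ => (herglotzRieszKernel 0 ζ a).re) 0 1 = 1 := by
  have hkd := differentiableOn_herglotzRieszKernel_zero ha
  have h1 := Complex.reCLM.circleAverage_comp_comm (circleIntegrable_of_closedBall hkd)
  refine h1.trans ?_
  rw [(diffContOnCl_of_closedBall hkd).circleAverage,
    herglotzRieszKernel_at_zero (norm_pos_iff.1 (by linarith))]
  simp

/-! ### The functions are outer -/

namespace BeurlingCarlesonSet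

variable {E : BeurlingCarlesonSet}

lemma one_lt_norm_pole {ζ : ℂ} (hζ : ‖ζ‖ = 1) (hζE : ζ ∉ E.carrier) : 1 < ‖E.pole ζ‖ := by
  rw [norm_pole hζ]
  linarith [E.infDist_pos_iff.2 hζE]

/-- The boundary values of the real parts of the kernels, as a function of two variables. -/
def boundaryKernel (E : BeurlingCarlesonSet) (θ : ℝ) (η : ℂ) : ℝ :=
  (herglotzRieszKernel 0 (circleMap 0 1 θ) (E.pole η)).re * E.weight η

/-- The real parts of the kernels are non-negative on the circle with average 1, so integrating in θ
first leaves 2π times the integrable weight. -/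
lemma integrable_boundaryKernel :
    Integrable (Function.uncurry E.boundaryKernel)
      ((volume.restrict (uIoc 0 (2 * Real.pi))).prod arcLength) := by
  have hm : Measurable (Function.uncurry E.boundaryKernel) := by
    have h1 : Measurable fun p : ℝ × ℂ => circleMap 0 1 p.1 :=
      (measurable_circleMap 0 1).comp measurable_fst
    have h2 : Measurable fun p : ℝ × ℂ => E.pole p.2 := measurable_pole.comp measurable_snd
    have h3 : Function.uncurry E.boundaryKernel = fun p : ℝ × ℂ =>
        ((E.pole p.2 + circleMap 0 1 p.1) / (E.pole p.2 - circleMap 0 1 p.1)).re *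
          E.weight p.2 := by
      ext p
      simp only [Function.uncurry, boundaryKernel, herglotzRieszKernel_zero]
    rw [h3]
    exact (Complex.measurable_re.comp ((h2.add h1).div (h2.sub h1))).mul
      (measurable_weight.comp measurable_snd)
  rw [integrable_prod_iff' hm.aestronglyMeasurable]
  have hsec : ∀ η : ℂ, ‖η‖ = 1 → η ∉ E.carrier →
      CircleIntegrable (fun ζ => (herglotzRieszKernel 0 ζ (E.pole η)).re) 0 1 := fun η h1 h2 => by
    refine ContinuousOn.circleIntegrable zero_le_one ?_
    exact Complex.continuous_re.comp_continuousOn ((differentiableOn_herglotzRieszKernel_zero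
      (one_lt_norm_pole h1 h2)).continuousOn.mono sphere_subset_closedBall)
  constructor
  · filter_upwards [ae_norm_eq_one, E.ae_notMem_carrier] with η h1 h2
    exact (intervalIntegrable_iff.1 (hsec η h1 h2)).mul_const (E.weight η)
  · refine (E.integrable_weight.const_mul (2 * Real.pi)).congr ?_
    filter_upwards [ae_norm_eq_one, E.ae_notMem_carrier] with η h1 h2
    have h3 := circleAverage_re_herglotzRieszKernel (one_lt_norm_pole h1 h2)
    rw [Real.circleAverage_def, smul_eq_mul, inv_mul_eq_iff_eq_mul₀ (by positivity), mul_one,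
      intervalIntegral.integral_of_le Real.two_pi_pos.le] at h3
    rw [uIoc_of_le Real.two_pi_pos.le]
    refine (congrArg (· * E.weight η) h3).symm.trans ((integral_mul_const _ _).symm.trans ?_)
    refine integral_congr_ae (Eventually.of_forall fun θ => ?_)
    simp only [Function.uncurry]
    exact (Real.norm_of_nonneg
      (mul_nonneg (re_kernel_nonneg (by simp) h1) (weight_nonneg η))).symm

lemma ae_circleMap_notMem_carrier (E : BeurlingCarlesonSet) :
    ∀ᵐ θ ∂(volume.restrict (uIoc 0 (2 * Real.pi))), circleMap 0 1 θ ∉ E.carrier := by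
  rw [uIoc_of_le Real.two_pi_pos.le]
  have h := E.ae_notMem_carrier
  rw [arcLength] at h
  exact ae_of_ae_map (measurable_circleMap 0 1).aemeasurable h

lemma integral_boundaryKernel {θ : ℝ} (hθ : circleMap 0 1 θ ∉ E.carrier) :
    ∫ η, E.boundaryKernel θ η ∂arcLength = (E.herglotz (circleMap 0 1 θ)).re := by
  rw [re_herglotz (mem_region_of_mem_closedBall (by norm_num) (by simp) hθ)]
  rfl

lemma circleIntegrable_re_herglotz (E : BeurlingCarlesonSet) :
    CircleIntegrable (fun ζ => -(E.herglotz ζ).re) 0 1 := by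
  rw [CircleIntegrable, intervalIntegrable_iff]
  refine (integrable_boundaryKernel (E := E)).integral_prod_left.neg.congr ?_
  filter_upwards [E.ae_circleMap_notMem_carrier] with θ hθ
  rw [Pi.neg_apply, ← integral_boundaryKernel hθ]
  rfl

/-- A superposition of the single-pole Schwarz formula over the poles. Fubini applies because the
Herglotz kernel at a fixed z is bounded on the circle. -/
lemma circleAverage_herglotzRieszKernel_mul_re_herglotz {z : ℂ} (hz : z ∈ ball (0 : ℂ) 1) :
    Real.circleAverage (fun ζ => herglotzRieszKernel 0 z ζ * ((-(E.herglotz ζ).re : ℝ) : ℂ)) 0 1 =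
      -E.herglotz z := by
  obtain ⟨B, hB⟩ := (isCompact_sphere (0 : ℂ) 1).exists_bound_of_continuousOn
    (continuousOn_herglotzRieszKernel_unit_sphere hz)
  have hHm : Measurable fun p : ℝ × ℂ => herglotzRieszKernel 0 z (circleMap 0 1 p.1) := by
    simp only [herglotzRieszKernel_zero]
    have h1 : Measurable fun p : ℝ × ℂ => circleMap 0 1 p.1 :=
      (measurable_circleMap 0 1).comp measurable_fst
    exact (h1.add_const z).div (h1.sub_const z)
  have hint : Integrable (Function.uncurry fun θ η =>
      herglotzRieszKernel 0 z (circleMap 0 1 θ) * (E.boundaryKernel θ η : ℂ))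
      ((volume.restrict (uIoc 0 (2 * Real.pi))).prod arcLength) := by
    refine Integrable.bdd_mul (c := B) (integrable_boundaryKernel (E := E)).ofReal
      hHm.aestronglyMeasurable (Eventually.of_forall fun p => hB _ (by simp))
  have hswap := intervalIntegral_integral_swap hint
  calc Real.circleAverage (fun ζ => herglotzRieszKernel 0 z ζ * ((-(E.herglotz ζ).re : ℝ) : ℂ)) 0 1
      = (2 * Real.pi)⁻¹ • ∫ θ in (0 : ℝ)..2 * Real.pi,
          -(∫ η, herglotzRieszKernel 0 z (circleMap 0 1 θ) *
            (E.boundaryKernel θ η : ℂ) ∂arcLength) := by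
        rw [Real.circleAverage_def]
        congr 1
        refine intervalIntegral.integral_congr_ae ?_
        have := (ae_restrict_iff' measurableSet_uIoc).1 E.ae_circleMap_notMem_carrier
        filter_upwards [this] with θ hθ hθ'
        rw [integral_const_mul, ← integral_boundaryKernel (hθ hθ'), integral_complex_ofReal]
        push_cast
        ring
    _ = -∫ η, ((2 * Real.pi)⁻¹ • ∫ θ in (0 : ℝ)..2 * Real.pi,
          herglotzRieszKernel 0 z (circleMap 0 1 θ) * (E.boundaryKernel θ η : ℂ)) ∂arcLength := by
        rw [intervalIntegral.integral_neg, hswap, integral_smul, smul_neg]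
    _ = _ := by
        rw [herglotz]
        congr 1
        refine integral_congr_ae ?_
        filter_upwards [ae_norm_eq_one, E.ae_notMem_carrier] with η h1 h2
        rw [← circleAverage_herglotzRieszKernel_mul_re (one_lt_norm_pole h1 h2) hz,
          Real.circleAverage_def, smul_mul_assoc, ← intervalIntegral.integral_mul_const]
        simp only [boundaryKernel, Complex.ofReal_mul, mul_assoc]

lemma isOuter_outerFunction (E : BeurlingCarlesonSet) : IsOuter E.outerFunction := by
  refine ⟨1, fun ζ => -(E.herglotz ζ).re, norm_one, E.circleIntegrable_re_herglotz, fun z hz => ?_⟩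
  rw [circleAverage_herglotzRieszKernel_mul_re_herglotz hz, one_mul,
    outerFunction_of_notMem (notMem_of_mem_ball hz)]

/-! ### Continuous dependence of the outer functions on the set -/

/-- Changing E moves the poles, by at most the Hausdorff distance, and changes the weight, which is
controlled in L¹. All poles stay at distance at least 1 - r from z. -/
lemma norm_herglotz_sub_herglotz_le (E E' : BeurlingCarlesonSet) {r : ℝ} (hr : r < 1) {z : ℂ}
    (hz : z ∈ closedBall (0 : ℂ) r) :
    ‖E'.herglotz z - E.herglotz z‖ ≤
      4 / (1 - r) ^ 2 * dist E'.toNonemptyCompacts E.toNonemptyCompacts +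
        3 / (1 - r) * ∫ ζ, |E'.weight ζ - E.weight ζ| ∂arcLength := by
  have hzr : ‖z‖ ≤ r := by simpa using hz
  have hr0 : 0 < 1 - r := by linarith
  have hzb : z ∈ closedBall (0 : ℂ) 1 := by simpa using hzr.trans hr.le
  have hz1 : z ∈ ball (0 : ℂ) 1 := by simpa using hzr.trans_lt hr
  have hreg : ∀ E : BeurlingCarlesonSet, z ∈ E.region (1 / 8) := fun E =>
    mem_region_of_mem_closedBall (by norm_num) hzb (notMem_of_mem_ball hz1)
  set Δ := dist E'.toNonemptyCompacts E.toNonemptyCompacts with hΔ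
  have hfar : ∀ (E : BeurlingCarlesonSet) (ζ : ℂ), ‖ζ‖ = 1 → 1 - r ≤ ‖E.pole ζ - z‖ :=
    fun E ζ hζ => by
      have h1 := norm_sub_norm_le (E.pole ζ) z
      rw [norm_pole hζ] at h1
      linarith [infDist_nonneg (x := ζ) (s := E.carrier)]
  have heq : ∀ (E : BeurlingCarlesonSet) (ζ : ℂ), ‖ζ‖ = 1 →
      herglotzRieszKernel 0 z (E.pole ζ) = 1 + 2 * z / (E.pole ζ - z) := fun E ζ hζ => by
    have : E.pole ζ - z ≠ 0 := norm_pos_iff.1 (by linarith [hfar E ζ hζ])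
    rw [herglotzRieszKernel_zero]
    field_simp
    ring
  have hb : ∀ ζ : ℂ, ‖ζ‖ = 1 → ‖herglotzRieszKernel 0 z (E.pole ζ)‖ ≤ 3 / (1 - r) :=
    fun ζ hζ => by
      rw [heq E ζ hζ]
      have h1 := hfar E ζ hζ
      calc ‖1 + 2 * z / (E.pole ζ - z)‖ ≤ 1 + 2 * ‖z‖ / ‖E.pole ζ - z‖ := by
            refine (norm_add_le _ _).trans ?_
            rw [norm_one, norm_div, norm_mul, Complex.norm_ofNat]
        _ ≤ 1 + 2 * 1 / (1 - r) := by gcongr; exact hzr.trans hr.le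
        _ ≤ 3 / (1 - r) := by
            rw [le_div_iff₀ hr0, add_mul, div_mul_cancel₀ _ hr0.ne']
            linarith [norm_nonneg z]
  have hd : ∀ ζ : ℂ, ‖ζ‖ = 1 → ‖herglotzRieszKernel 0 z (E'.pole ζ) -
      herglotzRieszKernel 0 z (E.pole ζ)‖ ≤ 2 / (1 - r) ^ 2 * Δ := fun ζ hζ => by
    have h1 := hfar E ζ hζ
    have h2 := hfar E' ζ hζ
    have n1 : E.pole ζ - z ≠ 0 := norm_pos_iff.1 (by linarith)
    have n2 : E'.pole ζ - z ≠ 0 := norm_pos_iff.1 (by linarith)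
    have h3 : herglotzRieszKernel 0 z (E'.pole ζ) - herglotzRieszKernel 0 z (E.pole ζ) =
        2 * z * (E.pole ζ - E'.pole ζ) / ((E'.pole ζ - z) * (E.pole ζ - z)) := by
      rw [heq E ζ hζ, heq E' ζ hζ]
      field_simp
      ring
    have h4 : ‖E.pole ζ - E'.pole ζ‖ ≤ Δ := by
      have : E.pole ζ - E'.pole ζ = -(((infDist ζ E'.carrier - infDist ζ E.carrier : ℝ) : ℂ) * ζ) := by
        simp only [pole]; push_cast; ring
      rw [this, norm_neg, norm_mul, hζ, mul_one, Complex.norm_real]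
      exact abs_infDist_sub_infDist_le E E' ζ
    rw [h3, norm_div, norm_mul, norm_mul, norm_mul, Complex.norm_ofNat]
    calc 2 * ‖z‖ * ‖E.pole ζ - E'.pole ζ‖ / (‖E'.pole ζ - z‖ * ‖E.pole ζ - z‖)
        ≤ 2 * 1 * Δ / ((1 - r) * (1 - r)) := by gcongr; exact hzr.trans hr.le
      _ = _ := by ring
  have hsub : E'.herglotz z - E.herglotz z =
      ∫ ζ, (herglotzRieszKernel 0 z (E'.pole ζ) * (E'.weight ζ : ℂ) -
        herglotzRieszKernel 0 z (E.pole ζ) * (E.weight ζ : ℂ)) ∂arcLength :=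
    (integral_sub (integrable_kernel_mul_weight (hreg E'))
      (integrable_kernel_mul_weight (hreg E))).symm
  have hi1 : Integrable (fun ζ => 2 / (1 - r) ^ 2 * Δ * E'.weight ζ) arcLength :=
    E'.integrable_weight.const_mul _
  have hi2 : Integrable (fun ζ => 3 / (1 - r) * |E'.weight ζ - E.weight ζ|) arcLength :=
    (E'.integrable_weight.sub E.integrable_weight).abs.const_mul _
  rw [hsub]
  calc _ ≤ ∫ ζ, (2 / (1 - r) ^ 2 * Δ * E'.weight ζ +
          3 / (1 - r) * |E'.weight ζ - E.weight ζ|) ∂arcLength := by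
        refine norm_integral_le_of_norm_le (hi1.add hi2) ?_
        filter_upwards [ae_norm_eq_one] with ζ hζ
        have h1 : herglotzRieszKernel 0 z (E'.pole ζ) * (E'.weight ζ : ℂ) -
            herglotzRieszKernel 0 z (E.pole ζ) * (E.weight ζ : ℂ) =
            (herglotzRieszKernel 0 z (E'.pole ζ) - herglotzRieszKernel 0 z (E.pole ζ)) *
              (E'.weight ζ : ℂ) +
            herglotzRieszKernel 0 z (E.pole ζ) * ((E'.weight ζ - E.weight ζ : ℝ) : ℂ) := by
          push_cast; ring
        rw [h1]
        refine (norm_add_le _ _).trans (add_le_add ?_ ?_)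
        · rw [norm_mul, Complex.norm_real, Real.norm_of_nonneg (weight_nonneg ζ)]
          exact mul_le_mul_of_nonneg_right (hd ζ hζ) (weight_nonneg ζ)
        · rw [norm_mul, Complex.norm_real, Real.norm_eq_abs]
          exact mul_le_mul_of_nonneg_right (hb ζ hζ) (abs_nonneg _)
    _ = 2 / (1 - r) ^ 2 * Δ * ∫ ζ, E'.weight ζ ∂arcLength +
          3 / (1 - r) * ∫ ζ, |E'.weight ζ - E.weight ζ| ∂arcLength := by
        rw [integral_add hi1 hi2, integral_const_mul, integral_const_mul]
    _ ≤ 2 / (1 - r) ^ 2 * Δ * 2 +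
          3 / (1 - r) * ∫ ζ, |E'.weight ζ - E.weight ζ| ∂arcLength := by
        have := E'.integral_weight_le
        gcongr
    _ = _ := by ring

lemma norm_exp_neg_sub_exp_neg_le {x y : ℂ} (hy : 0 ≤ y.re) (h : ‖x - y‖ ≤ 1) :
    ‖Complex.exp (-x) - Complex.exp (-y)‖ ≤ 2 * ‖x - y‖ := by
  have h1 : Complex.exp (-x) - Complex.exp (-y) =
      Complex.exp (-y) * (Complex.exp (y - x) - 1) := by
    rw [mul_sub, ← Complex.exp_add, mul_one]
    congr 2
    ring
  have h2 : ‖Complex.exp (-y)‖ ≤ 1 := by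
    rw [Complex.norm_exp, Complex.neg_re]
    exact Real.exp_le_one_iff.2 (by linarith)
  rw [norm_sub_rev] at h
  rw [h1, norm_mul, norm_sub_rev x y]
  have h3 := Complex.norm_exp_sub_one_le h
  calc _ ≤ 1 * (2 * ‖y - x‖) := mul_le_mul h2 h3 (norm_nonneg _) zero_le_one
    _ = _ := one_mul _

lemma tendstoLocallyUniformlyOn_outerFunction (E : BeurlingCarlesonSet) :
    TendstoLocallyUniformlyOn outerFunction E.outerFunction (𝓝 E) (ball 0 1) := by
  rw [tendstoLocallyUniformlyOn_iff_forall_isCompact isOpen_ball]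
  intro S hS hSc
  obtain ⟨r, hr, hSr⟩ : ∃ r < (1 : ℝ), S ⊆ closedBall (0 : ℂ) r := by
    rcases S.eq_empty_or_nonempty with rfl | hne
    · exact ⟨0, by norm_num, empty_subset _⟩
    · obtain ⟨x, hx, hmax⟩ := hSc.exists_isMaxOn hne continuous_norm.continuousOn
      exact ⟨‖x‖, by simpa using hS hx, fun y hy => by simpa using hmax hy⟩
  have hlim : Tendsto (fun E' : BeurlingCarlesonSet =>
      4 / (1 - r) ^ 2 * dist E'.toNonemptyCompacts E.toNonemptyCompacts +
        3 / (1 - r) * ∫ ζ, |E'.weight ζ - E.weight ζ| ∂arcLength) (𝓝 E)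
      (𝓝 (4 / (1 - r) ^ 2 * 0 + 3 / (1 - r) * 0)) := by
    refine Tendsto.add (Tendsto.const_mul _ ?_) (tendsto_integral_abs_weight_sub.const_mul _)
    have := (continuous_toNonemptyCompacts.tendsto E).dist
      (tendsto_const_nhds (x := E.toNonemptyCompacts))
    rwa [dist_self] at this
  simp only [mul_zero, add_zero] at hlim
  rw [Metric.tendstoUniformlyOn_iff]
  intro ε hε
  have hmin : 0 < min 1 (ε / 2) := lt_min one_pos (by linarith)
  filter_upwards [hlim.eventually_lt_const hmin] with E' hE' z hz
  have h1 := (norm_herglotz_sub_herglotz_le E E' hr (hSr hz)).trans_lt hE'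
  have hzb := hS hz
  rw [dist_comm, dist_eq_norm, outerFunction_of_notMem (notMem_of_mem_ball hzb),
    outerFunction_of_notMem (notMem_of_mem_ball hzb)]
  refine (norm_exp_neg_sub_exp_neg_le (re_herglotz_nonneg (ball_subset_closedBall hzb)
    (notMem_of_mem_ball hzb)) (h1.le.trans (min_le_left _ _))).trans_lt ?_
  linarith [min_le_right 1 (ε / 2)]

end BeurlingCarlesonSet

namespace BeurlingCarlesonSet

variable {E : BeurlingCarlesonSet}

/-! ### Smoothness of the outer functions up to the boundary -/

lemma region_mono {ε ε' : ℝ} (h : ε ≤ ε') : E.region ε ⊆ E.region ε' := fun _ hz =>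
  lt_of_lt_of_le hz (add_le_add le_rfl (mul_le_mul_of_nonneg_right h infDist_nonneg))

/-- Holomorphic functions near the closed disk minus `E`, growing at most like a power of the
reciprocal of the distance to `E`. -/
def HasPowerGrowth (E : BeurlingCarlesonSet) (q : ℂ → ℂ) : Prop :=
  DifferentiableOn ℂ q (E.region (1 / 8)) ∧
    ∃ (ε C : ℝ) (m : ℕ), 0 < ε ∧ ε ≤ 1 / 8 ∧
      ∀ z ∈ E.region ε, ‖q z‖ * infDist z E.carrier ^ m ≤ C

lemma hasPowerGrowth_const (E : BeurlingCarlesonSet) (c : ℂ) : E.HasPowerGrowth fun _ => c :=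
  ⟨differentiableOn_const c, 1 / 8, ‖c‖, 0, by norm_num, le_rfl, fun z _ => by simp⟩

lemma hasPowerGrowth_herglotz (E : BeurlingCarlesonSet) : E.HasPowerGrowth E.herglotz := by
  refine ⟨differentiableOn_herglotz, 1 / 8, 40, 1, by norm_num, le_rfl, fun z hz => ?_⟩
  rw [pow_one, ← le_div_iff₀ (E.infDist_pos_iff.2 (notMem_of_mem_region hz))]
  exact norm_herglotz_le hz

lemma HasPowerGrowth.mul {q₁ q₂ : ℂ → ℂ} (h₁ : E.HasPowerGrowth q₁) (h₂ : E.HasPowerGrowth q₂) :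
    E.HasPowerGrowth fun z => q₁ z * q₂ z := by
  obtain ⟨d₁, ε₁, C₁, m₁, hε₁, hε₁', b₁⟩ := h₁
  obtain ⟨d₂, ε₂, C₂, m₂, hε₂, hε₂', b₂⟩ := h₂
  refine ⟨d₁.mul d₂, min ε₁ ε₂, C₁ * C₂, m₁ + m₂, lt_min hε₁ hε₂,
    (min_le_left _ _).trans hε₁', fun z hz => ?_⟩
  have h₁ := b₁ z (region_mono (min_le_left _ _) hz)
  have h₂ := b₂ z (region_mono (min_le_right _ _) hz)
  have hD := infDist_nonneg (x := z) (s := E.carrier)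
  rw [norm_mul, pow_add, mul_mul_mul_comm]
  exact mul_le_mul h₁ h₂ (by positivity) (le_trans (by positivity) h₁)

lemma HasPowerGrowth.sub {q₁ q₂ : ℂ → ℂ} (h₁ : E.HasPowerGrowth q₁) (h₂ : E.HasPowerGrowth q₂) :
    E.HasPowerGrowth fun z => q₁ z - q₂ z := by
  obtain ⟨d₁, ε₁, C₁, m₁, hε₁, hε₁', b₁⟩ := h₁
  obtain ⟨d₂, ε₂, C₂, m₂, hε₂, hε₂', b₂⟩ := h₂
  refine ⟨d₁.sub d₂, min ε₁ ε₂, C₁ * 3 ^ m₂ + C₂ * 3 ^ m₁, m₁ + m₂, lt_min hε₁ hε₂,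
    (min_le_left _ _).trans hε₁', fun z hz => ?_⟩
  have h₁ := b₁ z (region_mono (min_le_left _ _) hz)
  have h₂ := b₂ z (region_mono (min_le_right _ _) hz)
  have hD := infDist_nonneg (x := z) (s := E.carrier)
  have hD3 : infDist z E.carrier ≤ 3 := by
    have := norm_lt_two_of_mem_region (region_mono ((min_le_left _ _).trans hε₁') hz)
    linarith [E.infDist_le_norm_add_one z]
  calc ‖q₁ z - q₂ z‖ * infDist z E.carrier ^ (m₁ + m₂)
      ≤ (‖q₁ z‖ + ‖q₂ z‖) * infDist z E.carrier ^ (m₁ + m₂) := by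
        gcongr
        exact norm_sub_le _ _
    _ = (‖q₁ z‖ * infDist z E.carrier ^ m₁) * infDist z E.carrier ^ m₂ +
          (‖q₂ z‖ * infDist z E.carrier ^ m₂) * infDist z E.carrier ^ m₁ := by ring
    _ ≤ _ := by
        have c₁ : 0 ≤ C₁ := le_trans (by positivity) h₁
        have c₂ : 0 ≤ C₂ := le_trans (by positivity) h₂
        gcongr

/-- Cauchy's estimate on the disk of radius εD/4, along which the distance to E stays above D/2. The
region of the bound shrinks from ε to ε/4, which is why ε is existential in the definition. -/
lemma HasPowerGrowth.deriv {q : ℂ → ℂ} (h : E.HasPowerGrowth q) :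
    E.HasPowerGrowth (deriv q) := by
  obtain ⟨d, ε, C, m, hε, hε', b⟩ := h
  refine ⟨d.deriv (E.isOpen_region _), ε / 4, C * 2 ^ m * (4 / ε), m + 1, by positivity,
    by linarith, fun z hz => ?_⟩
  set D := infDist z E.carrier with hD
  have hD0 : 0 < D := E.infDist_pos_iff.2 (notMem_of_mem_region hz)
  have hr : 0 < ε * D / 4 := by positivity
  have hz' : ‖z‖ < 1 + ε / 4 * D := hz
  have key : ∀ w ∈ closedBall z (ε * D / 4), w ∈ E.region ε ∧ D / 2 ≤ infDist w E.carrier :=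
    fun w hw => by
      rw [mem_closedBall] at hw
      have h1 : D ≤ infDist w E.carrier + dist w z := by
        rw [dist_comm]
        exact infDist_le_infDist_add_dist
      have h2 : D / 2 ≤ infDist w E.carrier := by nlinarith
      refine ⟨?_, h2⟩
      have h3 : ‖w‖ ≤ ‖z‖ + dist w z := by
        rw [dist_eq_norm, add_comm]
        exact norm_le_norm_sub_add w z
      change ‖w‖ < 1 + ε * infDist w E.carrier
      nlinarith [mul_le_mul_of_nonneg_left h2 hε.le]
  have hdc : DiffContOnCl ℂ q (ball z (ε * D / 4)) := by
    refine DifferentiableOn.diffContOnCl ?_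
    rw [closure_ball z hr.ne']
    exact d.mono fun w hw => region_mono hε' (key w hw).1
  have hbd : ∀ w ∈ sphere z (ε * D / 4), ‖q w‖ ≤ C * 2 ^ m / D ^ m := fun w hw => by
    obtain ⟨h1, h2⟩ := key w (sphere_subset_closedBall hw)
    rw [le_div_iff₀ (by positivity)]
    calc ‖q w‖ * D ^ m = ‖q w‖ * (D / 2) ^ m * 2 ^ m := by
          rw [mul_assoc, ← mul_pow, div_mul_cancel₀ _ two_ne_zero]
      _ ≤ ‖q w‖ * infDist w E.carrier ^ m * 2 ^ m := by gcongr
      _ ≤ C * 2 ^ m := by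
          gcongr
          exact b w h1
  have := Complex.norm_deriv_le_of_forall_mem_sphere_norm_le hr hdc hbd
  calc ‖_root_.deriv q z‖ * D ^ (m + 1) ≤ C * 2 ^ m / D ^ m / (ε * D / 4) * D ^ (m + 1) := by
        gcongr
    _ = C * 2 ^ m * (4 / ε) := by
        rw [pow_succ]
        field_simp

/-- Off E this is the product rule. At a point of E, decay of order m + 2 beats growth of order m,
so the product is O(|w - z|²) and its derivative is 0, as the formula predicts. -/
lemma HasPowerGrowth.hasDerivWithinAt_mul_outerFunction {q : ℂ → ℂ} (h : E.HasPowerGrowth q)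
    {z : ℂ} (hz : z ∈ closedBall (0 : ℂ) 1) :
    HasDerivWithinAt (fun w => q w * E.outerFunction w)
      ((_root_.deriv q z - _root_.deriv E.herglotz z * q z) * E.outerFunction z) (closedBall 0 1) z := by
  by_cases hzE : z ∈ E.carrier
  · obtain ⟨d, ε, C, m, hε, hε', b⟩ := h
    rw [outerFunction_of_mem hzE, mul_zero, hasDerivWithinAt_iff_isLittleO]
    simp only [outerFunction_of_mem hzE, mul_zero, sub_zero, smul_zero]
    have hbig : (fun w => q w * E.outerFunction w) =O[𝓝[closedBall 0 1] z]
        fun w => (w - z) ^ 2 := by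
      refine Asymptotics.IsBigO.of_bound (|C| * decayConstant (m + 2) E) ?_
      filter_upwards [self_mem_nhdsWithin] with w hw
      have hK : 0 < decayConstant (m + 2) E := Real.exp_pos _
      by_cases hwE : w ∈ E.carrier
      · rw [outerFunction_of_mem hwE, mul_zero, norm_zero]
        positivity
      · have h1 := b w (mem_region_of_mem_closedBall hε hw hwE)
        have h2 := norm_outerFunction_le (m + 2) hw hwE
        have h3 : infDist w E.carrier ≤ ‖w - z‖ := by
          rw [← dist_eq_norm]
          exact infDist_le_dist_of_mem hzE
        have hD := infDist_nonneg (x := w) (s := E.carrier)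
        rw [norm_mul, norm_pow]
        calc ‖q w‖ * ‖E.outerFunction w‖
            ≤ ‖q w‖ * (decayConstant (m + 2) E * infDist w E.carrier ^ (m + 2)) := by gcongr
          _ = (‖q w‖ * infDist w E.carrier ^ m) * decayConstant (m + 2) E *
                infDist w E.carrier ^ 2 := by ring
          _ ≤ |C| * decayConstant (m + 2) E * ‖w - z‖ ^ 2 := by
              gcongr
              exact h1.trans (le_abs_self C)
    refine hbig.trans_isLittleO ?_
    have h2 : (fun w : ℂ => w - z) =o[𝓝[closedBall 0 1] z] fun _ => (1 : ℂ) := by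
      rw [Asymptotics.isLittleO_one_iff]
      refine Tendsto.mono_left ?_ nhdsWithin_le_nhds
      have : Continuous fun w : ℂ => w - z := by fun_prop
      simpa using this.tendsto z
    simpa [pow_two] using h2.mul_isBigO (Asymptotics.isBigO_refl (fun w : ℂ => w - z) _)
  · have hreg : E.region (1 / 8) ∈ 𝓝 z := (E.isOpen_region _).mem_nhds
      (mem_region_of_mem_closedBall (by norm_num) hz hzE)
    have hq := (h.1.differentiableAt hreg).hasDerivAt
    have hH := (differentiableOn_herglotz.differentiableAt hreg).hasDerivAt
    have hd := hq.mul hH.neg.cexp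
    have heq : (fun w => q w * E.outerFunction w) =ᶠ[𝓝 z]
        fun w => q w * Complex.exp (-E.herglotz w) := by
      filter_upwards [hreg] with w hw
      rw [outerFunction_of_notMem (notMem_of_mem_region hw)]
    refine ((hd.congr_of_eventuallyEq heq).congr_deriv ?_).hasDerivWithinAt
    rw [outerFunction_of_notMem hzE, Pi.neg_apply]
    ring

/-- With H the Herglotz integral, q of power growth gives q' - H'q of power growth, so the products
with the outer function form a class stable under differentiation. -/
lemma HasPowerGrowth.contDiffOn_mul_outerFunction (n : ℕ) {q : ℂ → ℂ} (h : E.HasPowerGrowth q) :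
    ContDiffOn ℂ n (fun w => q w * E.outerFunction w) (closedBall 0 1) := by
  have hu : UniqueDiffOn ℂ (closedBall (0 : ℂ) 1) := by
    refine uniqueDiffOn_convex_of_isRCLikeNormedField (convex_closedBall 0 1) ?_
    rw [interior_closedBall (0 : ℂ) one_ne_zero]
    exact nonempty_ball.2 one_pos
  induction n generalizing q with
  | zero =>
    exact contDiffOn_zero.2 fun z hz =>
      (h.hasDerivWithinAt_mul_outerFunction hz).continuousWithinAt
  | succ n ih =>
    push_cast
    refine (contDiffOn_succ_iff_derivWithin hu).2 ⟨fun z hz =>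
      (h.hasDerivWithinAt_mul_outerFunction hz).differentiableWithinAt, by simp, ?_⟩
    exact (ih (h.deriv.sub (E.hasPowerGrowth_herglotz.deriv.mul h))).congr fun z hz =>
      (h.hasDerivWithinAt_mul_outerFunction hz).derivWithin (hu z hz)

lemma contDiffOn_outerFunction (E : BeurlingCarlesonSet) :
    ContDiffOn ℝ (⊤ : ℕ∞) E.outerFunction (closedBall 0 1) := by
  refine contDiffOn_infty.2 fun n => ContDiffOn.restrict_scalars ℝ (𝕜' := ℂ) ?_
  simpa using (E.hasPowerGrowth_const 1).contDiffOn_mul_outerFunction n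

lemma isCarlesonFamily_outerFunction : IsCarlesonFamily fun E => E.outerFunction where
  isOuter := isOuter_outerFunction
  smooth := contDiffOn_outerFunction
  eq_zero_iff E z _ := outerFunction_eq_zero_iff z
  tendsto := tendstoLocallyUniformlyOn_outerFunction
  decay := ⟨decayConstant, continuous_decayConstant, fun E => by simp [decayConstant],
    fun N E z hz => norm_outerFunction_le N (ball_subset_closedBall hz) (notMem_of_mem_ball hz)⟩

end BeurlingCarlesonSet

end

theorem theorem5p2 :
    (∃ Φ : BeurlingCarlesonSet → ℂ → ℂ, IsCarlesonFamily Φ) ∧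
    ∀ Φ : BeurlingCarlesonSet → ℂ → ℂ, IsCarlesonFamily Φ →
    ∀ p α : ℝ, 1 ≤ p → -1 < α →
    ∃ C : BeurlingCarlesonSet → ℝ → ℝ → ℝ,
      ContinuousOn (fun q : BeurlingCarlesonSet × ℝ × ℝ => C q.1 q.2.1 q.2.2)
        (univ ×ˢ (Ioi 0 ×ˢ Ici 0)) ∧
      ∀ (E : BeurlingCarlesonSet) (I : ℂ → ℂ) (μ : Measure ℂ) (f : ℂ → ℂ) (δ : ℝ),
        IsInner I → HasZeroStructure I μ → μ.support ⊆ E.korenblumStar →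
        MemInvariantSubspace p α I f → 0 < δ →
        -- `exp (δ * L)` is the power `Φ_E ^ δ`, formed with a holomorphic logarithm `L` of `Φ_E`
        ∀ L : ℂ → ℂ, DifferentiableOn ℂ L (ball 0 1) →
          (∀ z ∈ ball (0 : ℂ) 1, Complex.exp (L z) = Φ E z) →
          ∃ g : ℂ → ℂ, MemBergman p α g ∧
            (∀ z ∈ ball (0 : ℂ) 1, I z * g z = Complex.exp (δ * L z) * f z) ∧
            bergmanNorm p α g ≤
              ENNReal.ofReal (C E δ (μ.real (closedBall 0 1))) * bergmanNorm p α f :=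
  ⟨⟨_, BeurlingCarlesonSet.isCarlesonFamily_outerFunction⟩,
    fun _ hΦ _ _ hp hα => hΦ.exists_division hp hα⟩
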